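/- A plane tropical curve is a finite graph $C$ embedded in $\mathbb{R}^2$ with straight (bounded or unbounded) edges of rational slope, together with positive integer weights on its edges, such that at every vertex the weighted sum of the outgoing primitive integral edge directions is zero. It is smooth of degree $d$ if it is dual to a unimodular triangulation of the triangle with vertices $(0,0),(d,0),(0,d)$, i.e. a triangulation into lattice triangles of area $\tfrac12$. Here duality means that vertices and edges of $C$ correspond bijectively to triangles and sides of the triangulation with incidences reversed, that the edge direction leaving a vertex is the outer normal direction of the dual side of the dual triangle, and that the weight of an edge is the lattice length of its dual side. The skeleton $\Gamma$ of $C$ is the graph obtained by contracting the leaf edges (including the unbounded edges) until none is left, regarded as a metric graph in which each edge has its lattice length: a segment from $p$ to $p+\ell n$ with $n\in\mathbb{Z}^2$ primitive and $\ell>0$ has length $\ell$. A divisor on a metric graph $\Gamma$ is a finite formal $\mathbb{Z}$-linear combination of points of $\Gamma$; its degree is the sum of its coefficients, and it is effective if all its coefficients are non-negative. A rational function on $\Gamma$ is a continuous piecewise linear function $f:\Gamma\to\mathbb{R}$ with integer slopes, and $\operatorname{div}(f)$ is the divisor whose coefficient at $p$ is the sum of the outgoing slopes of $f$ at $p$.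 Divisors $D,D'$ are linearly equivalent if $D-D'=\operatorname{div}(f)$ for some rational function $f$. A divisor $D$ has rank $r$ if $r$ is the largest integer such that for every effective divisor $E$ of degree $r$ the divisor $D-E$ is linearly equivalent to an effective divisor. The metric graph $\Gamma$ is hyperelliptic if it has a divisor of degree $2$ and rank $1$. **Theorem.** Let $C$ be a smooth plane tropical curve of degree $4$. Then its skeleton $\Gamma$ is not hyperelliptic: no divisor on $\Gamma$ of degree $2$ has rank $1$. -/

import Mathlib

open Set
open scoped Classical

noncomputable section

/-! ### Metric graphs and their divisor theory -/

/-- A (finite, compact) metric graph, presented by a finite multigraph (loops and multiple edges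
allowed) with positive edge lengths. The edge `e` is a copy of the segment `[0, len e]`, glued at
`0` to `src e` and at `len e` to `tgt e`. -/
structure MetricGraph where
  V : Type
  E : Type
  finV : Finite V
  finE : Fintype E
  src : E → V
  tgt : E → V
  len : E → ℝ
  len_pos : ∀ e, 0 < len e

namespace MetricGraph

attribute [instance] MetricGraph.finV MetricGraph.finE

/-- The points of the metric graph: its vertices and the interior points of its edges. -/
inductive Point (Γ : MetricGraph) : Type
  | vertex (v : Γ.V) : Point Γ
  | inner (e : Γ.E) (t : ℝ) (ht : t ∈ Ioo 0 (Γ.len e)) : Point Γ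

variable (Γ : MetricGraph)

/-- The point at distance `t` from the start of the edge `e`, for `t ∈ [0, len e]`
(outside this interval the value is the nearer end). -/
def pt (e : Γ.E) (t : ℝ) : Γ.Point :=
  if ht : t ∈ Ioo 0 (Γ.len e) then Point.inner e t ht
  else if t ≤ 0 then Point.vertex (Γ.src e) else Point.vertex (Γ.tgt e)

/-- A divisor is an element of the free abelian group on the points of the graph. -/
abbrev Divisor : Type := Γ.Point →₀ ℤ

variable {Γ}

/-- The degree of a divisor: the sum of its coefficients. -/
def degree (D : Γ.Divisor) : ℤ := D.sum fun _ a => a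

/-- A divisor is effective if all its coefficients are non-negative. -/
def IsEffective (D : Γ.Divisor) : Prop := ∀ p, 0 ≤ D p

/-- A rational function: on every (closed) edge `f` is piecewise linear with integer slopes.
There are finitely many break points on the edge, and on every closed subinterval without a
break point in its interior `f` is affine with an integer slope; this includes continuity of `f`
along every edge up to its ends, hence continuity on the graph. -/
def IsRational (f : Γ.Point → ℝ) : Prop :=
  ∀ e : Γ.E, ∃ S : Finset ℝ, ∀ a b : ℝ, 0 ≤ a → a < b → b ≤ Γ.len e → (∀ s ∈ S, s ∉ Ioo a b) →
    ∃ m : ℤ, ∀ t ∈ Icc a b, f (Γ.pt e t) = f (Γ.pt e a) + m * (t - a)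

/-- The slope at `0` of a function on `[0, ∞)` (its right derivative). -/
def slopeAtZero (g : ℝ → ℝ) : ℝ := derivWithin g (Ici 0) 0

/-- The coefficient of `div f` at a point: the sum of the outgoing slopes of `f` there. A loop
contributes to its vertex with both of its ends. -/
def ord (f : Γ.Point → ℝ) : Γ.Point → ℝ
  | Point.vertex v => ∑ e : Γ.E,
      ((if Γ.src e = v then slopeAtZero (fun s => f (Γ.pt e s)) else 0) +
        (if Γ.tgt e = v then slopeAtZero (fun s => f (Γ.pt e (Γ.len e - s))) else 0))
  | Point.inner e t _ =>
      slopeAtZero (fun s => f (Γ.pt e (t + s))) + slopeAtZero (fun s => f (Γ.pt e (t - s)))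

/-- Linear equivalence: `D - D' = div f` for some rational function `f`. -/
def LinearEquiv (D D' : Γ.Divisor) : Prop :=
  ∃ f : Γ.Point → ℝ, IsRational f ∧ ∀ p, (((D - D') p : ℤ) : ℝ) = ord f p

/-- For every effective divisor `E` of degree `r`, the divisor `D - E` is linearly equivalent to
an effective divisor. -/
def RankAtLeast (D : Γ.Divisor) (r : ℕ) : Prop :=
  ∀ E : Γ.Divisor, IsEffective E → degree E = r →
    ∃ D' : Γ.Divisor, IsEffective D' ∧ LinearEquiv (D - E) D'

/-- `D` has rank `r`: `r` is the largest integer with the above property. -/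
def HasRank (D : Γ.Divisor) (r : ℕ) : Prop :=
  RankAtLeast D r ∧ ∀ r' : ℕ, r < r' → ¬ RankAtLeast D r'

variable (Γ)

/-- A metric graph is hyperelliptic if it has a divisor of degree `2` and rank `1`. -/
def IsHyperelliptic : Prop := ∃ D : Γ.Divisor, degree D = 2 ∧ HasRank D 1

end MetricGraph

/-! ### Plane tropical curves -/

/-- The inclusion of the lattice `ℤ²` in the plane `ℝ²`. -/
def latticeToPlane (n : ℤ × ℤ) : ℝ × ℝ := ((n.1 : ℝ), (n.2 : ℝ))

/-- A plane tropical curve: a finite graph embedded in `ℝ²` with straight edges, which are bounded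
(`E`) or unbounded (`R`), all of rational slope, with positive integer weights, and balanced at
every vertex. The bounded edge `e` is the segment from `pos (src e)` to
`pos (tgt e) = pos (src e) + len e • dir e` with `dir e` a primitive integral vector, so that
`len e` is the lattice length of `e`. -/
structure PlaneTropicalCurve where
  V : Type
  E : Type
  R : Type
  finV : Fintype V
  finE : Fintype E
  finR : Fintype R
  pos : V → ℝ × ℝ
  src : E → V
  tgt : E → V
  dir : E → ℤ × ℤ
  len : E → ℝ
  base : R → V
  rdir : R → ℤ × ℤ
  weight : E → ℕ
  rweight : R → ℕ
  dir_primitive : ∀ e, Int.gcd (dir e).1 (dir e).2 = 1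
  rdir_primitive : ∀ r, Int.gcd (rdir r).1 (rdir r).2 = 1
  len_pos : ∀ e, 0 < len e
  pos_tgt : ∀ e, pos (tgt e) = pos (src e) + len e • latticeToPlane (dir e)
  weight_pos : ∀ e, 0 < weight e
  rweight_pos : ∀ r, 0 < rweight r
  /-- Planarity: the vertices and the relatively open edges are pairwise disjoint. -/
  pos_injective : Function.Injective pos
  planar : Pairwise fun c c' : V ⊕ E ⊕ R => Disjoint
    (Sum.elim (fun v => {pos v})
      (Sum.elim (fun e => (fun s : ℝ => pos (src e) + s • latticeToPlane (dir e)) '' Ioo 0 (len e))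
        (fun r => (fun s : ℝ => pos (base r) + s • latticeToPlane (rdir r)) '' Ioi 0)) c :
      Set (ℝ × ℝ))
    (Sum.elim (fun v => {pos v})
      (Sum.elim (fun e => (fun s : ℝ => pos (src e) + s • latticeToPlane (dir e)) '' Ioo 0 (len e))
        (fun r => (fun s : ℝ => pos (base r) + s • latticeToPlane (rdir r)) '' Ioi 0)) c')
  /-- Balancing: the weighted sum of the outgoing primitive vectors at a vertex vanishes. -/
  balanced : ∀ v,
    (∑ e : E, if src e = v then (weight e : ℤ) • dir e else 0) +
      (∑ e : E, if tgt e = v then (weight e : ℤ) • (-dir e) else 0) +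
      (∑ r : R, if base r = v then (rweight r : ℤ) • rdir r else 0) = 0

/-- `T` is a unimodular triangulation of the triangle with vertices `(0,0)`, `(d,0)`, `(0,d)`.
A triangle is given by the set of its three vertices. -/
structure IsUnimodularTriangulation (d : ℕ) (T : Finset (Finset (ℤ × ℤ))) : Prop where
  /-- Every triangle is a lattice triangle of area `1/2`. -/
  unimodular : ∀ t ∈ T, ∃ p q r : ℤ × ℤ, t = {p, q, r} ∧
    |(q.1 - p.1) * (r.2 - p.2) - (q.2 - p.2) * (r.1 - p.1)| = 1
  /-- Two triangles meet in a common face (possibly empty). -/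
  inter : ∀ t ∈ T, ∀ t' ∈ T,
    convexHull ℝ (latticeToPlane '' (t : Set (ℤ × ℤ))) ∩
        convexHull ℝ (latticeToPlane '' (t' : Set (ℤ × ℤ))) =
      convexHull ℝ (latticeToPlane '' ((t ∩ t' : Finset (ℤ × ℤ)) : Set (ℤ × ℤ)))
  /-- The triangles cover exactly the big triangle. -/
  cover : (⋃ t ∈ T, convexHull ℝ (latticeToPlane '' (t : Set (ℤ × ℤ)))) =
    convexHull ℝ {((0 : ℝ), (0 : ℝ)), ((d : ℝ), (0 : ℝ)), ((0 : ℝ), (d : ℝ))}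

/-- `s` is the set of vertices of `t` at which the linear form `n` is maximal on `t`: the face of
`t` with outer normal `n`. -/
def IsOuterFace (n : ℤ × ℤ) (s t : Finset (ℤ × ℤ)) : Prop :=
  ∀ q, q ∈ s ↔ q ∈ t ∧ ∀ r ∈ t, n.1 * r.1 + n.2 * r.2 ≤ n.1 * q.1 + n.2 * q.2

namespace PlaneTropicalCurve

attribute [instance] PlaneTropicalCurve.finV PlaneTropicalCurve.finE PlaneTropicalCurve.finR

/-- A duality between a plane tropical curve and a triangulation: the vertices of the curve
correspond to the triangles and its edges to the sides of the triangles, bijectively and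
reversing incidence (so bounded edges correspond to sides of two triangles, and unbounded edges
to sides of one triangle only). An edge leaving a vertex points in the direction of the outer
normal of the dual side of the dual triangle, and its weight is the lattice length of that side. -/
structure Duality (C : PlaneTropicalCurve) (T : Finset (Finset (ℤ × ℤ))) where
  tri : C.V ≃ {t : Finset (ℤ × ℤ) // t ∈ T}
  side : C.E ⊕ C.R ≃ {s : Finset (ℤ × ℤ) // s.card = 2 ∧ ∃ t ∈ T, s ⊆ t}
  incident_edge : ∀ (e : C.E) (v : C.V),
    (side (Sum.inl e)).1 ⊆ (tri v).1 ↔ v = C.src e ∨ v = C.tgt e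
  incident_ray : ∀ (r : C.R) (v : C.V), (side (Sum.inr r)).1 ⊆ (tri v).1 ↔ v = C.base r
  normal_src : ∀ e, IsOuterFace (C.dir e) (side (Sum.inl e)).1 (tri (C.src e)).1
  normal_tgt : ∀ e, IsOuterFace (-C.dir e) (side (Sum.inl e)).1 (tri (C.tgt e)).1
  normal_ray : ∀ r, IsOuterFace (C.rdir r) (side (Sum.inr r)).1 (tri (C.base r)).1
  weight_edge : ∀ e, ∀ p ∈ (side (Sum.inl e)).1, ∀ q ∈ (side (Sum.inl e)).1, p ≠ q →
    Int.gcd (p.1 - q.1) (p.2 - q.2) = C.weight e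
  weight_ray : ∀ r, ∀ p ∈ (side (Sum.inr r)).1, ∀ q ∈ (side (Sum.inr r)).1, p ≠ q →
    Int.gcd (p.1 - q.1) (p.2 - q.2) = C.rweight r

/-- A plane tropical curve is smooth of degree `d` if it is dual to a unimodular triangulation of
the triangle with vertices `(0,0)`, `(d,0)`, `(0,d)`. -/
def IsSmoothOfDegree (C : PlaneTropicalCurve) (d : ℕ) : Prop :=
  ∃ T : Finset (Finset (ℤ × ℤ)), IsUnimodularTriangulation d T ∧ Nonempty (C.Duality T)

variable (C : PlaneTropicalCurve)

/-- A set of bounded edges whose union has no leaf edge: each end of each of its edges is also an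
end of another one of its edges. -/
def IsLeafless (S : Set C.E) : Prop :=
  ∀ e ∈ S, (∃ e' ∈ S, e' ≠ e ∧ (C.src e' = C.src e ∨ C.tgt e' = C.src e)) ∧
    (∃ e' ∈ S, e' ≠ e ∧ (C.src e' = C.tgt e ∨ C.tgt e' = C.tgt e))

/-- The edges that survive when all leaf edges (the unbounded ones to begin with) are contracted,
until there is none left: they form the largest leafless set of bounded edges. -/
def skeletonEdges : Set C.E := ⋃₀ {S | C.IsLeafless S}

/-- The skeleton of a plane tropical curve (with at least one cycle), as a metric graph: the length
of an edge is its lattice length. -/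
def skeleton : MetricGraph where
  V := {v : C.V // ∃ e ∈ C.skeletonEdges, C.src e = v ∨ C.tgt e = v}
  E := C.skeletonEdges
  finV := inferInstance
  finE := Fintype.ofFinite _
  src e := ⟨C.src e.1, e.1, e.2, Or.inl rfl⟩
  tgt e := ⟨C.tgt e.1, e.1, e.2, Or.inr rfl⟩
  len e := C.len e.1
  len_pos e := C.len_pos e.1

end PlaneTropicalCurve

end

/-!
A divisor `D` of degree `2` and rank at least `1` defines a pencil: every point `P` of the skeleton
has a partner `Q` with `D ∼ P + Q`. The proof moves two chips from the cycle of one interior lattice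
point of the dual triangulation to that of another one within this pencil, and derives a
contradiction from the way in which the cycle between them is embedded in the plane.

*The dual graph.* Everything is expressed by the triangulation, through the structure `DualGraph`:
vertices are labelled by triangles and edges by sides, and after a quarter turn each edge is a
multiple of its dual side. The three interior lattice points `(1,1)`, `(2,1)`, `(1,2)` carry cycles
of the graph, their cells, with unit circulations `cellFlow`. By considering the triangles at the
midpoints between the interior points, and up to the rotational symmetry of the big triangle, the
cell of `(1,1)` may be assumed to be connected to each of the other two, by a common edge or by a
bridge dual to `(1,0) (2,2)` or to `(0,1) (2,2)` (`DualGraph.exists_isCentral`). The chord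
dual to a bridge of the skeleton must have interior lattice points on both sides, which leaves six
chords (`DualGraph.core_chord_mem`), and all but these two cross one of the given connections
(`DualGraph.IsCentral.core_chord_mem`).

*Rational functions.* For a function with prescribed divisor the slopes form a flow along the edges
with sources at the chips, and the increments of the function add up to zero around cycles, hence
against every circulation (`DualGraph.IsCirculation.sum_mul_sub_eq_zero`). If the chips move by less
than the edge lengths only, the slope flow is a circulation, and its pairing with the increments is
a sum of non-negative terms, so it vanishes. With the pigeonhole principle this shows that the
partner of a suitable point on an edge lies on an edge of the same cells
(`DualGraph.exists_partner`). So there are two divisors in the pencil, one with both chips on the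
common edge of the cells of `(1,1)` and `(2,1)` (or on the cell of `(2,1)`, if there is a bridge
instead), and the other one likewise for `(1,2)`. Let `f` be a function whose divisor is their
difference.

*The contradiction.* The two arcs of the cell of `(1,1)` between the ends of this movement are the
short one, which consists of the edge dual to `(1,1) (2,2)` if it exists, and the long one around the
other side. If `f` had slope `1` along both arcs they would have equal lengths. In general the
slopes of `f` differ from these symmetric ones by a circulation (`DualGraph.slopeDefect`), and
the same energy argument shows that, in the direction of the movement, the slope on each edge of the
arcs is `0` or `1` (`DualGraph.slopeDefect_eq_or`). Adding the cycle condition for `f` and the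
horizontal closing condition of a circulation on the cell gives a sum of non-negative terms
(`DualGraph.arcBalance_nonneg`), not all of which vanish (`DualGraph.IsGradient.not_isTransfer`).
-/

open Filter Topology

/-! ### Piecewise linear functions on an interval -/

/-- `h` is affine with slope `m` on a right neighbourhood of `0`. -/
def HasInitialSlope (h : ℝ → ℝ) (m : ℝ) : Prop := ∀ᶠ s in 𝓝[≥] (0 : ℝ), h s = h 0 + m * s

namespace HasInitialSlope

theorem slopeAtZero_eq {h : ℝ → ℝ} {m : ℝ} (H : HasInitialSlope h m) :
    MetricGraph.slopeAtZero h = m := by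
  have h1 : HasDerivWithinAt (fun s : ℝ => h 0 + m * s) m (Ici 0) 0 := by
    have := ((hasDerivAt_id (0 : ℝ)).const_mul m).const_add (h 0)
    simpa using this.hasDerivWithinAt
  have h2 : HasDerivWithinAt h m (Ici 0) 0 :=
    h1.congr_of_eventuallyEq (f₁ := h) H (by simp)
  exact h2.derivWithin (uniqueDiffWithinAt_Ici (0 : ℝ))

theorem add {h k : ℝ → ℝ} {m n : ℝ} (H : HasInitialSlope h m) (K : HasInitialSlope k n) :
    HasInitialSlope (fun s => h s + k s) (m + n) := by
  filter_upwards [H, K] with s h1 h2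
  rw [h1, h2]; ring

theorem const_mul {h : ℝ → ℝ} {m : ℝ} (H : HasInitialSlope h m) (c : ℝ) :
    HasInitialSlope (fun s => c * h s) (c * m) := by
  filter_upwards [H] with s h1
  rw [h1]; ring

theorem sum {ι : Type*} {K : Finset ι} {h : ι → ℝ → ℝ} {m : ι → ℝ}
    (H : ∀ i ∈ K, HasInitialSlope (h i) (m i)) :
    HasInitialSlope (fun s => ∑ i ∈ K, h i s) (∑ i ∈ K, m i) := by
  have := (Filter.eventually_all_finset K).2 H
  filter_upwards [this] with s hs
  rw [Finset.sum_congr rfl hs, Finset.sum_add_distrib, Finset.sum_mul]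

theorem of_le {h : ℝ → ℝ} {m ε : ℝ} (hε : 0 < ε)
    (H : ∀ s ∈ Icc 0 ε, h s = h 0 + m * s) : HasInitialSlope h m :=
  Filter.mem_of_superset (Icc_mem_nhdsGE hε) H

theorem exists_pos {h : ℝ → ℝ} {m : ℝ} (H : HasInitialSlope h m) :
    ∃ ε > 0, ∀ s ∈ Icc 0 ε, h s = h 0 + m * s := by
  obtain ⟨ε, hε, h1⟩ := (mem_nhdsGE_iff_exists_Icc_subset).1 H
  exact ⟨ε, hε, h1⟩

end HasInitialSlope

theorem hasInitialSlope_hinge_right (t x : ℝ) :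
    HasInitialSlope (fun s => max (t + s - x) 0) (if x ≤ t then 1 else 0) := by
  split_ifs with h
  · refine .of_le one_pos fun s hs => ?_
    rw [max_eq_left (by linarith [hs.1]), max_eq_left (by linarith)]; ring
  · refine .of_le (ε := x - t) (by linarith) fun s hs => ?_
    rw [max_eq_right (by linarith [hs.2]), max_eq_right (by linarith)]; ring

theorem hasInitialSlope_hinge_left (t x : ℝ) :
    HasInitialSlope (fun s => max (t - s - x) 0) (if x < t then -1 else 0) := by
  split_ifs with h
  · refine .of_le (ε := t - x) (by linarith) fun s hs => ?_
    rw [max_eq_left (by linarith [hs.2]), max_eq_left (by linarith)]; ring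
  · refine .of_le one_pos fun s hs => ?_
    rw [max_eq_right (by linarith [hs.1]), max_eq_right (by linarith)]; ring

/-- A function that is affine on both sides of every point of `[0, l]` and has no kinks inside
is affine. -/
theorem affine_of_no_kinks {G : ℝ → ℝ} {l m : ℝ} (r q : ℝ → ℝ) (h0 : r 0 = m)
    (hr : ∀ t ∈ Ico 0 l, HasInitialSlope (fun s => G (t + s)) (r t))
    (hq : ∀ t ∈ Ioc 0 l, HasInitialSlope (fun s => G (t - s)) (q t))
    (hrq : ∀ t ∈ Ioo 0 l, r t + q t = 0) :
    ∀ t ∈ Icc 0 l, G t = G 0 + m * t := by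
  -- If the formula holds on `[0, t)`, then it holds at `t` and the slope to the left of `t` is `m`.
  have key : ∀ t ∈ Ioc 0 l, (∀ u ∈ Icc 0 l, u < t → G u = G 0 + m * u) →
      G t = G 0 + m * t ∧ q t = -m := by
    intro t ht hu
    obtain ⟨ε, hε, h1⟩ := (hq t ht).exists_pos
    simp only [sub_zero] at h1
    set δ := min ε t with hδ
    have hδ0 : 0 < δ := lt_min hε ht.1
    have hδ1 : δ ≤ ε := min_le_left _ _
    have hδ2 : δ ≤ t := min_le_right _ _
    have e1 := h1 δ ⟨hδ0.le, hδ1⟩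
    have e2 := h1 (δ / 2) ⟨by linarith, by linarith⟩
    rw [hu _ ⟨by linarith, by linarith [ht.2]⟩ (by linarith)] at e1 e2
    have e3 : q t = -m := by
      have : (q t + m) * δ = 0 := by linarith
      rcases mul_eq_zero.1 this with h | h <;> linarith
    refine ⟨?_, e3⟩
    rw [e3] at e1
    linarith
  have hcl : IsClosed {t | ∀ u ∈ Icc 0 l, u < t → G u = G 0 + m * u} := by
    have : {t | ∀ u ∈ Icc 0 l, u < t → G u = G 0 + m * u} =
        ⋂ u ∈ {u | u ∈ Icc 0 l ∧ ¬ (G u = G 0 + m * u)}, Iic u := by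
      ext t
      simp only [mem_ofPred_eq, mem_iInter, mem_Iic, and_imp]
      refine forall₂_congr fun u hu => ?_
      rw [← not_imp_not, not_lt]
    rw [this]
    exact isClosed_biInter fun _ _ => isClosed_Iic
  have hsub := IsClosed.Icc_subset_of_forall_exists_gt (a := 0) (b := l)
    (s := {t | ∀ u ∈ Icc 0 l, u < t → G u = G 0 + m * u}) (hcl.inter isClosed_Icc)
    (fun u hu hu' => absurd hu.1 (not_le.2 hu')) (by
      rintro x ⟨hx, hx0, hxl⟩ y hy
      have hx1 : G x = G 0 + m * x ∧ r x = m := by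
        rcases hx0.eq_or_lt with h | h
        · subst h; simp [h0]
        · have k := key x ⟨h, hxl.le⟩ hx
          exact ⟨k.1, by linarith [hrq x ⟨h, hxl⟩, k.2]⟩
      obtain ⟨ε, hε, h1⟩ := (hr x ⟨hx0, hxl⟩).exists_pos
      simp only [add_zero] at h1
      refine ⟨min (x + ε) y, fun u hu hlt => ?_, lt_min (by linarith) hy, min_le_right _ _⟩
      rcases lt_or_ge u x with h | h
      · exact hx u hu h
      · have := h1 (u - x) ⟨by linarith, by linarith [min_le_left (x + ε) y]⟩
        rw [add_sub_cancel, hx1.1, hx1.2] at this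
        rw [this]; ring)
  intro t ht
  rcases ht.1.eq_or_lt with h | h
  · subst h; simp
  · exact (key t ⟨h, ht.2⟩ (hsub ht)).1

/-- A piecewise linear function on `[0, l]` is determined by its value and slope at `0` and its
kinks. -/
theorem eq_sum_hinges {g : ℝ → ℝ} {l : ℝ} (S : Finset ℝ)
    (hS : ∀ a b : ℝ, 0 ≤ a → a < b → b ≤ l → (∀ s ∈ S, s ∉ Ioo a b) →
      ∃ m : ℤ, ∀ t ∈ Icc a b, g t = g a + m * (t - a))
    (K : Finset ℝ) (hK : ∀ x ∈ K, x ∈ Ioo 0 l) (c : ℝ → ℤ) (hc : ∀ x, x ∉ K → c x = 0)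
    (hk : ∀ t ∈ Ioo 0 l, MetricGraph.slopeAtZero (fun s => g (t + s)) +
      MetricGraph.slopeAtZero (fun s => g (t - s)) = c t) :
    ∃ m : ℤ, ∀ t ∈ Icc 0 l, g t = g 0 + m * t + ∑ x ∈ K, c x * max (t - x) 0 := by
  have hR : ∀ t ∈ Ico 0 l, ∃ m : ℤ, HasInitialSlope (fun s => g (t + s)) m := by
    intro t ht
    have h1 : ∀ᶠ b in 𝓝[>] t, ∀ s ∈ S, s ∉ Ioo t b := by
      refine (Filter.eventually_all_finset S).2 fun s _ => ?_
      rcases le_or_gt s t with h | h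
      · exact Eventually.of_forall fun b hb => absurd hb.1 (not_lt.2 h)
      · filter_upwards [Ioo_mem_nhdsGT h] with b hb hb'
        exact lt_asymm hb.2 hb'.2
    obtain ⟨b, hb, hb1⟩ := (h1.and (Ioo_mem_nhdsGT ht.2)).exists
    obtain ⟨m, hm⟩ := hS t b ht.1 hb1.1 hb1.2.le hb
    refine ⟨m, .of_le (ε := b - t) (by linarith [hb1.1]) fun s hs => ?_⟩
    rw [hm (t + s) ⟨by linarith [hs.1], by linarith [hs.2]⟩]; simp
  have hL : ∀ t ∈ Ioc 0 l, ∃ m : ℤ, HasInitialSlope (fun s => g (t - s)) m := by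
    intro t ht
    have h1 : ∀ᶠ b in 𝓝[<] t, ∀ s ∈ S, s ∉ Ioo b t := by
      refine (Filter.eventually_all_finset S).2 fun s _ => ?_
      rcases le_or_gt t s with h | h
      · exact Eventually.of_forall fun b hb => absurd hb.2 (not_lt.2 h)
      · filter_upwards [Ioo_mem_nhdsLT h] with b hb hb'
        exact lt_asymm hb.1 hb'.1
    obtain ⟨b, hb, hb1⟩ := (h1.and (Ioo_mem_nhdsLT ht.1)).exists
    obtain ⟨m, hm⟩ := hS b t hb1.1.le hb1.2 ht.2 hb
    refine ⟨-m, .of_le (ε := t - b) (by linarith [hb1.2]) fun s hs => ?_⟩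
    rw [hm (t - s) ⟨by linarith [hs.2], by linarith [hs.1]⟩, hm (t - 0) ⟨by linarith [hb1.2], by simp⟩]
    push_cast; ring
  choose! r hr using hR
  choose! q hq using hL
  have hGr : ∀ t ∈ Ico 0 l, HasInitialSlope
      (fun s => g (t + s) + ∑ x ∈ K, (-(c x : ℝ)) * max (t + s - x) 0)
      (r t + ∑ x ∈ K, (-(c x : ℝ)) * (if x ≤ t then 1 else 0)) := fun t ht =>
    (hr t ht).add (.sum fun x _ => (hasInitialSlope_hinge_right t x).const_mul _)
  have hGq : ∀ t ∈ Ioc 0 l, HasInitialSlope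
      (fun s => g (t - s) + ∑ x ∈ K, (-(c x : ℝ)) * max (t - s - x) 0)
      (q t + ∑ x ∈ K, (-(c x : ℝ)) * (if x < t then -1 else 0)) := fun t ht =>
    (hq t ht).add (.sum fun x _ => (hasInitialSlope_hinge_left t x).const_mul _)
  refine ⟨r 0, ?_⟩
  have := affine_of_no_kinks (G := fun t => g t + ∑ x ∈ K, (-(c x : ℝ)) * max (t - x) 0) (m := r 0)
    _ _ ?_ hGr hGq ?_
  · intro t ht
    have h := this t ht
    have h0 : ∑ x ∈ K, (-(c x : ℝ)) * max (0 - x) 0 = 0 := by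
      refine Finset.sum_eq_zero fun x hx => ?_
      rw [max_eq_right (by linarith [(hK x hx).1])]; simp
    simp only [h0] at h
    simp only [neg_mul, Finset.sum_neg_distrib] at h
    linarith
  · have : ∑ x ∈ K, (-(c x : ℝ)) * (if x ≤ 0 then 1 else 0) = 0 := by
      refine Finset.sum_eq_zero fun x hx => ?_
      rw [if_neg (not_le.2 (hK x hx).1)]; simp
    simp only [this]; simp
  · intro t ht
    have e := hk t ht
    rw [(hr t ⟨ht.1.le, ht.2⟩).slopeAtZero_eq, (hq t ⟨ht.1, ht.2.le⟩).slopeAtZero_eq] at e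
    have : ∑ x ∈ K, (-(c x : ℝ)) * (if x ≤ t then 1 else 0) +
        ∑ x ∈ K, (-(c x : ℝ)) * (if x < t then -1 else 0) = -c t := by
      rw [← Finset.sum_add_distrib]
      have h2 : ∀ x ∈ K, (-(c x : ℝ)) * (if x ≤ t then 1 else 0) +
          (-(c x : ℝ)) * (if x < t then -1 else 0) = if x = t then -(c t : ℝ) else 0 := by
        intro x _
        rcases lt_trichotomy x t with h | h | h
        · simp [h, h.le, h.ne]
        · simp [h]
        · simp [not_le.2 h, not_lt.2 h.le, h.ne']
      rw [Finset.sum_congr rfl h2, Finset.sum_ite_eq']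
      split_ifs with h3
      · rfl
      · simp [hc t h3]
    linarith

/-! ### Principal divisors on a metric graph -/

namespace MetricGraph

variable {Γ : MetricGraph}

theorem pt_zero (e : Γ.E) : Γ.pt e 0 = .vertex (Γ.src e) := by simp [pt]

theorem pt_len (e : Γ.E) : Γ.pt e (Γ.len e) = .vertex (Γ.tgt e) := by
  simp [pt, not_le.2 (Γ.len_pos e)]

theorem pt_of_mem (e : Γ.E) {t : ℝ} (ht : t ∈ Ioo 0 (Γ.len e)) : Γ.pt e t = .inner e t ht :=
  dif_pos ht

/-- The number of chips of a divisor in the interior of the edge `e`. -/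
noncomputable def chipCount (e : Γ.E) : Γ.Divisor →ₗ[ℤ] ℤ :=
  Finsupp.linearCombination ℤ fun P => match P with
    | .vertex _ => 0
    | .inner e' _ _ => if e' = e then 1 else 0

/-- The sum of the distances to the end of the edge `e` of the chips in its interior. -/
noncomputable def chipMoment (e : Γ.E) : Γ.Divisor →ₗ[ℤ] ℝ :=
  Finsupp.linearCombination ℤ fun P => match P with
    | .vertex _ => 0
    | .inner e' t _ => if e' = e then Γ.len e - t else 0

/-- A divisor is *principal* if it is the divisor of a rational function. This is expressed in
terms of the values `F` of the function at the vertices and its slopes `n` at the starts of the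
edges: a function whose divisor is `A` gains slope at the chips of `A` inside an edge. -/
def IsPrincipal (A : Γ.Divisor) : Prop :=
  ∃ (F : Γ.V → ℝ) (n : Γ.E → ℤ),
    (∀ e, F (Γ.tgt e) - F (Γ.src e) = n e * Γ.len e + chipMoment e A) ∧
    ∀ v, (∑ e, if Γ.src e = v then n e else 0) -
      (∑ e, if Γ.tgt e = v then n e + chipCount e A else 0) = A (.vertex v)

theorem IsPrincipal.sub {A B : Γ.Divisor} (hA : IsPrincipal A) (hB : IsPrincipal B) :
    IsPrincipal (A - B) := by
  obtain ⟨F, n, h1, h2⟩ := hA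
  obtain ⟨G, k, h3, h4⟩ := hB
  refine ⟨F - G, n - k, fun e => ?_, fun v => ?_⟩
  · simp only [Pi.sub_apply, map_sub, Int.cast_sub]
    linarith [h1 e, h3 e]
  · have e1 : ∀ e, (if Γ.src e = v then (n - k) e else 0) =
        (if Γ.src e = v then n e else 0) - (if Γ.src e = v then k e else 0) := fun e => by
      split_ifs <;> simp
    have e2 : ∀ e, (if Γ.tgt e = v then (n - k) e + chipCount e (A - B) else 0) =
        (if Γ.tgt e = v then n e + chipCount e A else 0) -
          (if Γ.tgt e = v then k e + chipCount e B else 0) := fun e => by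
      split_ifs
      · simp only [Pi.sub_apply, map_sub]; ring
      · simp
    simp only [e1, e2, Finset.sum_sub_distrib]
    rw [Finsupp.sub_apply, ← h2 v, ← h4 v]
    ring

/-- A rational function on an edge: its slope at the start determines its increment and its slope at
the end by means of the chips in between. -/
theorem exists_edge_slope {f : Γ.Point → ℝ} (hf : IsRational f) {A : Γ.Divisor}
    (hA : ∀ p, ((A p : ℤ) : ℝ) = ord f p) (e : Γ.E) :
    ∃ m : ℤ, f (.vertex (Γ.tgt e)) - f (.vertex (Γ.src e)) = m * Γ.len e + chipMoment e A ∧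
      slopeAtZero (fun s => f (Γ.pt e s)) = m ∧
      slopeAtZero (fun s => f (Γ.pt e (Γ.len e - s))) = -(m + chipCount e A : ℤ) := by
  obtain ⟨S, hS⟩ := hf e
  have hl := Γ.len_pos e
  have hinj : Function.Injective (fun t : Ioo 0 (Γ.len e) => Point.inner e t.1 t.2) := by
    rintro ⟨t, ht⟩ ⟨u, hu⟩ h
    simpa using h
  set K : Finset (Ioo 0 (Γ.len e)) := A.support.preimage _ hinj.injOn with hKdef
  have hsum : ∀ (M : Type) [AddCommGroup M] (φ : Γ.Point → M),
      (∀ P, P ∉ range (fun t : Ioo 0 (Γ.len e) => Point.inner e t.1 t.2) → φ P = 0) →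
      Finsupp.linearCombination ℤ φ A =
        ∑ t ∈ K, A (.inner e t.1 t.2) • φ (.inner e t.1 t.2) := by
    intro M _ φ hφ
    rw [Finsupp.linearCombination_apply, Finsupp.sum, hKdef]
    exact (Finset.sum_preimage _ A.support hinj.injOn (fun P => A P • φ P)
      fun P _ hP => by rw [hφ P hP, smul_zero]).symm
  have hcnt : chipCount e A = ∑ t ∈ K, A (.inner e t.1 t.2) := by
    rw [chipCount, hsum]
    · simp
    · rintro (v | ⟨e', t, ht⟩) h
      · rfl
      · refine if_neg ?_
        rintro rfl
        exact h ⟨⟨t, ht⟩, rfl⟩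
  have hmom : chipMoment e A = ∑ t ∈ K, (A (.inner e t.1 t.2) : ℝ) * (Γ.len e - t.1) := by
    rw [chipMoment, hsum]
    · simp
    · rintro (v | ⟨e', t, ht⟩) h
      · rfl
      · refine if_neg ?_
        rintro rfl
        exact h ⟨⟨t, ht⟩, rfl⟩
  obtain ⟨m, hm⟩ := eq_sum_hinges (g := fun t => f (Γ.pt e t)) S hS
    (K.map (Function.Embedding.subtype _)) (fun x hx => by
      obtain ⟨t, _, rfl⟩ := Finset.mem_map.1 hx
      exact t.2)
    (fun t => if ht : t ∈ Ioo 0 (Γ.len e) then A (.inner e t ht) else 0)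
    (fun x hx => by
      split_ifs with h
      · by_contra h2
        exact hx (Finset.mem_map.2 ⟨⟨x, h⟩, by simp [hKdef, h2], rfl⟩)
      · rfl)
    (fun t ht => by
      simp only [dif_pos ht]
      rw [hA]
      rfl)
  have hm' : ∀ t ∈ Icc 0 (Γ.len e), f (Γ.pt e t) = f (Γ.pt e 0) + m * t +
      ∑ x ∈ K, (A (.inner e x.1 x.2) : ℝ) * max (t - x.1) 0 := by
    intro t ht
    rw [hm t ht, Finset.sum_map]
    simp
  refine ⟨m, ?_, ?_, ?_⟩
  · rw [← pt_len, ← pt_zero, hm' _ ⟨hl.le, le_rfl⟩, hmom]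
    have : ∀ x ∈ K, (A (.inner e x.1 x.2) : ℝ) * max (Γ.len e - x.1) 0 =
        (A (.inner e x.1 x.2) : ℝ) * (Γ.len e - x.1) := by
      intro x _
      rw [max_eq_left (by linarith [x.2.2])]
    rw [Finset.sum_congr rfl this]; ring
  · have h1 : HasInitialSlope (fun s => m * s + ∑ x ∈ K, (A (.inner e x.1 x.2) : ℝ) *
        max (0 + s - x.1) 0) (m + ∑ x ∈ K, (A (.inner e x.1 x.2) : ℝ) *
          (if x.1 ≤ 0 then 1 else 0)) :=
      .add (.of_le one_pos fun s _ => by simp)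
        (.sum fun x _ => (hasInitialSlope_hinge_right 0 x.1).const_mul _)
    have h2 : ∑ x ∈ K, (A (.inner e x.1 x.2) : ℝ) * (if x.1 ≤ 0 then 1 else 0) = 0 :=
      Finset.sum_eq_zero fun x _ => by rw [if_neg (not_le.2 x.2.1), mul_zero]
    rw [h2, add_zero] at h1
    refine HasInitialSlope.slopeAtZero_eq ?_
    have h3 : ∑ x ∈ K, (A (.inner e x.1 x.2) : ℝ) * max (0 + 0 - x.1) 0 = 0 :=
      Finset.sum_eq_zero fun x _ => by
        rw [max_eq_right (by linarith [x.2.1]), mul_zero]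
    filter_upwards [h1, Icc_mem_nhdsGE hl] with s hs hs2
    rw [hm' s hs2]
    simp only [h3] at hs
    simp only [zero_add, mul_zero] at hs ⊢
    linarith
  · have h1 : HasInitialSlope (fun s => -m * s + ∑ x ∈ K, (A (.inner e x.1 x.2) : ℝ) *
        max (Γ.len e - s - x.1) 0) (-m + ∑ x ∈ K, (A (.inner e x.1 x.2) : ℝ) *
          (if x.1 < Γ.len e then -1 else 0)) :=
      .add (.of_le one_pos fun s _ => by simp)
        (.sum fun x _ => (hasInitialSlope_hinge_left (Γ.len e) x.1).const_mul _)
    have h2 : ∑ x ∈ K, (A (.inner e x.1 x.2) : ℝ) * (if x.1 < Γ.len e then -1 else 0) =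
        -(chipCount e A : ℝ) := by
      rw [hcnt]
      push_cast
      rw [← Finset.sum_neg_distrib]
      exact Finset.sum_congr rfl fun x _ => by rw [if_pos x.2.2]; ring
    rw [h2] at h1
    have h4 : -(m : ℝ) + -(chipCount e A : ℝ) = (-(m + chipCount e A : ℤ) : ℝ) := by
      push_cast; ring
    rw [← h4]
    refine HasInitialSlope.slopeAtZero_eq ?_
    filter_upwards [h1, Icc_mem_nhdsGE hl] with s hs hs2
    rw [hm' _ ⟨by linarith [hs2.2], by linarith [hs2.1]⟩,
      hm' (Γ.len e - 0) ⟨by linarith, by linarith⟩]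
    simp only [mul_zero, zero_add] at hs
    linarith

theorem LinearEquiv.isPrincipal_sub {D D' : Γ.Divisor} (h : LinearEquiv D D') :
    IsPrincipal (D - D') := by
  obtain ⟨f, hf, hA⟩ := h
  choose n h1 h2 h3 using fun e => exists_edge_slope hf hA e
  refine ⟨fun v => f (.vertex v), n, h1, fun v => ?_⟩
  have h := hA (.vertex v)
  rw [ord, Finset.sum_add_distrib] at h
  simp only [h2, h3] at h
  have h5 : ((((∑ e, if Γ.src e = v then n e else 0) -
      (∑ e, if Γ.tgt e = v then n e + chipCount e (D - D') else 0) : ℤ)) : ℝ) =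
      (((D - D') (.vertex v) : ℤ) : ℝ) := by
    rw [h]
    push_cast
    rw [sub_eq_add_neg, ← Finset.sum_neg_distrib]
    congr 1
    refine Finset.sum_congr rfl fun e _ => ?_
    split_ifs <;> simp
  exact_mod_cast h5

/-- The degree as a linear map. -/
noncomputable def degreeHom : Γ.Divisor →ₗ[ℤ] ℤ := Finsupp.linearCombination ℤ fun _ => 1

theorem degreeHom_apply (A : Γ.Divisor) : degreeHom A = degree A := by
  simp [degreeHom, degree, Finsupp.linearCombination_apply]

theorem degreeHom_eq_sum (A : Γ.Divisor) [Fintype Γ.V] :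
    degreeHom A = ∑ v, A (.vertex v) + ∑ e, chipCount e A := by
  induction A using Finsupp.induction_linear with
  | zero => simp
  | add f g hf hg =>
    simp only [map_add, hf, hg, Finsupp.add_apply, Finset.sum_add_distrib]; ring
  | single P a =>
    rcases P with v | ⟨e, t, ht⟩
    · simp [degreeHom, chipCount, Finsupp.single_apply]
    · simp [degreeHom, chipCount]

theorem IsPrincipal.degreeHom_eq_zero {A : Γ.Divisor} (h : IsPrincipal A) : degreeHom A = 0 := by
  have := Fintype.ofFinite Γ.V
  obtain ⟨F, n, -, h2⟩ := h
  rw [degreeHom_eq_sum]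
  simp only [← h2]
  rw [Finset.sum_sub_distrib, Finset.sum_comm, Finset.sum_comm (γ := Γ.V)]
  simp [Finset.sum_add_distrib]

theorem eq_single_of_isEffective {D : Γ.Divisor} (hD : IsEffective D) (h1 : degreeHom D = 1) :
    ∃ Q, D = Finsupp.single Q 1 := by
  have h : ∑ P ∈ D.support, D P = 1 := by
    simpa [degreeHom, Finsupp.linearCombination_apply, Finsupp.sum] using h1
  obtain ⟨Q, hQ⟩ : D.support.Nonempty := by
    by_contra h0
    rw [Finset.not_nonempty_iff_eq_empty] at h0
    simp [h0] at h
  have hpos : ∀ P ∈ D.support, 1 ≤ D P := fun P hP => by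
    have := hD P
    have := Finsupp.mem_support_iff.1 hP
    omega
  have hcard : D.support.card ≤ 1 := by
    have := Finset.sum_le_sum hpos
    rw [h] at this
    simpa using this
  have : Nonempty Γ.Point := ⟨Q⟩
  have hs : D.support = {Q} := (Finset.card_le_one_iff_subset_singleton.1 hcard).elim
    fun P hP => by
      have := Finset.mem_singleton.1 (hP hQ)
      subst this
      exact Finset.Subset.antisymm hP (Finset.singleton_subset_iff.2 hQ)
  refine ⟨Q, ?_⟩
  rw [hs, Finset.sum_singleton] at h
  rw [Finsupp.support_eq_singleton.1 hs |>.2, h]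

/-- A divisor of degree `2` and rank at least `1` is equivalent to the sum of any given point and
another one. -/
theorem RankAtLeast.exists_isPrincipal {D : Γ.Divisor} (hD : degree D = 2)
    (h : RankAtLeast D 1) (P : Γ.Point) :
    ∃ Q, IsPrincipal (D - Finsupp.single P 1 - Finsupp.single Q 1) := by
  obtain ⟨D', hD', hequiv⟩ := h (Finsupp.single P 1)
    (fun Q => by rw [Finsupp.single_apply]; split_ifs <;> simp) (by simp [degree])
  have hp := hequiv.isPrincipal_sub
  have hdeg := hp.degreeHom_eq_zero
  rw [map_sub, map_sub, degreeHom_apply D, hD, degreeHom_apply (Finsupp.single P 1)] at hdeg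
  simp only [degree, Finsupp.sum_single_index] at hdeg
  obtain ⟨Q, rfl⟩ := eq_single_of_isEffective hD' (by omega)
  exact ⟨Q, hp⟩

end MetricGraph

/-! ### Graphs dual to unimodular triangulations -/

/-- Twice the signed area of the triangle `p q r`. -/
def orient (p q r : ℤ × ℤ) : ℤ := (q.1 - p.1) * (r.2 - p.2) - (q.2 - p.2) * (r.1 - p.1)

theorem orient_swap_left (p q r : ℤ × ℤ) : orient q p r = -orient p q r := by
  simp only [orient]; ring

theorem orient_swap_right (p q r : ℤ × ℤ) : orient p r q = -orient p q r := by
  simp only [orient]; ring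

theorem orient_rotate (p q r : ℤ × ℤ) : orient q r p = orient p q r := by
  simp only [orient]; ring

theorem ne_of_orient_ne_zero {p q r : ℤ × ℤ} (h : orient p q r ≠ 0) : p ≠ q ∧ q ≠ r ∧ p ≠ r := by
  refine ⟨?_, ?_, ?_⟩ <;> rintro rfl <;> exact h (by simp only [orient]; ring)

/-- The lattice points of the triangle with vertices `(0,0)`, `(4,0)`, `(0,4)`. -/
def quarticPoints : Finset (ℤ × ℤ) :=
  {(0,0), (1,0), (2,0), (3,0), (4,0), (0,1), (1,1), (2,1), (3,1), (0,2), (1,2), (2,2), (0,3),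
    (1,3), (0,4)}

/-- The lattice points in the interior of that triangle. -/
def interiorPoints : Finset (ℤ × ℤ) := {(1,1), (2,1), (1,2)}

theorem mem_quarticPoints {q : ℤ × ℤ} : q ∈ quarticPoints ↔ 0 ≤ q.1 ∧ 0 ≤ q.2 ∧ q.1 + q.2 ≤ 4 := by
  obtain ⟨x, y⟩ := q
  simp only [quarticPoints, Finset.mem_insert, Finset.mem_singleton, Prod.mk.injEq]
  omega

/-- A finite metric graph dual to a unimodular triangulation of the triangle with vertices
`(0,0)`, `(4,0)`, `(0,4)`: vertices are labelled by triangles and edges by the sides between two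
triangles. The core is a leafless set of edges which contains the boundaries of all cells, that is,
the edges dual to the sides at interior lattice points. Of the triangulation only the facts that are
needed are recorded: sides do not cross, and all half-integral points of the big triangle are
midpoints of two (possibly equal) vertices of a triangle. The vertices have positions in the plane,
normalized by a quarter turn so that each edge is parallel to its dual side. -/
structure DualGraph where
  V : Type
  E : Type
  finV : Fintype V
  finE : Fintype E
  src : E → V
  tgt : E → V
  len : E → ℝ
  core : Set E
  tri : V → Finset (ℤ × ℤ)
  side : E → Finset (ℤ × ℤ)
  pos : V → ℝ × ℝ
  len_pos : ∀ e, 0 < len e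
  src_ne_tgt : ∀ e, src e ≠ tgt e
  unimodular : ∀ v, ∃ p q r, tri v = {p, q, r} ∧ orient p q r = 1
  tri_subset : ∀ v, tri v ⊆ quarticPoints
  not_cross : ∀ v v' u w u' w', u ∈ tri v → w ∈ tri v → u' ∈ tri v' → w' ∈ tri v' →
    ¬ (orient u w u' * orient u w w' < 0 ∧ orient u' w' u * orient u' w' w < 0)
  exists_add_eq : ∀ s : ℤ × ℤ, 0 ≤ s.1 → 0 ≤ s.2 → s.1 + s.2 ≤ 8 →
    ∃ v, ∃ u ∈ tri v, ∃ w ∈ tri v, u + w = s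
  side_card : ∀ e, (side e).card = 2
  side_injective : Function.Injective side
  side_subset_tri : ∀ e v, side e ⊆ tri v ↔ v = src e ∨ v = tgt e
  exists_edge : ∀ v u w, u ∈ tri v → w ∈ tri v → u ≠ w → u ∈ interiorPoints →
    ∃ e, side e = {u, w}
  pos_src : ∀ e u w z, side e = {u, w} → z ∈ tri (src e) → orient u w z = 1 →
    pos (tgt e) - pos (src e) = len e • latticeToPlane (w - u)
  pos_tgt : ∀ e u w z, side e = {u, w} → z ∈ tri (tgt e) → orient u w z = 1 →
    pos (tgt e) - pos (src e) = len e • latticeToPlane (u - w)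
  core_leafless : ∀ e ∈ core, (∃ e' ∈ core, e' ≠ e ∧ (src e' = src e ∨ tgt e' = src e)) ∧
    (∃ e' ∈ core, e' ≠ e ∧ (src e' = tgt e ∨ tgt e' = tgt e))
  mem_core : ∀ e, ∀ x ∈ interiorPoints, x ∈ side e → e ∈ core

namespace DualGraph

attribute [instance] DualGraph.finV DualGraph.finE

variable (G : DualGraph)

/-- Two lattice points are joined if they lie in a common triangle. -/
def Joined (u w : ℤ × ℤ) : Prop := ∃ v, u ∈ G.tri v ∧ w ∈ G.tri v

variable {G}

theorem Joined.symm {u w : ℤ × ℤ} (h : G.Joined u w) : G.Joined w u :=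
  h.imp fun _ h => ⟨h.2, h.1⟩

theorem Joined.not_cross {u w u' w' : ℤ × ℤ} (h : G.Joined u w) (h' : G.Joined u' w') :
    ¬ (orient u w u' * orient u w w' < 0 ∧ orient u' w' u * orient u' w' w < 0) := by
  obtain ⟨v, h1, h2⟩ := h
  obtain ⟨v', h3, h4⟩ := h'
  exact G.not_cross v v' u w u' w' h1 h2 h3 h4

theorem exists_tri_eq {v : G.V} {x : ℤ × ℤ} (hx : x ∈ G.tri v) :
    ∃ y z, G.tri v = {x, y, z} ∧ orient x y z = 1 := by
  obtain ⟨p, q, r, h, ho⟩ := G.unimodular v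
  rw [h] at hx
  simp only [Finset.mem_insert, Finset.mem_singleton] at hx
  rcases hx with rfl | rfl | rfl
  · exact ⟨q, r, h, ho⟩
  · refine ⟨r, p, ?_, by rw [orient_rotate]; exact ho⟩
    rw [h]; ext; simp; tauto
  · refine ⟨p, q, ?_, by rw [← orient_rotate]; exact ho⟩
    rw [h]; ext; simp; tauto

theorem exists_tri_eq_of_mem_of_mem {v : G.V} {x y : ℤ × ℤ} (hx : x ∈ G.tri v) (hy : y ∈ G.tri v)
    (hxy : x ≠ y) : ∃ z, G.tri v = {x, y, z} ∧ (orient x y z = 1 ∨ orient x y z = -1) := by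
  obtain ⟨p, q, h, ho⟩ := exists_tri_eq hx
  rw [h] at hy
  simp only [Finset.mem_insert, Finset.mem_singleton] at hy
  rcases hy with rfl | rfl | rfl
  · exact absurd rfl hxy
  · exact ⟨q, h, .inl ho⟩
  · refine ⟨p, ?_, .inr (by rw [orient_swap_right, ho])⟩
    rw [h, Finset.pair_comm]

theorem orient_eq_one_or {v : G.V} {x y z : ℤ × ℤ} (h : G.tri v = {x, y, z}) :
    orient x y z = 1 ∨ orient x y z = -1 := by
  obtain ⟨p, q, r, h', ho⟩ := G.unimodular v
  have hne := ne_of_orient_ne_zero (p := p) (q := q) (r := r) (by rw [ho]; norm_num)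
  have hcard : ({x, y, z} : Finset (ℤ × ℤ)).card = 3 := by
    rw [← h, h', Finset.card_eq_three]; exact ⟨p, q, r, hne.1, hne.2.2, hne.2.1, rfl⟩
  have hxy : x ≠ y := by
    rintro rfl
    have := Finset.card_le_two (a := x) (b := z)
    simp at hcard; omega
  obtain ⟨w, hw, ho'⟩ := exists_tri_eq_of_mem_of_mem (v := v) (x := x) (y := y)
    (by simp [h]) (by simp [h]) hxy
  have : w ∈ ({x, y, z} : Finset (ℤ × ℤ)) := by rw [← h, hw]; simp
  simp only [Finset.mem_insert, Finset.mem_singleton] at this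
  rcases this with rfl | rfl | rfl
  · exfalso; revert ho'; simp [orient]
  · exfalso; revert ho'; simp [orient]; constructor <;> intro h <;> ring_nf at h <;> simp at h
  · exact ho'

theorem orient_ne_zero {v : G.V} {x y z : ℤ × ℤ} (h : G.tri v = {x, y, z}) :
    orient x y z ≠ 0 := by
  rcases orient_eq_one_or h with h | h <;> rw [h] <;> norm_num

theorem Joined.exists_orient {u w : ℤ × ℤ} (h : G.Joined u w) (huw : u ≠ w) :
    u ∈ quarticPoints ∧ w ∈ quarticPoints ∧
      ∃ z ∈ quarticPoints, orient u w z = 1 ∨ orient u w z = -1 := by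
  obtain ⟨v, h1, h2⟩ := h
  obtain ⟨z, hz, ho⟩ := exists_tri_eq_of_mem_of_mem h1 h2 huw
  exact ⟨G.tri_subset v h1, G.tri_subset v h2, z, G.tri_subset v (by simp [hz]), ho⟩

theorem side_subset_src (e : G.E) : G.side e ⊆ G.tri (G.src e) :=
  (G.side_subset_tri e _).2 (.inl rfl)

theorem side_subset_tgt (e : G.E) : G.side e ⊆ G.tri (G.tgt e) :=
  (G.side_subset_tri e _).2 (.inr rfl)

theorem exists_side_eq (e : G.E) : ∃ u w, u ≠ w ∧ G.side e = {u, w} :=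
  (Finset.card_eq_two.1 (G.side_card e))

theorem exists_side_eq_of_mem {e : G.E} {x : ℤ × ℤ} (hx : x ∈ G.side e) :
    ∃ y, x ≠ y ∧ G.side e = {x, y} := by
  obtain ⟨u, w, huw, h⟩ := exists_side_eq e
  rw [h] at hx
  simp only [Finset.mem_insert, Finset.mem_singleton] at hx
  rcases hx with rfl | rfl
  · exact ⟨w, huw, h⟩
  · exact ⟨u, huw.symm, by rw [h, Finset.pair_comm]⟩

/-- The triangles at the two ends of an edge lie on different sides of the dual side. -/
theorem orient_tgt_eq_neg {e : G.E} {x y z z' : ℤ × ℤ} (hs : G.side e = {x, y})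
    (h : G.tri (G.src e) = {x, y, z}) (h' : G.tri (G.tgt e) = {x, y, z'}) :
    orient x y z' = -orient x y z := by
  have key : ∀ x y : ℤ × ℤ, G.side e = {x, y} → G.tri (G.src e) = {x, y, z} →
      G.tri (G.tgt e) = {x, y, z'} → orient x y z = 1 → orient x y z' = 1 → False := by
    intro x y hs h h' ho ho'
    have h1 := G.pos_src e x y z hs (by simp [h]) ho
    rw [G.pos_tgt e x y z' hs (by simp [h']) ho'] at h1
    have h2 := smul_right_injective _ (G.len_pos e).ne' h1
    have hne := (ne_of_orient_ne_zero (orient_ne_zero h)).1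
    simp only [latticeToPlane, Prod.mk.injEq, Prod.fst_sub, Prod.snd_sub, Int.cast_inj] at h2
    exact hne (Prod.ext (by omega) (by omega))
  rcases orient_eq_one_or h with ho | ho <;> rcases orient_eq_one_or h' with ho' | ho'
  · exact (key x y hs h h' ho ho').elim
  · rw [ho, ho']
  · rw [ho, ho']; norm_num
  · refine (key y x (by rw [hs, Finset.pair_comm]) (by rw [h, Finset.insert_comm])
      (by rw [h', Finset.insert_comm]) ?_ ?_).elim <;> rw [orient_swap_left]
    · rw [ho]; norm_num
    · rw [ho']; norm_num

/-! ### Circulations -/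

variable (G) in
/-- The incidence number of a vertex and an edge: `1` at the start and `-1` at the end. -/
noncomputable def incidence (v : G.V) (e : G.E) : ℤ :=
  (if G.src e = v then 1 else 0) - (if G.tgt e = v then 1 else 0)

theorem incidence_src (e : G.E) : G.incidence (G.src e) e = 1 := by
  simp [incidence, (G.src_ne_tgt e).symm]

theorem incidence_tgt (e : G.E) : G.incidence (G.tgt e) e = -1 := by
  simp [incidence, (G.src_ne_tgt e)]

theorem incidence_eq_zero {v : G.V} {e : G.E} (h : ¬ G.side e ⊆ G.tri v) :
    G.incidence v e = 0 := by
  rw [G.side_subset_tri] at h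
  push Not at h
  simp [incidence, h.1.symm, h.2.symm]

variable (G) in
/-- An integral flow along the edges without sources or sinks. -/
def IsCirculation (w : G.E → ℤ) : Prop := ∀ v, ∑ e, G.incidence v e * w e = 0

theorem IsCirculation.sum_mul_sub_eq_zero {w : G.E → ℤ} (h : G.IsCirculation w) (F : G.V → ℝ) :
    ∑ e, (w e : ℝ) * (F (G.tgt e) - F (G.src e)) = 0 := by
  have h1 : ∀ e, (w e : ℝ) * (F (G.tgt e) - F (G.src e)) =
      -∑ v, F v * ((G.incidence v e * w e : ℤ) : ℝ) := by
    intro e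
    simp only [incidence]
    push_cast
    simp only [sub_mul, mul_sub, Finset.sum_sub_distrib]
    simp
    ring
  simp only [h1, Finset.sum_neg_distrib]
  rw [Finset.sum_comm]
  simp only [← Finset.mul_sum, ← Int.cast_sum, h _]
  simp

variable (G) in
/-- The value of `φ` at the edge dual to `s`, or zero if there is none. -/
noncomputable def onSide {M : Type*} [AddCommMonoid M] (s : Finset (ℤ × ℤ)) (φ : G.E → M) : M :=
  ∑ e, if G.side e = s then φ e else 0

theorem onSide_eq {M : Type*} [AddCommMonoid M] {s : Finset (ℤ × ℤ)} {φ : G.E → M} {e : G.E}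
    (h : G.side e = s) : G.onSide s φ = φ e := by
  rw [onSide, Finset.sum_eq_single e, if_pos h]
  · intro e' _ he'
    exact if_neg fun h' => he' (G.side_injective (h'.trans h.symm))
  · simp

theorem onSide_eq_zero {M : Type*} [AddCommMonoid M] {s : Finset (ℤ × ℤ)} {φ : G.E → M}
    (h : ∀ e, G.side e = s → φ e = 0) : G.onSide s φ = 0 :=
  Finset.sum_eq_zero fun e _ => by split_ifs with h'; exacts [h e h', rfl]

theorem exists_of_onSide_ne_zero {M : Type*} [AddCommMonoid M] {s : Finset (ℤ × ℤ)} {φ : G.E → M}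
    (h : G.onSide s φ ≠ 0) : ∃ e, G.side e = s ∧ φ e ≠ 0 := by
  by_contra h'
  push Not at h'
  exact h (onSide_eq_zero h')

theorem pair_ne_pair {x y z : ℤ × ℤ} (h : x ≠ y ∧ y ≠ z ∧ x ≠ z) :
    ({x, y} : Finset (ℤ × ℤ)) ≠ {y, z} ∧ ({x, y} : Finset (ℤ × ℤ)) ≠ {x, z} ∧
      ({y, z} : Finset (ℤ × ℤ)) ≠ {x, z} := by
  obtain ⟨h1, h2, h3⟩ := h
  refine ⟨fun h => ?_, fun h => ?_, fun h => ?_⟩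
  · have : x ∈ ({y, z} : Finset (ℤ × ℤ)) := h ▸ by simp
    simp [h1, h3] at this
  · have : y ∈ ({x, z} : Finset (ℤ × ℤ)) := h ▸ by simp
    simp [h1.symm, h2] at this
  · have : x ∈ ({y, z} : Finset (ℤ × ℤ)) := h ▸ by simp
    simp [h1, h3] at this

theorem eq_pair_of_subset {x y z : ℤ × ℤ} {s : Finset (ℤ × ℤ)} (hs : s.card = 2)
    (h : s ⊆ {x, y, z}) : s = {x, y} ∨ s = {y, z} ∨ s = {x, z} := by
  obtain ⟨u, w, huw, rfl⟩ := Finset.card_eq_two.1 hs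
  have hu : u ∈ ({x, y, z} : Finset (ℤ × ℤ)) := h (by simp)
  have hw : w ∈ ({x, y, z} : Finset (ℤ × ℤ)) := h (by simp)
  simp only [Finset.mem_insert, Finset.mem_singleton] at hu hw
  rcases hu with rfl | rfl | rfl <;> rcases hw with rfl | rfl | rfl <;>
    simp_all [Finset.pair_comm]

/-- A sum over the edges at a vertex. -/
theorem sum_eq_onSide {M : Type*} [AddCommMonoid M] {v : G.V} {x y z : ℤ × ℤ}
    (h : G.tri v = {x, y, z}) {φ : G.E → M} (hφ : ∀ e, ¬ G.side e ⊆ G.tri v → φ e = 0) :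
    ∑ e, φ e = G.onSide {x, y} φ + G.onSide {y, z} φ + G.onSide {x, z} φ := by
  simp only [onSide, ← Finset.sum_add_distrib]
  refine Finset.sum_congr rfl fun e _ => ?_
  have hne := pair_ne_pair (ne_of_orient_ne_zero (orient_ne_zero h))
  by_cases hs : G.side e ⊆ G.tri v
  · rw [h] at hs
    rcases eq_pair_of_subset (G.side_card e) hs with h' | h' | h'
    · simp [h', hne.1, hne.2.1]
    · simp [h', hne.1.symm, hne.2.2]
    · simp [h', hne.2.1.symm, hne.2.2.symm]
  · simp [hφ e hs]

variable (G) in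
/-- The circulation around the cell of the interior lattice point `x`: the sign of an edge depends on
whether the triangle at its start lies to the left or to the right of the dual side, directed away
from `x`. -/
noncomputable def cellFlow (x : ℤ × ℤ) (e : G.E) : ℤ :=
  if x ∈ G.side e then
    -∑ y ∈ (G.side e).erase x, ∑ z ∈ G.tri (G.src e) \ G.side e, orient x y z
  else 0

theorem cellFlow_eq_zero {x : ℤ × ℤ} {e : G.E} (h : x ∉ G.side e) : G.cellFlow x e = 0 := if_neg h

theorem cellFlow_eq_src {x y z : ℤ × ℤ} {e : G.E} (hs : G.side e = {x, y})
    (h : G.tri (G.src e) = {x, y, z}) : G.cellFlow x e = -orient x y z := by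
  obtain ⟨h1, h2, h3⟩ := ne_of_orient_ne_zero (orient_ne_zero h)
  have e1 : ({x, y} : Finset (ℤ × ℤ)).erase x = {y} := by
    ext w; simp only [Finset.mem_erase, Finset.mem_insert, Finset.mem_singleton]
    constructor
    · tauto
    · rintro rfl; exact ⟨h1.symm, .inr rfl⟩
  have e2 : ({x, y, z} : Finset (ℤ × ℤ)) \ {x, y} = {z} := by
    ext w; simp only [Finset.mem_sdiff, Finset.mem_insert, Finset.mem_singleton]
    constructor
    · tauto
    · rintro rfl; exact ⟨.inr (.inr rfl), by rintro (h | h); exacts [h3 h.symm, h2 h.symm]⟩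
  rw [cellFlow, if_pos (by simp [hs]), h, hs, e1, e2]
  simp

theorem incidence_mul_cellFlow {x y z : ℤ × ℤ} {e : G.E} {v : G.V} (hs : G.side e = {x, y})
    (h : G.tri v = {x, y, z}) : G.incidence v e * G.cellFlow x e = -orient x y z := by
  have hsub : G.side e ⊆ G.tri v := by
    rw [hs, h]; intro w; simp only [Finset.mem_insert, Finset.mem_singleton]; tauto
  rcases (G.side_subset_tri e v).1 hsub with rfl | rfl
  · rw [incidence_src, cellFlow_eq_src hs h, one_mul]
  · have hx : x ∈ G.side e := by simp [hs]
    have hy : y ∈ G.side e := by simp [hs]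
    obtain ⟨z', h', -⟩ := exists_tri_eq_of_mem_of_mem (side_subset_src e hx) (side_subset_src e hy)
      (ne_of_orient_ne_zero (orient_ne_zero h)).1
    rw [incidence_tgt, cellFlow_eq_src hs h', orient_tgt_eq_neg hs h' h]
    ring

theorem cellFlow_eq_one_or {x : ℤ × ℤ} {e : G.E} (hx : x ∈ G.side e) :
    G.cellFlow x e = 1 ∨ G.cellFlow x e = -1 := by
  obtain ⟨y, hxy, hs⟩ := exists_side_eq_of_mem hx
  obtain ⟨z, h, ho⟩ := exists_tri_eq_of_mem_of_mem (side_subset_src e hx)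
    (side_subset_src e (by simp [hs] : y ∈ G.side e)) hxy
  rw [cellFlow_eq_src hs h]
  rcases ho with ho | ho <;> simp [ho]

theorem cellFlow_mul_self {x : ℤ × ℤ} {e : G.E} (hx : x ∈ G.side e) :
    G.cellFlow x e * G.cellFlow x e = 1 := by
  rcases cellFlow_eq_one_or hx with h | h <;> rw [h] <;> norm_num

theorem isCirculation_cellFlow {x : ℤ × ℤ} (hx : x ∈ interiorPoints) :
    G.IsCirculation (G.cellFlow x) := by
  intro v
  by_cases hv : x ∈ G.tri v
  · obtain ⟨y, z, h, ho⟩ := exists_tri_eq hv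
    obtain ⟨h1, h2, h3⟩ := ne_of_orient_ne_zero (orient_ne_zero h)
    obtain ⟨e1, he1⟩ := G.exists_edge v x y hv (by simp [h]) h1 hx
    obtain ⟨e2, he2⟩ := G.exists_edge v x z hv (by simp [h]) h3 hx
    rw [sum_eq_onSide h (fun e he => by rw [incidence_eq_zero he, zero_mul]), onSide_eq he1,
      onSide_eq he2, incidence_mul_cellFlow he1 h,
      incidence_mul_cellFlow he2 (h.trans (by rw [Finset.pair_comm])), onSide_eq_zero,
      orient_swap_right x y z]
    · ring
    · intro e he
      rw [cellFlow_eq_zero (by simp [he, h1, h3]), mul_zero]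
  · refine Finset.sum_eq_zero fun e _ => ?_
    by_cases he : x ∈ G.side e
    · rw [incidence_eq_zero fun h => hv (h he), zero_mul]
    · rw [cellFlow_eq_zero he, mul_zero]

/-- Along the cell of `x`, the normalized displacement of an edge is its length times the vector
from `x` to the other end of the dual side. -/
theorem cellFlow_mul_pos {x y : ℤ × ℤ} {e : G.E} (hs : G.side e = {x, y}) (hxy : x ≠ y) :
    (G.cellFlow x e : ℝ) * ((G.pos (G.tgt e)).1 - (G.pos (G.src e)).1) =
      -G.len e * ((y.1 : ℝ) - x.1) := by
  obtain ⟨z, h, ho⟩ := exists_tri_eq_of_mem_of_mem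
    (side_subset_src e (by simp [hs] : x ∈ G.side e))
    (side_subset_src e (by simp [hs] : y ∈ G.side e)) hxy
  rw [cellFlow_eq_src hs h]
  rcases ho with ho | ho
  · have := congrArg Prod.fst (G.pos_src e x y z hs (by simp [h]) ho)
    simp [latticeToPlane] at this
    rw [ho, this]; simp
  · have := congrArg Prod.fst (G.pos_src e y x z (by rw [hs, Finset.pair_comm]) (by simp [h])
      (by rw [orient_swap_left, ho]; norm_num))
    simp [latticeToPlane] at this
    rw [ho, this]; simp; ring

end DualGraph

namespace DualGraph

/-! ### Chords in the core -/

/-- The number of lattice points of the big triangle strictly to the left of `u w`. -/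
def leftCount (u w : ℤ × ℤ) : ℕ := (quarticPoints.filter fun q => 0 < orient u w q).card

/-- If there is no interior lattice point to the left of a boundary chord, then the same holds for
the two other sides of the triangle to its left, and these have fewer points on that side. -/
theorem chord_step : ∀ u ∈ quarticPoints \ interiorPoints, ∀ w ∈ quarticPoints \ interiorPoints,
    ∀ z ∈ quarticPoints \ interiorPoints, orient u w z = 1 →
    (∀ x ∈ interiorPoints, orient u w x ≤ 0) →
    ((∀ x ∈ interiorPoints, orient u z x ≤ 0) ∧ leftCount u z < leftCount u w) ∧
    ((∀ x ∈ interiorPoints, orient z w x ≤ 0) ∧ leftCount z w < leftCount u w) := by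
  decide +kernel

/-- The triangles with exactly one interior vertex whose opposite side has an interior lattice point
on its other side, too. -/
theorem chord_list : ∀ x ∈ interiorPoints, ∀ y ∈ quarticPoints \ interiorPoints,
    ∀ z ∈ quarticPoints \ interiorPoints, orient x y z = 1 →
    (∃ x' ∈ interiorPoints, orient y z x' < 0) → (x, y, z) ∈ ({
      ((1,1), (1,0), (2,2)), ((2,1), (2,2), (1,0)),
      ((1,1), (2,2), (0,1)), ((1,2), (0,1), (2,2)),
      ((1,1), (2,0), (0,3)), ((1,2), (0,3), (2,0)),
      ((1,1), (3,0), (0,2)), ((2,1), (0,2), (3,0)),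
      ((1,2), (2,0), (1,3)), ((2,1), (1,3), (2,0)),
      ((1,2), (0,2), (3,1)), ((2,1), (3,1), (0,2))} : Finset ((ℤ × ℤ) × (ℤ × ℤ) × (ℤ × ℤ))) := by
  decide +kernel

variable {G : DualGraph}

/-- There is a triangle to the left of every directed side that is dual to an edge. -/
theorem exists_tri_left {e : G.E} {u w : ℤ × ℤ} (hs : G.side e = {u, w}) (huw : u ≠ w) :
    ∃ v z, (v = G.src e ∨ v = G.tgt e) ∧ G.tri v = {u, w, z} ∧ orient u w z = 1 := by
  have hu : u ∈ G.side e := by simp [hs]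
  have hw : w ∈ G.side e := by simp [hs]
  obtain ⟨z, h, ho⟩ := exists_tri_eq_of_mem_of_mem (side_subset_src e hu) (side_subset_src e hw) huw
  obtain ⟨z', h', -⟩ := exists_tri_eq_of_mem_of_mem (side_subset_tgt e hu) (side_subset_tgt e hw)
    huw
  rcases ho with ho | ho
  · exact ⟨_, z, .inl rfl, h, ho⟩
  · exact ⟨_, z', .inr rfl, h', by rw [orient_tgt_eq_neg hs h h', ho]; norm_num⟩

theorem exists_core_ne {e : G.E} (he : e ∈ G.core) {v : G.V} (hv : v = G.src e ∨ v = G.tgt e) :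
    ∃ e' ∈ G.core, e' ≠ e ∧ G.side e' ⊆ G.tri v := by
  rcases hv with rfl | rfl
  · obtain ⟨e', h1, h2, h3⟩ := (G.core_leafless e he).1
    exact ⟨e', h1, h2, (G.side_subset_tri _ _).2 (h3.imp Eq.symm Eq.symm)⟩
  · obtain ⟨e', h1, h2, h3⟩ := (G.core_leafless e he).2
    exact ⟨e', h1, h2, (G.side_subset_tri _ _).2 (h3.imp Eq.symm Eq.symm)⟩

/-- A chord between boundary points whose dual edge belongs to the core has interior lattice points
on both of its sides: otherwise the leafless core would continue into a part of the triangulation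
whose dual graph is a forest. -/
theorem exists_interior_left {e : G.E} (he : e ∈ G.core) {u w : ℤ × ℤ} (hs : G.side e = {u, w})
    (hu : u ∉ interiorPoints) (hw : w ∉ interiorPoints) :
    ∃ x ∈ interiorPoints, 0 < orient u w x := by
  by_contra! hneg
  induction hk : leftCount u w using Nat.strong_induction_on generalizing e u w with
  | _ k ih =>
    have huw : u ≠ w := by
      rintro rfl
      have := G.side_card e
      simp [hs] at this
    obtain ⟨v, z, hv, h, ho⟩ := exists_tri_left hs huw
    have hz : z ∉ interiorPoints := fun hz => by
      have := hneg z hz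
      omega
    have hq : ∀ q ∈ ({u, w, z} : Finset (ℤ × ℤ)), q ∉ interiorPoints →
        q ∈ quarticPoints \ interiorPoints := fun q hq hq' =>
      Finset.mem_sdiff.2 ⟨G.tri_subset v (h ▸ hq), hq'⟩
    obtain ⟨⟨h1, h2⟩, h3, h4⟩ := chord_step u (hq u (by simp) hu) w (hq w (by simp) hw) z
      (hq z (by simp) hz) ho hneg
    obtain ⟨e', he', hne, hsub⟩ := exists_core_ne he hv
    rw [h] at hsub
    rcases eq_pair_of_subset (G.side_card e') hsub with h' | h' | h'
    · exact hne (G.side_injective (h'.trans hs.symm))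
    · exact ih _ (hk ▸ h4) he' (h'.trans (Finset.pair_comm _ _)) hz hw h3 rfl
    · exact ih _ (hk ▸ h2) he' h' hu hz h1 rfl

theorem core_chord_mem {e : G.E} (he : e ∈ G.core) {v : G.V} {x y z : ℤ × ℤ}
    (h : G.tri v = {x, y, z}) (ho : orient x y z = 1) (hs : G.side e = {y, z})
    (hx : x ∈ interiorPoints) (hy : y ∉ interiorPoints) (hz : z ∉ interiorPoints) :
    (x, y, z) ∈ ({
      ((1,1), (1,0), (2,2)), ((2,1), (2,2), (1,0)),
      ((1,1), (2,2), (0,1)), ((1,2), (0,1), (2,2)),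
      ((1,1), (2,0), (0,3)), ((1,2), (0,3), (2,0)),
      ((1,1), (3,0), (0,2)), ((2,1), (0,2), (3,0)),
      ((1,2), (2,0), (1,3)), ((2,1), (1,3), (2,0)),
      ((1,2), (0,2), (3,1)), ((2,1), (3,1), (0,2))} :
        Finset ((ℤ × ℤ) × (ℤ × ℤ) × (ℤ × ℤ))) := by
  obtain ⟨x', hx', hpos⟩ := exists_interior_left he (hs.trans (Finset.pair_comm _ _)) hz hy
  exact chord_list x hx y (Finset.mem_sdiff.2 ⟨G.tri_subset v (by simp [h]), hy⟩) z
    (Finset.mem_sdiff.2 ⟨G.tri_subset v (by simp [h]), hz⟩) ho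
    ⟨x', hx', by rw [orient_swap_left] at hpos; omega⟩

/-! ### Slopes of rational functions -/

variable (G) in
/-- The outgoing slope at `v` along `e` of a function with slope `n e` at the start of the edge `e`
which gains slope `c e` in its interior. -/
noncomputable def outSlope (n c : G.E → ℤ) (v : G.V) (e : G.E) : ℤ :=
  (if G.src e = v then n e else 0) - (if G.tgt e = v then n e + c e else 0)

variable (G) in
/-- `F` and `n` are the values at the vertices and the slopes at the starts of the edges of a
rational function on the core whose divisor is supported in the interior of edges, with `c e` chips
on `e`, the distances of which to the end of `e` add up to `μ e`. -/
structure IsGradient (c : G.E → ℤ) (μ : G.E → ℝ) (F : G.V → ℝ) (n : G.E → ℤ) : Prop where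
  slope_eq_zero : ∀ e ∉ G.core, n e = 0
  chips_eq_zero : ∀ e ∉ G.core, c e = 0
  sub_eq : ∀ e ∈ G.core, F (G.tgt e) - F (G.src e) = n e * G.len e + μ e
  sum_outSlope : ∀ v, ∑ e, G.outSlope n c v e = 0

theorem outSlope_eq (n c : G.E → ℤ) (v : G.V) (e : G.E) :
    G.outSlope n c v e = G.incidence v e * n e - (if G.tgt e = v then c e else 0) := by
  simp only [outSlope, incidence]
  split_ifs <;> ring

theorem outSlope_eq_zero_of_not_subset {n c : G.E → ℤ} {v : G.V} {e : G.E}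
    (h : ¬ G.side e ⊆ G.tri v) : G.outSlope n c v e = 0 := by
  rw [G.side_subset_tri] at h
  push Not at h
  simp [outSlope, h.1.symm, h.2.symm]

theorem energy_nonneg (n : ℤ) {l k : ℝ} (h : |k| ≤ l) : 0 ≤ (n : ℝ) * (n * l + k) := by
  obtain ⟨h1, h2⟩ := abs_le.1 h
  rcases lt_trichotomy n 0 with hn | rfl | hn
  · have : (n : ℝ) ≤ -1 := by exact_mod_cast Int.le_sub_one_of_lt hn
    exact mul_nonneg_of_nonpos_of_nonpos (by linarith) (by nlinarith)
  · simp
  · have : (1 : ℝ) ≤ n := by exact_mod_cast hn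
    exact mul_nonneg (by linarith) (by nlinarith)

theorem eq_zero_of_energy_eq_zero {n : ℤ} {l k : ℝ} (h : |k| < l)
    (h0 : (n : ℝ) * (n * l + k) = 0) : n = 0 := by
  obtain ⟨h1, h2⟩ := abs_lt.1 h
  rcases mul_eq_zero.1 h0 with h3 | h3
  · exact_mod_cast h3
  · rcases lt_trichotomy n 0 with hn | rfl | hn
    · have : (n : ℝ) ≤ -1 := by exact_mod_cast Int.le_sub_one_of_lt hn
      nlinarith
    · rfl
    · have : (1 : ℝ) ≤ n := by exact_mod_cast hn
      nlinarith

theorem eq_zero_or_of_energy_eq_zero {n t : ℤ} {l : ℝ} (hl : 0 < l)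
    (h0 : (n : ℝ) * (n * l + t * l) = 0) : n = 0 ∨ n = -t := by
  have h : (n : ℝ) * (n + t) = 0 := by
    have : ((n : ℝ) * (n + t)) * l = 0 := by linarith
    exact (mul_eq_zero.1 this).resolve_right hl.ne'
  have h' : n * (n + t) = 0 := by exact_mod_cast h
  rcases mul_eq_zero.1 h' with h | h
  · exact .inl h
  · right; omega

/-- Moving chips by less than the edge lengths within their edges leaves a function constant off
these edges: the slope flow is orthogonal to itself. -/
theorem IsGradient.slope_eq_zero_of_small {μ : G.E → ℝ} {F : G.V → ℝ} {n : G.E → ℤ}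
    (h : G.IsGradient (fun _ => 0) μ F n) (hμ : ∀ e, |μ e| < G.len e) : n = 0 := by
  have hc : G.IsCirculation n := fun v => by
    rw [← h.sum_outSlope v]
    exact Finset.sum_congr rfl fun e _ => by rw [outSlope_eq]; simp
  have hsum := hc.sum_mul_sub_eq_zero F
  have hterm : ∀ e, (n e : ℝ) * (F (G.tgt e) - F (G.src e)) = n e * (n e * G.len e + μ e) := by
    intro e
    by_cases he : e ∈ G.core
    · rw [h.sub_eq e he]
    · simp [h.slope_eq_zero e he]
  simp only [hterm] at hsum
  rw [Finset.sum_eq_zero_iff_of_nonneg fun e _ => energy_nonneg _ (hμ e).le] at hsum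
  funext e
  exact eq_zero_of_energy_eq_zero (hμ e) (hsum e (Finset.mem_univ e))

theorem IsGradient.sum_cellFlow_mul {c : G.E → ℤ} {μ : G.E → ℝ} {F : G.V → ℝ} {n : G.E → ℤ}
    (h : G.IsGradient c μ F n) {x : ℤ × ℤ} (hx : x ∈ interiorPoints) :
    ∑ e, (G.cellFlow x e : ℝ) * (n e * G.len e + μ e) = 0 := by
  rw [← (isCirculation_cellFlow hx).sum_mul_sub_eq_zero F]
  refine Finset.sum_congr rfl fun e _ => ?_
  by_cases he : x ∈ G.side e
  · rw [h.sub_eq e (G.mem_core e x hx he)]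
  · simp [cellFlow_eq_zero he]

/-- If the cell of `x` is attached to the rest of the core along the edge dual to `s` only, then
all chips on the cell have to leave through this edge. -/
theorem IsGradient.exists_flux {c : G.E → ℤ} {μ : G.E → ℝ} {F : G.V → ℝ} {n : G.E → ℤ}
    (h : G.IsGradient c μ F n) {x : ℤ × ℤ} {s : Finset (ℤ × ℤ)}
    (hs : ∀ v e, x ∈ G.tri v → G.side e ⊆ G.tri v → x ∉ G.side e → e ∈ G.core → G.side e = s)
    (hxs : x ∉ s) (hcs : ∀ e, G.side e = s → c e = 0) {k : ℤ} (hk : k ≠ 0)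
    (hck : (∑ e, if x ∈ G.side e then c e else 0) = k) :
    ∃ e, G.side e = s ∧ ∀ v, G.side e ⊆ G.tri v → x ∉ G.tri v → G.outSlope n c v e = -k := by
  set τ : G.E → ℤ := fun e => (if x ∈ G.tri (G.src e) then n e else 0) -
    (if x ∈ G.tri (G.tgt e) then n e + c e else 0) with hτ
  have h1 : ∑ e, τ e = 0 := by
    have : ∀ e, τ e = ∑ v, if x ∈ G.tri v then G.outSlope n c v e else 0 := by
      intro e
      have h2 : ∀ v, (if x ∈ G.tri v then G.outSlope n c v e else 0) =
          (if G.src e = v then (if x ∈ G.tri (G.src e) then n e else 0) else 0) -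
          (if G.tgt e = v then (if x ∈ G.tri (G.tgt e) then n e + c e else 0) else 0) := by
        intro v
        rw [outSlope]
        by_cases h1 : G.src e = v <;> by_cases h2 : G.tgt e = v <;> by_cases h3 : x ∈ G.tri v <;>
          simp [h1, h2, h3]
      simp [h2, hτ]
    simp only [this]
    rw [Finset.sum_comm]
    refine Finset.sum_eq_zero fun v _ => ?_
    split_ifs
    · exact h.sum_outSlope v
    · simp
  have h2 : ∀ e, τ e = (if G.side e = s then τ e else 0) - (if x ∈ G.side e then c e else 0) := by
    intro e
    by_cases hx : x ∈ G.side e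
    · have : G.side e ≠ s := fun h' => hxs (h' ▸ hx)
      simp [hτ, hx, this, side_subset_src e hx, side_subset_tgt e hx]
    · by_cases he : G.side e = s
      · simp [he, hxs]
      · simp only [hx, he, if_false, sub_zero]
        by_cases hc : e ∈ G.core
        · have h3 : x ∉ G.tri (G.src e) := fun h' => he (hs _ e h' (side_subset_src e) hx hc)
          have h4 : x ∉ G.tri (G.tgt e) := fun h' => he (hs _ e h' (side_subset_tgt e) hx hc)
          simp [hτ, h3, h4]
        · simp [hτ, h.slope_eq_zero e hc, h.chips_eq_zero e hc]
  have h3 : G.onSide s τ = k := by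
    rw [Finset.sum_congr rfl fun e _ => h2 e, Finset.sum_sub_distrib, hck] at h1
    rw [onSide]; omega
  obtain ⟨e, he, -⟩ := exists_of_onSide_ne_zero (h3.trans_ne hk)
  rw [onSide_eq he] at h3
  refine ⟨e, he, fun v hv hxv => ?_⟩
  have hc := hcs e he
  have hne := G.src_ne_tgt e
  rcases (G.side_subset_tri e v).1 hv with rfl | rfl
  · simp only [hτ, hxv, if_false, hc] at h3
    simp only [outSlope, if_true, hne.symm, if_false]
    split_ifs at h3 <;> omega
  · simp only [hτ, hxv, if_false, hc] at h3
    simp only [outSlope, if_true, hne, if_false, hc]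
    split_ifs at h3 <;> omega

end DualGraph

/-! ### The central cell and its cluster -/

namespace DualGraph

variable {G : DualGraph}

variable (G) in
/-- The cell of `(1,1)` is connected to those of `(2,1)` and `(1,2)`, either by a common edge or by
a bridge, the dual chord of which separates that point from the two other interior points. -/
structure IsCentral : Prop where
  right : G.Joined (1,1) (2,1) ∨ G.Joined (1,0) (2,2)
  up : G.Joined (1,1) (1,2) ∨ G.Joined (0,1) (2,2)

namespace IsCentral

theorem not_joined_of_cross_right (h : G.IsCentral) {u w : ℤ × ℤ}
    (h1 : orient u w (1,1) * orient u w (2,1) < 0 ∧ orient (1,1) (2,1) u * orient (1,1) (2,1) w < 0)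
    (h2 : orient u w (1,0) * orient u w (2,2) < 0 ∧
      orient (1,0) (2,2) u * orient (1,0) (2,2) w < 0) : ¬ G.Joined u w := fun hj =>
  h.right.elim (fun h => hj.not_cross h h1) (fun h => hj.not_cross h h2)

theorem not_joined_of_cross_up (h : G.IsCentral) {u w : ℤ × ℤ}
    (h1 : orient u w (1,1) * orient u w (1,2) < 0 ∧ orient (1,1) (1,2) u * orient (1,1) (1,2) w < 0)
    (h2 : orient u w (0,1) * orient u w (2,2) < 0 ∧
      orient (0,1) (2,2) u * orient (0,1) (2,2) w < 0) : ¬ G.Joined u w := fun hj =>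
  h.up.elim (fun h => hj.not_cross h h1) (fun h => hj.not_cross h h2)

theorem joined_right_of_joined (h : G.IsCentral) (hj : G.Joined (2,1) (1,2)) :
    G.Joined (1,1) (2,1) := h.right.resolve_right fun h' => hj.not_cross h' (by decide)

theorem joined_up_of_joined (h : G.IsCentral) (hj : G.Joined (2,1) (1,2)) :
    G.Joined (1,1) (1,2) := h.up.resolve_right fun h' => hj.not_cross h' (by decide)

/-- The chords that cut the core of a curve with central cell `(1,1)`. -/
theorem core_chord_mem (h : G.IsCentral) {e : G.E} (he : e ∈ G.core) {v : G.V} {x y z : ℤ × ℤ}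
    (ht : G.tri v = {x, y, z}) (ho : orient x y z = 1) (hs : G.side e = {y, z})
    (hx : x ∈ interiorPoints) (hy : y ∉ interiorPoints) (hz : z ∉ interiorPoints) :
    (x, y, z) ∈ ({((1,1), (1,0), (2,2)), ((2,1), (2,2), (1,0)),
      ((1,1), (2,2), (0,1)), ((1,2), (0,1), (2,2))} : Finset ((ℤ × ℤ) × (ℤ × ℤ) × (ℤ × ℤ))) := by
  have hj : G.Joined y z := ⟨v, by simp [ht], by simp [ht]⟩
  have hm := DualGraph.core_chord_mem he ht ho hs hx hy hz
  simp only [Finset.mem_insert, Finset.mem_singleton, Prod.mk.injEq] at hm ⊢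
  rcases hm with hm | hm | hm | hm | hm | hm | hm | hm | hm | hm | hm | hm
  · simp [hm]
  · simp [hm]
  · simp [hm]
  · simp [hm]
  all_goals
    exfalso
    obtain ⟨-, rfl, rfl⟩ := hm
  · exact h.not_joined_of_cross_right (by decide) (by decide) hj
  · exact h.not_joined_of_cross_right (by decide) (by decide) hj
  · exact h.not_joined_of_cross_up (by decide) (by decide) hj
  · exact h.not_joined_of_cross_up (by decide) (by decide) hj
  · exact h.not_joined_of_cross_right (by decide) (by decide) hj
  · exact h.not_joined_of_cross_right (by decide) (by decide) hj
  · exact h.not_joined_of_cross_up (by decide) (by decide) hj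
  · exact h.not_joined_of_cross_up (by decide) (by decide) hj

end IsCentral

variable (G) in
/-- The interior lattice points in the same connected component of the bridgeless part as `(1,1)`:
that point itself and the interior points joined to it. -/
def cluster : Set (ℤ × ℤ) :=
  {x | x = (1,1) ∨ x = (2,1) ∧ G.Joined (1,1) (2,1) ∨ x = (1,2) ∧ G.Joined (1,1) (1,2)}

theorem mem_interiorPoints {x : ℤ × ℤ} :
    x ∈ interiorPoints ↔ x = (1,1) ∨ x = (2,1) ∨ x = (1,2) := by simp [interiorPoints]

theorem interior_of_mem_cluster {x : ℤ × ℤ} (h : x ∈ G.cluster) : x ∈ interiorPoints := by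
  rw [mem_interiorPoints]
  rcases h with h | h | h
  · exact .inl h
  · exact .inr (.inl h.1)
  · exact .inr (.inr h.1)

theorem IsCentral.mem_cluster_of_joined (h : G.IsCentral) {x y : ℤ × ℤ} (hx : x ∈ G.cluster)
    (hy : y ∈ interiorPoints) (hj : G.Joined x y) : y ∈ G.cluster := by
  rw [mem_interiorPoints] at hy
  rcases hx with rfl | ⟨rfl, hx⟩ | ⟨rfl, hx⟩ <;> rcases hy with rfl | rfl | rfl
  · exact .inl rfl
  · exact .inr (.inl ⟨rfl, hj⟩)
  · exact .inr (.inr ⟨rfl, hj⟩)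
  · exact .inl rfl
  · exact .inr (.inl ⟨rfl, hx⟩)
  · exact .inr (.inr ⟨rfl, h.joined_up_of_joined hj⟩)
  · exact .inl rfl
  · exact .inr (.inl ⟨rfl, h.joined_right_of_joined hj.symm⟩)
  · exact .inr (.inr ⟨rfl, hx⟩)

variable (G) in
/-- The edges of the cells of the cluster. -/
def clusterEdges : Set G.E := {e | ∃ x ∈ G.side e, x ∈ G.cluster}

theorem mem_clusterEdges_of_center {e : G.E} (h : (1,1) ∈ G.side e) : e ∈ G.clusterEdges :=
  ⟨_, h, .inl rfl⟩

theorem mem_core_of_mem_clusterEdges {e : G.E} (h : e ∈ G.clusterEdges) : e ∈ G.core := by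
  obtain ⟨x, hx, hx'⟩ := h
  exact G.mem_core e x (interior_of_mem_cluster hx') hx

theorem joined_of_side {e : G.E} {u w : ℤ × ℤ} (hu : u ∈ G.side e) (hw : w ∈ G.side e) :
    G.Joined u w := ⟨G.src e, side_subset_src e hu, side_subset_src e hw⟩

/-- A core edge at a vertex of the cluster that is not an edge of the cluster is one of the two
possible bridges. -/
theorem IsCentral.bridge_of_not_mem (h : G.IsCentral) {v : G.V} {x : ℤ × ℤ} (hx : x ∈ G.tri v)
    (hxc : x ∈ G.cluster) {e : G.E} (he : e ∈ G.core) (hsub : G.side e ⊆ G.tri v)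
    (hec : e ∉ G.clusterEdges) :
    x = (1,1) ∧ (G.tri v = {(1,1), (1,0), (2,2)} ∧ G.side e = {(1,0), (2,2)} ∨
      G.tri v = {(1,1), (2,2), (0,1)} ∧ G.side e = {(2,2), (0,1)}) := by
  have hxe : x ∉ G.side e := fun h' => hec ⟨x, h', hxc⟩
  obtain ⟨y, z, ht, ho⟩ := exists_tri_eq hx
  have hs : G.side e = {y, z} := by
    rw [ht] at hsub
    rcases eq_pair_of_subset (G.side_card e) hsub with h' | h' | h'
    · exact absurd (by simp [h']) hxe
    · exact h'
    · exact absurd (by simp [h']) hxe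
  have hint : ∀ w ∈ G.side e, w ∉ interiorPoints := fun w hw hw' =>
    hec ⟨w, hw, h.mem_cluster_of_joined hxc hw' ⟨v, hx, hsub hw⟩⟩
  have hm := h.core_chord_mem he ht ho hs (interior_of_mem_cluster hxc) (hint y (by simp [hs]))
    (hint z (by simp [hs]))
  simp only [Finset.mem_insert, Finset.mem_singleton, Prod.mk.injEq] at hm
  rcases hm with ⟨rfl, rfl, rfl⟩ | ⟨rfl, rfl, rfl⟩ | ⟨rfl, rfl, rfl⟩ | ⟨rfl, rfl, rfl⟩
  · exact ⟨rfl, .inl ⟨ht, hs⟩⟩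
  · exfalso
    rcases hxc with h' | h' | h'
    · simp at h'
    · exact (joined_of_side (e := e) (u := (2,2)) (w := (1,0)) (by simp [hs])
        (by simp [hs])).not_cross h'.2 (by decide)
    · simp at h'
  · exact ⟨rfl, .inr ⟨ht, hs⟩⟩
  · exfalso
    rcases hxc with h' | h' | h'
    · simp at h'
    · simp at h'
    · exact (joined_of_side (e := e) (u := (0,1)) (w := (2,2)) (by simp [hs])
        (by simp [hs])).not_cross h'.2 (by decide)

variable (G) in
/-- Chips that are moved from the cell of `(1,2)` to that of `(2,1)`: two of them are placed on the
common edge of the latter with the cell of `(1,1)`, if it exists, and anywhere on the edges of the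
cell otherwise; likewise for the two which are removed. -/
structure IsTransfer (c : G.E → ℤ) (μ : G.E → ℝ) : Prop where
  center_right : ∀ e, G.side e = {(1,1), (2,1)} → c e = 2 ∧ |-G.len e + μ e| < G.len e
  center_up : ∀ e, G.side e = {(1,1), (1,2)} → c e = -2 ∧ |G.len e + μ e| < G.len e
  other : ∀ e ∈ G.clusterEdges, G.side e ≠ {(1,1), (2,1)} → G.side e ≠ {(1,1), (1,2)} →
    c e = 0 ∧ μ e = 0
  sum_right : ¬ G.Joined (1,1) (2,1) → (∑ e, if (2,1) ∈ G.side e then c e else 0) = 2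
  sum_up : ¬ G.Joined (1,1) (1,2) → (∑ e, if (1,2) ∈ G.side e then c e else 0) = -2
  bridge : ∀ e, (∀ x ∈ interiorPoints, x ∉ G.side e) → c e = 0

theorem IsTransfer.flux_right (h : G.IsCentral) {c : G.E → ℤ} {μ : G.E → ℝ} {F : G.V → ℝ}
    {n : G.E → ℤ} (hT : G.IsTransfer c μ) (hg : G.IsGradient c μ F n)
    (hj : ¬ G.Joined (1,1) (2,1)) : ∃ e, G.side e = {(1,0), (2,2)} ∧
      ∀ v, G.side e ⊆ G.tri v → (2,1) ∉ G.tri v → G.outSlope n c v e = -2 := by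
  refine hg.exists_flux (x := (2,1)) (s := {(1,0), (2,2)}) ?_ (by decide)
    (fun e he => hT.bridge e (by rw [he]; decide)) two_ne_zero (hT.sum_right hj)
  intro v e hv hsub hxe he
  obtain ⟨y, z, ht, ho⟩ := exists_tri_eq hv
  have hs : G.side e = {y, z} := by
    rw [ht] at hsub
    rcases eq_pair_of_subset (G.side_card e) hsub with h' | h' | h'
    · exact absurd (by simp [h']) hxe
    · exact h'
    · exact absurd (by simp [h']) hxe
  have hint : ∀ w ∈ G.side e, w ∉ interiorPoints := by
    intro w hw hw'
    rw [mem_interiorPoints] at hw'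
    rcases hw' with rfl | rfl | rfl
    · exact hj ⟨v, hsub hw, hv⟩
    · exact hxe hw
    · exact hj (h.joined_right_of_joined ⟨v, hv, hsub hw⟩)
  have hm := h.core_chord_mem he ht ho hs (by decide) (hint y (by simp [hs]))
    (hint z (by simp [hs]))
  simp only [Finset.mem_insert, Finset.mem_singleton, Prod.mk.injEq] at hm
  rcases hm with ⟨h', -, -⟩ | ⟨-, rfl, rfl⟩ | ⟨h', -, -⟩ | ⟨h', -, -⟩
  · simp at h'
  · rw [hs, Finset.pair_comm]
  · simp at h'
  · simp at h'

theorem IsTransfer.flux_up (h : G.IsCentral) {c : G.E → ℤ} {μ : G.E → ℝ} {F : G.V → ℝ}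
    {n : G.E → ℤ} (hT : G.IsTransfer c μ) (hg : G.IsGradient c μ F n)
    (hj : ¬ G.Joined (1,1) (1,2)) : ∃ e, G.side e = {(2,2), (0,1)} ∧
      ∀ v, G.side e ⊆ G.tri v → (1,2) ∉ G.tri v → G.outSlope n c v e = - -2 := by
  refine hg.exists_flux (x := (1,2)) (s := {(2,2), (0,1)}) ?_ (by decide)
    (fun e he => hT.bridge e (by rw [he]; decide)) (by norm_num) (hT.sum_up hj)
  intro v e hv hsub hxe he
  obtain ⟨y, z, ht, ho⟩ := exists_tri_eq hv
  have hs : G.side e = {y, z} := by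
    rw [ht] at hsub
    rcases eq_pair_of_subset (G.side_card e) hsub with h' | h' | h'
    · exact absurd (by simp [h']) hxe
    · exact h'
    · exact absurd (by simp [h']) hxe
  have hint : ∀ w ∈ G.side e, w ∉ interiorPoints := by
    intro w hw hw'
    rw [mem_interiorPoints] at hw'
    rcases hw' with rfl | rfl | rfl
    · exact hj ⟨v, hsub hw, hv⟩
    · exact hj (h.joined_up_of_joined ⟨v, hsub hw, hv⟩)
    · exact hxe hw
  have hm := h.core_chord_mem he ht ho hs (by decide) (hint y (by simp [hs]))
    (hint z (by simp [hs]))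
  simp only [Finset.mem_insert, Finset.mem_singleton, Prod.mk.injEq] at hm
  rcases hm with ⟨h', -, -⟩ | ⟨h', -, -⟩ | ⟨h', -, -⟩ | ⟨-, rfl, rfl⟩
  · simp at h'
  · simp at h'
  · simp at h'
  · rw [hs, Finset.pair_comm]

/-! ### Comparison of the two arcs of the central cell -/

variable (G) in
/-- The slopes at the starts of the edges of the cell of `(1,1)` for the function that would move
the chips symmetrically along both arcs of this cell. -/
noncomputable def arcSlope (e : G.E) : ℤ :=
  if G.side e = {(1,1), (2,1)} then -1
  else if G.side e = {(1,1), (1,2)} then 1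
  else if G.side e = {(1,1), (2,2)} then G.cellFlow (1,1) e
  else -G.cellFlow (1,1) e

theorem arcSlope_eq_zero {e : G.E} (h : (1,1) ∉ G.side e) : G.arcSlope e = 0 := by
  have : ∀ y : ℤ × ℤ, G.side e ≠ {(1,1), y} := fun y h' => h (by simp [h'])
  simp [arcSlope, this, cellFlow_eq_zero h]

variable (G) in
/-- The deviation of the slopes `n` in the cluster from `arcSlope`. -/
noncomputable def slopeDefect (n : G.E → ℤ) (e : G.E) : ℤ :=
  if e ∈ G.clusterEdges then n e - G.arcSlope e else 0

/-- The contribution to `slopeDefect` of the first side `(1,1) y` of a triangle. -/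
def firstCorrection (y : ℤ × ℤ) : ℤ :=
  if y = (2,1) then 1 else if y = (1,2) then -1 else if y = (2,2) then 1 else -1

/-- The contribution to `slopeDefect` of the last side `(1,1) z` of a triangle. -/
def lastCorrection (z : ℤ × ℤ) : ℤ :=
  if z = (2,1) then 1 else if z = (1,2) then -1 else if z = (2,2) then -1 else 1

/-- The two excluded pairs are cut by the connection of `(1,1)` with `(1,2)` or `(2,1)`; the pairs with
a non-zero sum are the triangles at a bridge. -/
theorem correction_add : ∀ y ∈ quarticPoints, ∀ z ∈ quarticPoints, orient (1,1) y z = 1 →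
    (y, z) ≠ ((2,1), (0,2)) → (y, z) ≠ ((2,0), (1,2)) →
    firstCorrection y + lastCorrection z =
      if (y, z) = ((1,0), (2,2)) then -2 else if (y, z) = ((2,2), (0,1)) then 2 else 0 := by
  decide +kernel

theorem pair_inj {x y z : ℤ × ℤ} (hy : x ≠ y) : ({x, y} : Finset (ℤ × ℤ)) = {x, z} ↔ y = z := by
  constructor
  · intro h
    have : y ∈ ({x, z} : Finset (ℤ × ℤ)) := h ▸ by simp
    simpa [hy.symm] using this
  · rintro rfl; rfl

theorem incidence_mul_slopeDefect {n c : G.E → ℤ} {μ : G.E → ℝ} (hT : G.IsTransfer c μ) {e : G.E}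
    (he : e ∈ G.clusterEdges) {v : G.V} (hv : G.side e ⊆ G.tri v) :
    G.incidence v e * G.slopeDefect n e = G.outSlope n c v e +
      if G.side e = {(1,1), (2,1)} then 1
      else if G.side e = {(1,1), (1,2)} then -1
      else -(G.incidence v e * G.arcSlope e) := by
  have hne := G.src_ne_tgt e
  rw [slopeDefect, if_pos he, outSlope_eq]
  by_cases h1 : G.side e = {(1,1), (2,1)}
  · rw [arcSlope, if_pos h1, if_pos h1, (hT.center_right e h1).1]
    rcases (G.side_subset_tri e v).1 hv with rfl | rfl
    · rw [incidence_src, if_neg hne.symm]; ring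
    · rw [incidence_tgt, if_pos rfl]; ring
  by_cases h2 : G.side e = {(1,1), (1,2)}
  · rw [arcSlope, if_neg h1, if_neg h1, if_pos h2, if_pos h2, (hT.center_up e h2).1]
    rcases (G.side_subset_tri e v).1 hv with rfl | rfl
    · rw [incidence_src, if_neg hne.symm]; ring
    · rw [incidence_tgt, if_pos rfl]; ring
  · rw [if_neg h1, if_neg h2, (hT.other e he h1 h2).1, ite_self]; ring

/-- Off the cell of `(1,1)` the defect is the slope itself. -/
theorem incidence_mul_slopeDefect_of_not_mem {n c : G.E → ℤ} {μ : G.E → ℝ}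
    (hT : G.IsTransfer c μ) {e : G.E} (he : e ∈ G.clusterEdges) {v : G.V}
    (hv : G.side e ⊆ G.tri v) (h : (1,1) ∉ G.side e) :
    G.incidence v e * G.slopeDefect n e = G.outSlope n c v e := by
  have : ∀ y : ℤ × ℤ, G.side e ≠ {(1,1), y} := fun y h' => h (by simp [h'])
  rw [incidence_mul_slopeDefect hT he hv, if_neg (this _), if_neg (this _), arcSlope_eq_zero h]
  ring

theorem incidence_mul_slopeDefect_first {n c : G.E → ℤ} {μ : G.E → ℝ} (hT : G.IsTransfer c μ)
    {e : G.E} {v : G.V} {y z : ℤ × ℤ} (hs : G.side e = {(1,1), y}) (ht : G.tri v = {(1,1), y, z})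
    (ho : orient (1,1) y z = 1) :
    G.incidence v e * G.slopeDefect n e = G.outSlope n c v e + firstCorrection y := by
  have hne := (ne_of_orient_ne_zero (orient_ne_zero ht)).1
  have hI := incidence_mul_cellFlow hs ht
  rw [incidence_mul_slopeDefect hT (mem_clusterEdges_of_center (by simp [hs]))
    (by rw [hs, ht]; intro; simp; tauto), firstCorrection, arcSlope, hs]
  simp only [pair_inj hne]
  split_ifs <;> simp_all

theorem incidence_mul_slopeDefect_last {n c : G.E → ℤ} {μ : G.E → ℝ} (hT : G.IsTransfer c μ)
    {e : G.E} {v : G.V} {y z : ℤ × ℤ} (hs : G.side e = {(1,1), z}) (ht : G.tri v = {(1,1), y, z})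
    (ho : orient (1,1) y z = 1) :
    G.incidence v e * G.slopeDefect n e = G.outSlope n c v e + lastCorrection z := by
  have ht' : G.tri v = {(1,1), z, y} := by rw [ht, Finset.pair_comm]
  have hne := (ne_of_orient_ne_zero (orient_ne_zero ht')).1
  have hI := incidence_mul_cellFlow hs ht'
  rw [orient_swap_right, ho] at hI
  rw [incidence_mul_slopeDefect hT (mem_clusterEdges_of_center (by simp [hs]))
    (by rw [hs, ht]; intro; simp; tauto), lastCorrection, arcSlope, hs]
  simp only [pair_inj hne]
  split_ifs <;> simp_all

end DualGraph

/-! ### The deviation from symmetric slopes -/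

namespace DualGraph

variable {G : DualGraph}

theorem onSide_congr {M : Type*} [AddCommMonoid M] {s : Finset (ℤ × ℤ)} {φ ψ : G.E → M}
    (h : ∀ e, G.side e = s → φ e = ψ e) : G.onSide s φ = G.onSide s ψ :=
  Finset.sum_congr rfl fun e _ => by split_ifs with h'; exacts [h e h', rfl]

theorem eq_or_swap_of_pair_eq {x y u w : ℤ × ℤ}
    (h : ({x, y} : Finset (ℤ × ℤ)) = {u, w}) : x = u ∧ y = w ∨ x = w ∧ y = u := by
  have h1 : x ∈ ({u, w} : Finset (ℤ × ℤ)) := h ▸ by simp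
  have h2 : y ∈ ({u, w} : Finset (ℤ × ℤ)) := h ▸ by simp
  have h3 : u ∈ ({x, y} : Finset (ℤ × ℤ)) := h ▸ by simp
  have h4 : w ∈ ({x, y} : Finset (ℤ × ℤ)) := h ▸ by simp
  simp only [Finset.mem_insert, Finset.mem_singleton] at h1 h2 h3 h4
  rcases h1 with rfl | rfl <;> rcases h2 with rfl | rfl <;> simp_all

theorem IsGradient.outSlope_eq_zero {c : G.E → ℤ} {μ : G.E → ℝ} {F : G.V → ℝ} {n : G.E → ℤ}
    (h : G.IsGradient c μ F n) {e : G.E} (he : e ∉ G.core) (v : G.V) : G.outSlope n c v e = 0 := by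
  simp [outSlope, h.slope_eq_zero e he, h.chips_eq_zero e he]

theorem slopeDefect_eq_zero {n : G.E → ℤ} {e : G.E} (h : e ∉ G.clusterEdges) :
    G.slopeDefect n e = 0 := if_neg h

theorem not_mem_clusterEdges {e : G.E} (h : ∀ x ∈ G.side e, x ∉ interiorPoints) :
    e ∉ G.clusterEdges := fun ⟨x, hx, hx'⟩ => h x hx (interior_of_mem_cluster hx')

/-- At a vertex of the cell of `(1,1)` the symmetric slopes balance with the two chips on the edges
to the neighbouring cells, or with the flux `2` through the bridges if there is no such edge. -/
theorem isCirculation_slopeDefect (h : G.IsCentral) {c : G.E → ℤ} {μ : G.E → ℝ} {F : G.V → ℝ}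
    {n : G.E → ℤ} (hT : G.IsTransfer c μ) (hg : G.IsGradient c μ F n) :
    G.IsCirculation (G.slopeDefect n) := by
  intro v
  by_cases hv : ∃ x ∈ G.tri v, x ∈ G.cluster
  swap
  · refine Finset.sum_eq_zero fun e _ => ?_
    by_cases hsub : G.side e ⊆ G.tri v
    · rw [slopeDefect_eq_zero, mul_zero]
      rintro ⟨x, hx, hx'⟩
      exact hv ⟨x, hsub hx, hx'⟩
    · rw [incidence_eq_zero hsub, zero_mul]
  by_cases ha : (1,1) ∈ G.tri v
  swap
  · obtain ⟨x, hx, hxc⟩ := hv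
    rw [← hg.sum_outSlope v]
    refine Finset.sum_congr rfl fun e _ => ?_
    by_cases hsub : G.side e ⊆ G.tri v
    · by_cases hec : e ∈ G.clusterEdges
      · exact incidence_mul_slopeDefect_of_not_mem hT hec hsub fun h' => ha (hsub h')
      · rw [slopeDefect_eq_zero hec, mul_zero]
        by_cases hco : e ∈ G.core
        · exact absurd ((h.bridge_of_not_mem hx hxc hco hsub hec).1 ▸ hx) ha
        · rw [hg.outSlope_eq_zero hco]
    · rw [incidence_eq_zero hsub, zero_mul, outSlope_eq_zero_of_not_subset hsub]
  · obtain ⟨y, z, ht, ho⟩ := exists_tri_eq ha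
    obtain ⟨h1, h2, h3⟩ := ne_of_orient_ne_zero (orient_ne_zero ht)
    have hy : y ∈ G.tri v := by simp [ht]
    have hz : z ∈ G.tri v := by simp [ht]
    have hj : G.Joined y z := ⟨v, hy, hz⟩
    obtain ⟨e1, he1⟩ := G.exists_edge v _ y ha hy h1 (by decide)
    obtain ⟨e2, he2⟩ := G.exists_edge v _ z ha hz h3 (by decide)
    have hK := hg.sum_outSlope v
    rw [sum_eq_onSide ht fun e he => outSlope_eq_zero_of_not_subset he, onSide_eq he1,
      onSide_eq he2] at hK
    rw [sum_eq_onSide ht fun e he => by rw [incidence_eq_zero he, zero_mul], onSide_eq he1,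
      onSide_eq he2, incidence_mul_slopeDefect_first hT he1 ht ho,
      incidence_mul_slopeDefect_last hT he2 ht ho]
    have hcorr := correction_add y (G.tri_subset v hy) z (G.tri_subset v hz) ho
      (fun h' => by
        obtain ⟨rfl, rfl⟩ := Prod.mk.inj h'
        exact h.not_joined_of_cross_up (by decide) (by decide) hj)
      (fun h' => by
        obtain ⟨rfl, rfl⟩ := Prod.mk.inj h'
        exact h.not_joined_of_cross_right (by decide) (by decide) hj)
    have hmid : G.onSide {y, z} (fun e => G.incidence v e * G.slopeDefect n e) =
        G.onSide {y, z} (G.outSlope n c v) + if (y, z) = ((1,0), (2,2)) then 2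
          else if (y, z) = ((2,2), (0,1)) then -2 else 0 := by
      split_ifs with hB hC
      · obtain ⟨rfl, rfl⟩ := Prod.mk.inj hB
        obtain ⟨e, he, hval⟩ := hT.flux_right h hg fun h' => hj.not_cross h' (by decide)
        rw [onSide_eq he, onSide_eq he, hval v (by rw [he, ht]; decide) (by rw [ht]; decide),
          slopeDefect_eq_zero (not_mem_clusterEdges (by rw [he]; decide))]
        ring
      · obtain ⟨rfl, rfl⟩ := Prod.mk.inj hC
        obtain ⟨e, he, hval⟩ := hT.flux_up h hg fun h' => hj.not_cross h' (by decide)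
        rw [onSide_eq he, onSide_eq he, hval v (by rw [he, ht]; decide) (by rw [ht]; decide),
          slopeDefect_eq_zero (not_mem_clusterEdges (by rw [he]; decide))]
        ring
      · rw [add_zero]
        refine onSide_congr fun e he => ?_
        have hsub : G.side e ⊆ G.tri v := by
          rw [he, ht]; exact Finset.subset_insert _ _
        have hae : (1,1) ∉ G.side e := by simp [he, h1, h3]
        by_cases hec : e ∈ G.clusterEdges
        · exact incidence_mul_slopeDefect_of_not_mem hT hec hsub hae
        · rw [slopeDefect_eq_zero hec, mul_zero]
          by_cases hco : e ∈ G.core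
          · exfalso
            rcases (h.bridge_of_not_mem ha (.inl rfl) hco hsub hec).2 with ⟨-, h'⟩ | ⟨-, h'⟩
            · rcases eq_or_swap_of_pair_eq (he.symm.trans h') with ⟨rfl, rfl⟩ | ⟨rfl, rfl⟩
              · exact hB rfl
              · exact absurd ho (by decide)
            · rcases eq_or_swap_of_pair_eq (he.symm.trans h') with ⟨rfl, rfl⟩ | ⟨rfl, rfl⟩
              · exact hC rfl
              · exact absurd ho (by decide)
          · rw [hg.outSlope_eq_zero hco]
    rw [hmid]
    have : (if (y, z) = ((1,0), (2,2)) then (-2 : ℤ) else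
        if (y, z) = ((2,2), (0,1)) then 2 else 0) = -(if (y, z) = ((1,0), (2,2)) then 2
          else if (y, z) = ((2,2), (0,1)) then -2 else 0) := by split_ifs <;> norm_num
    rw [this] at hcorr
    linarith

variable (G) in
/-- The part of the increment along an edge that is not accounted for by `slopeDefect`. -/
noncomputable def arcIncrement (μ : G.E → ℝ) (e : G.E) : ℝ := G.arcSlope e * G.len e + μ e

theorem arcIncrement_eq_zero {c : G.E → ℤ} {μ : G.E → ℝ} (hT : G.IsTransfer c μ) {e : G.E}
    (he : e ∈ G.clusterEdges) (h : (1,1) ∉ G.side e) : G.arcIncrement μ e = 0 := by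
  have : ∀ y : ℤ × ℤ, G.side e ≠ {(1,1), y} := fun y h' => h (by simp [h'])
  rw [arcIncrement, arcSlope_eq_zero h, (hT.other e he (this _) (this _)).2]
  simp

theorem abs_arcIncrement_lt {c : G.E → ℤ} {μ : G.E → ℝ} (hT : G.IsTransfer c μ) {e : G.E}
    (h : G.side e = {(1,1), (2,1)} ∨ G.side e = {(1,1), (1,2)}) :
    |G.arcIncrement μ e| < G.len e := by
  have hab : ({(1,1), (1,2)} : Finset (ℤ × ℤ)) ≠ {(1,1), (2,1)} := by decide
  rcases h with h | h
  · rw [arcIncrement, arcSlope, if_pos h]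
    have := (hT.center_right e h).2
    push_cast
    rwa [neg_one_mul]
  · rw [arcIncrement, arcSlope, if_neg (h.trans_ne hab), if_pos h]
    have := (hT.center_up e h).2
    push_cast
    rwa [one_mul]

theorem arcIncrement_eq {c : G.E → ℤ} {μ : G.E → ℝ} (hT : G.IsTransfer c μ) {e : G.E}
    (h : (1,1) ∈ G.side e) (h1 : G.side e ≠ {(1,1), (2,1)}) (h2 : G.side e ≠ {(1,1), (1,2)}) :
    G.arcIncrement μ e = ((if G.side e = {(1,1), (2,2)} then G.cellFlow (1,1) e
      else -G.cellFlow (1,1) e : ℤ) : ℝ) * G.len e := by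
  rw [arcIncrement, arcSlope, if_neg h1, if_neg h2,
    (hT.other e (mem_clusterEdges_of_center h) h1 h2).2, add_zero]

theorem abs_arcIncrement_le {c : G.E → ℤ} {μ : G.E → ℝ} (hT : G.IsTransfer c μ) {e : G.E}
    (he : e ∈ G.clusterEdges) : |G.arcIncrement μ e| ≤ G.len e := by
  have hl := G.len_pos e
  by_cases ha : (1,1) ∈ G.side e
  · by_cases h1 : G.side e = {(1,1), (2,1)}
    · exact (abs_arcIncrement_lt hT (.inl h1)).le
    by_cases h2 : G.side e = {(1,1), (1,2)}
    · exact (abs_arcIncrement_lt hT (.inr h2)).le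
    rw [arcIncrement_eq hT ha h1 h2]
    rcases cellFlow_eq_one_or ha with h | h <;> rw [h] <;> split_ifs <;>
      simp [abs_of_pos hl]
  · rw [arcIncrement_eq_zero hT he ha, abs_zero]; exact hl.le

theorem IsGradient.sub_eq_slopeDefect {c : G.E → ℤ} {μ : G.E → ℝ} {F : G.V → ℝ} {n : G.E → ℤ}
    (hg : G.IsGradient c μ F n) {e : G.E} (he : e ∈ G.clusterEdges) :
    F (G.tgt e) - F (G.src e) = G.slopeDefect n e * G.len e + G.arcIncrement μ e := by
  rw [hg.sub_eq e (mem_core_of_mem_clusterEdges he), slopeDefect, if_pos he, arcIncrement]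
  push_cast; ring

/-- The defect is a circulation which is orthogonal to the slopes; as the symmetric slopes have
absolute value at most `1`, this forces equality in the energy estimate on every edge. -/
theorem energy_eq_zero (h : G.IsCentral) {c : G.E → ℤ} {μ : G.E → ℝ} {F : G.V → ℝ}
    {n : G.E → ℤ} (hT : G.IsTransfer c μ) (hg : G.IsGradient c μ F n) {e : G.E}
    (he : e ∈ G.clusterEdges) :
    (G.slopeDefect n e : ℝ) * (G.slopeDefect n e * G.len e + G.arcIncrement μ e) = 0 := by
  have hsum := (isCirculation_slopeDefect h hT hg).sum_mul_sub_eq_zero F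
  have hterm : ∀ e, 0 ≤ (G.slopeDefect n e : ℝ) * (F (G.tgt e) - F (G.src e)) := by
    intro e
    by_cases he : e ∈ G.clusterEdges
    · rw [hg.sub_eq_slopeDefect he]
      exact energy_nonneg _ (abs_arcIncrement_le hT he)
    · simp [slopeDefect_eq_zero he]
  rw [Finset.sum_eq_zero_iff_of_nonneg fun e _ => hterm e] at hsum
  rw [← hg.sub_eq_slopeDefect he]
  exact hsum e (Finset.mem_univ e)

theorem slopeDefect_eq_zero_of_not_mem (h : G.IsCentral) {c : G.E → ℤ} {μ : G.E → ℝ} {F : G.V → ℝ}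
    {n : G.E → ℤ} (hT : G.IsTransfer c μ) (hg : G.IsGradient c μ F n) {e : G.E}
    (ha : (1,1) ∉ G.side e) : G.slopeDefect n e = 0 := by
  by_cases he : e ∈ G.clusterEdges
  · refine eq_zero_of_energy_eq_zero ?_ (energy_eq_zero h hT hg he)
    rw [arcIncrement_eq_zero hT he ha, abs_zero]
    exact G.len_pos e
  · exact slopeDefect_eq_zero he

theorem slopeDefect_eq_zero_of_side (h : G.IsCentral) {c : G.E → ℤ} {μ : G.E → ℝ} {F : G.V → ℝ}
    {n : G.E → ℤ} (hT : G.IsTransfer c μ) (hg : G.IsGradient c μ F n) {e : G.E}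
    (hs : G.side e = {(1,1), (2,1)} ∨ G.side e = {(1,1), (1,2)}) : G.slopeDefect n e = 0 :=
  eq_zero_of_energy_eq_zero (abs_arcIncrement_lt hT hs)
    (energy_eq_zero h hT hg (mem_clusterEdges_of_center (by rcases hs with hs | hs <;> simp [hs])))

theorem slopeDefect_eq_or (h : G.IsCentral) {c : G.E → ℤ} {μ : G.E → ℝ} {F : G.V → ℝ}
    {n : G.E → ℤ} (hT : G.IsTransfer c μ) (hg : G.IsGradient c μ F n) {e : G.E}
    (ha : (1,1) ∈ G.side e) (h1 : G.side e ≠ {(1,1), (2,1)}) (h2 : G.side e ≠ {(1,1), (1,2)}) :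
    G.slopeDefect n e = 0 ∨ G.slopeDefect n e =
      if G.side e = {(1,1), (2,2)} then -G.cellFlow (1,1) e else G.cellFlow (1,1) e := by
  have hE := energy_eq_zero h hT hg (mem_clusterEdges_of_center ha)
  rw [arcIncrement_eq hT ha h1 h2] at hE
  refine (eq_zero_or_of_energy_eq_zero (G.len_pos e) hE).imp_right fun h' => ?_
  rw [h']
  split_ifs <;> simp

/-- The increment along the common edge of two cells of the cluster vanishes, by the cycle condition
for the other cell. -/
theorem arcIncrement_eq_zero_of_side (h : G.IsCentral) {c : G.E → ℤ} {μ : G.E → ℝ} {F : G.V → ℝ}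
    {n : G.E → ℤ} (hT : G.IsTransfer c μ) (hg : G.IsGradient c μ F n) {e : G.E} {x : ℤ × ℤ}
    (hx : x = (2,1) ∨ x = (1,2)) (hs : G.side e = {(1,1), x}) : G.arcIncrement μ e = 0 := by
  have hj : G.Joined (1,1) x := joined_of_side (e := e) (by simp [hs]) (by simp [hs])
  have hxc : x ∈ G.cluster := by
    rcases hx with rfl | rfl
    · exact .inr (.inl ⟨rfl, hj⟩)
    · exact .inr (.inr ⟨rfl, hj⟩)
  have hxe : x ∈ G.side e := by simp [hs]
  have hsum := (isCirculation_cellFlow (interior_of_mem_cluster hxc)).sum_mul_sub_eq_zero F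
  rw [Finset.sum_eq_single e] at hsum
  · rw [hg.sub_eq_slopeDefect ⟨x, hxe, hxc⟩, slopeDefect_eq_zero_of_side h hT hg
      (by rcases hx with rfl | rfl <;> simp [hs])] at hsum
    rcases cellFlow_eq_one_or hxe with h' | h' <;> rw [h'] at hsum <;> simpa using hsum
  · intro e' _ hne
    by_cases hxe' : x ∈ G.side e'
    · have ha : (1,1) ∉ G.side e' := by
        intro ha
        refine hne (G.side_injective ?_)
        rw [hs]
        refine (Finset.eq_of_subset_of_card_le ?_ ?_).symm
        · intro w hw
          simp only [Finset.mem_insert, Finset.mem_singleton] at hw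
          rcases hw with rfl | rfl <;> assumption
        · rw [← hs, G.side_card, G.side_card]
      rw [hg.sub_eq_slopeDefect ⟨x, hxe', hxc⟩, slopeDefect_eq_zero_of_not_mem h hT hg ha,
        arcIncrement_eq_zero hT ⟨x, hxe', hxc⟩ ha]
      simp
    · simp [cellFlow_eq_zero hxe']
  · simp

end DualGraph

/-! ### The horizontal displacement around the central cell -/

namespace DualGraph

variable {G : DualGraph}

variable (G) in
/-- A combination of two terms that add up to zero: of the increments around the cell of `(1,1)`
and of the horizontal displacements along the circulation `cellFlow (1,1) - slopeDefect`. -/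
noncomputable def arcBalance (F : G.V → ℝ) (n : G.E → ℤ) (e : G.E) : ℝ :=
  -((G.cellFlow (1,1) e : ℝ) * (F (G.tgt e) - F (G.src e))) -
    ((G.cellFlow (1,1) e - G.slopeDefect n e : ℤ) : ℝ) *
      ((G.pos (G.tgt e)).1 - (G.pos (G.src e)).1)

theorem isCirculation_cellFlow_sub (h : G.IsCentral) {c : G.E → ℤ} {μ : G.E → ℝ} {F : G.V → ℝ}
    {n : G.E → ℤ} (hT : G.IsTransfer c μ) (hg : G.IsGradient c μ F n) :
    G.IsCirculation fun e => G.cellFlow (1,1) e - G.slopeDefect n e := by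
  intro v
  simp only [mul_sub, Finset.sum_sub_distrib, isCirculation_slopeDefect h hT hg v,
    isCirculation_cellFlow (G := G) (x := (1,1)) (by decide) v, sub_zero]

theorem sum_arcBalance (h : G.IsCentral) {c : G.E → ℤ} {μ : G.E → ℝ} {F : G.V → ℝ}
    {n : G.E → ℤ} (hT : G.IsTransfer c μ) (hg : G.IsGradient c μ F n) :
    ∑ e, G.arcBalance F n e = 0 := by
  simp only [arcBalance, Finset.sum_sub_distrib, Finset.sum_neg_distrib]
  rw [(isCirculation_cellFlow (G := G) (x := (1,1)) (by decide)).sum_mul_sub_eq_zero F,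
    (isCirculation_cellFlow_sub h hT hg).sum_mul_sub_eq_zero fun v => (G.pos v).1]
  simp

theorem arcBalance_eq (d : ℝ) {F : G.V → ℝ} {n : G.E → ℤ} {e : G.E} {y : ℤ × ℤ}
    (hs : G.side e = {(1,1), y}) (hF : F (G.tgt e) - F (G.src e) = d) :
    G.arcBalance F n e = -((G.cellFlow (1,1) e : ℝ) * d) +
      (1 - G.cellFlow (1,1) e * G.slopeDefect n e) * (G.len e * (y.1 - 1)) := by
  have hy : (1,1) ≠ y := by
    rintro rfl
    have := G.side_card e
    simp [hs] at this
  have hpos := cellFlow_mul_pos hs hy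
  have hsq : (G.cellFlow (1,1) e : ℝ) * G.cellFlow (1,1) e = 1 := by
    exact_mod_cast cellFlow_mul_self (by simp [hs] : (1,1) ∈ G.side e)
  rw [arcBalance, hF]
  push_cast at hpos ⊢
  linear_combination (-1 + (G.cellFlow (1,1) e : ℝ) * G.slopeDefect n e) * hpos +
    (G.slopeDefect n e : ℝ) * ((G.pos (G.src e)).1 - (G.pos (G.tgt e)).1) * hsq

/-- All terms of the balance are non-negative. The term of a common edge with the cell of `(2,1)` is
its length, and if the term of the edge dual to `(1,1) (1,0)` or `(1,1) (2,2)` vanishes then the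
defect is known there. -/
theorem arcBalance_nonneg (h : G.IsCentral) {c : G.E → ℤ} {μ : G.E → ℝ} {F : G.V → ℝ}
    {n : G.E → ℤ} (hT : G.IsTransfer c μ) (hg : G.IsGradient c μ F n) (e : G.E) :
    0 ≤ G.arcBalance F n e ∧ (G.side e = {(1,1), (2,1)} → 0 < G.arcBalance F n e) ∧
      (G.side e = {(1,1), (1,0)} → G.arcBalance F n e = 0 →
        G.slopeDefect n e = G.cellFlow (1,1) e) ∧
      (G.side e = {(1,1), (2,2)} → G.arcBalance F n e = 0 → G.slopeDefect n e = 0) := by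
  have hl := G.len_pos e
  have hab : ({(1,1), (1,2)} : Finset (ℤ × ℤ)) ≠ {(1,1), (2,1)} := by decide
  by_cases ha : (1,1) ∈ G.side e
  swap
  · have hne : ∀ y : ℤ × ℤ, G.side e ≠ {(1,1), y} := fun y h' => ha (by simp [h'])
    refine ⟨?_, fun h' => absurd h' (hne _), fun h' => absurd h' (hne _),
      fun h' => absurd h' (hne _)⟩
    rw [arcBalance, cellFlow_eq_zero ha, slopeDefect_eq_zero_of_not_mem h hT hg ha]
    simp
  obtain ⟨y, hy, hs⟩ := exists_side_eq_of_mem ha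
  have hy0 : (0 : ℝ) ≤ y.1 := by
    have : y ∈ quarticPoints := G.tri_subset _ (side_subset_src e (by simp [hs]))
    exact_mod_cast (mem_quarticPoints.1 this).1
  have hsq : (G.cellFlow (1,1) e : ℝ) * G.cellFlow (1,1) e = 1 := by
    exact_mod_cast cellFlow_mul_self ha
  rw [arcBalance_eq _ hs (hg.sub_eq_slopeDefect (mem_clusterEdges_of_center ha))]
  simp only [hs, pair_inj hy]
  by_cases h1 : y = (2,1)
  · subst h1
    rw [slopeDefect_eq_zero_of_side h hT hg (.inl hs),
      arcIncrement_eq_zero_of_side h hT hg (.inl rfl) hs]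
    norm_num [hl, hl.le]
  by_cases h2 : y = (1,2)
  · subst h2
    rw [slopeDefect_eq_zero_of_side h hT hg (.inr hs),
      arcIncrement_eq_zero_of_side h hT hg (.inr rfl) hs]
    norm_num
  have h1' : G.side e ≠ {(1,1), (2,1)} := by rwa [hs, Ne, pair_inj hy]
  have h2' : G.side e ≠ {(1,1), (1,2)} := by rwa [hs, Ne, pair_inj hy]
  have hor := slopeDefect_eq_or h hT hg ha h1' h2'
  rw [arcIncrement_eq hT ha h1' h2']
  simp only [hs, pair_inj hy] at hor ⊢
  by_cases h3 : y = (2,2)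
  · subst h3
    simp only [if_true] at hor ⊢
    rcases hor with h' | h' <;> rw [h']
    · norm_num [← mul_assoc, hsq]
    · push_cast
      have : -((G.cellFlow (1,1) e : ℝ) * (-G.cellFlow (1,1) e * G.len e +
          G.cellFlow (1,1) e * G.len e)) + (1 - G.cellFlow (1,1) e * -G.cellFlow (1,1) e) *
          (G.len e * (2 - 1)) = 2 * G.len e := by
        linear_combination G.len e * hsq
      rw [this]
      refine ⟨by linarith, fun h' => absurd h' (by decide), fun h' => absurd h' (by decide),
        fun _ h' => by linarith⟩
  · simp only [h1, h3, if_false] at hor ⊢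
    rcases hor with h' | h' <;> rw [h']
    · have : -((G.cellFlow (1,1) e : ℝ) * (((0 : ℤ) : ℝ) * G.len e +
          ((-G.cellFlow (1,1) e : ℤ) : ℝ) * G.len e)) +
          (1 - G.cellFlow (1,1) e * ((0 : ℤ) : ℝ)) * (G.len e * (y.1 - 1)) =
          G.len e * y.1 := by
        push_cast
        linear_combination G.len e * hsq
      rw [this]
      refine ⟨by positivity, fun h' => absurd h' id, fun hy1 h' => ?_, fun h' => absurd h' id⟩
      rw [hy1] at h'
      norm_num at h'
      exact absurd h' hl.ne'
    · have : -((G.cellFlow (1,1) e : ℝ) * (G.cellFlow (1,1) e * G.len e +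
          ((-G.cellFlow (1,1) e : ℤ) : ℝ) * G.len e)) +
          (1 - G.cellFlow (1,1) e * G.cellFlow (1,1) e) * (G.len e * (y.1 - 1)) = 0 := by
        push_cast
        linear_combination -(G.len e * (y.1 - 1)) * hsq
      rw [this]
      exact ⟨le_rfl, fun h' => absurd h' id, fun _ _ => rfl, fun h' => absurd h' id⟩

/-- The triangle to the left of the bridge chord is the one with the vertex `(1,1)`. -/
theorem left_of_bridge : ∀ z ∈ quarticPoints, orient (1,0) (2,2) z = 1 → z = (1,1) := by
  decide +kernel

/-- The chips cannot be transferred between the cells of `(2,1)` and `(1,2)`. If the former is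
attached by a bridge, the circulation `cellFlow (1,1) - slopeDefect` would be zero on the edge dual
to `(1,1) (1,0)` but not on the adjacent one dual to `(1,1) (2,2)`. -/
theorem IsGradient.not_isTransfer (h : G.IsCentral) {c : G.E → ℤ} {μ : G.E → ℝ} {F : G.V → ℝ}
    {n : G.E → ℤ} (hg : G.IsGradient c μ F n) : ¬ G.IsTransfer c μ := by
  intro hT
  have hsum := sum_arcBalance h hT hg
  rw [Finset.sum_eq_zero_iff_of_nonneg fun e _ => (arcBalance_nonneg h hT hg e).1] at hsum
  have hzero : ∀ e, G.arcBalance F n e = 0 := fun e => hsum e (Finset.mem_univ e)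
  by_cases hj : G.Joined (1,1) (2,1)
  · obtain ⟨v, h1, h2⟩ := hj
    obtain ⟨e, he⟩ := G.exists_edge v _ _ h1 h2 (by decide) (by decide)
    exact ((arcBalance_nonneg h hT hg e).2.1 he).ne' (hzero e)
  · obtain ⟨e, he, -⟩ := hT.flux_right h hg hj
    obtain ⟨v, z, -, ht, ho⟩ := exists_tri_left he (by decide)
    obtain rfl := left_of_bridge z (G.tri_subset v (by simp [ht])) ho
    have ht' : G.tri v = {(1,1), (1,0), (2,2)} := by rw [ht]; decide
    obtain ⟨e1, he1⟩ := G.exists_edge v (1,1) (1,0) (by simp [ht]) (by simp [ht]) (by decide)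
      (by decide)
    obtain ⟨e2, he2⟩ := G.exists_edge v (1,1) (2,2) (by simp [ht]) (by simp [ht]) (by decide)
      (by decide)
    have hc := isCirculation_cellFlow_sub h hT hg v
    have hm1 := (arcBalance_nonneg h hT hg e1).2.2.1 he1 (hzero e1)
    have hm2 := (arcBalance_nonneg h hT hg e2).2.2.2 he2 (hzero e2)
    have ha : (1,1) ∉ G.side e := by rw [he]; decide
    rw [sum_eq_onSide ht' fun e he => by rw [incidence_eq_zero he, zero_mul], onSide_eq he1,
      onSide_eq he2, onSide_eq he] at hc
    simp only [hm1, hm2, cellFlow_eq_zero ha, slopeDefect_eq_zero_of_not_mem h hT hg ha, sub_zero,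
      sub_self, mul_zero, zero_add] at hc
    rw [incidence_mul_cellFlow he2 (z := (1,0)) (by rw [ht']; decide)] at hc
    revert hc
    decide

end DualGraph

/-! ### Rotation of the triangle -/

/-- The rotation of the lattice triangle with vertices `(0,0)`, `(4,0)`, `(0,4)`. -/
def latticeRotation : (ℤ × ℤ) ≃ (ℤ × ℤ) where
  toFun q := (4 - q.1 - q.2, q.1)
  invFun q := (q.2, 4 - q.1 - q.2)
  left_inv q := by
    ext
    · simp
    · simp; ring
  right_inv q := by ext <;> simp

theorem orient_latticeRotation (p q r : ℤ × ℤ) :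
    orient (latticeRotation p) (latticeRotation q) (latticeRotation r) = orient p q r := by
  simp only [orient, latticeRotation, Equiv.coe_fn_mk]; ring

theorem latticeRotation_symm_mem_interiorPoints {q : ℤ × ℤ} (h : q ∈ interiorPoints) :
    latticeRotation.symm q ∈ interiorPoints := by
  revert q; decide

theorem image_latticeRotation_eq {s t : Finset (ℤ × ℤ)} (h : s.image latticeRotation = t) :
    s = t.image latticeRotation.symm := by
  rw [← h, Finset.image_image]; simp

namespace DualGraph

/-- The graph with all labels rotated. The positions are transformed by the linear part of the
rotation, so that edges stay parallel to their dual sides. -/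
noncomputable def rotate (G : DualGraph) : DualGraph where
  V := G.V
  E := G.E
  finV := G.finV
  finE := G.finE
  src := G.src
  tgt := G.tgt
  len := G.len
  core := G.core
  tri v := (G.tri v).image latticeRotation
  side e := (G.side e).image latticeRotation
  pos v := (-(G.pos v).1 - (G.pos v).2, (G.pos v).1)
  len_pos := G.len_pos
  src_ne_tgt := G.src_ne_tgt
  unimodular v := by
    obtain ⟨p, q, r, h, ho⟩ := G.unimodular v
    exact ⟨_, _, _, by rw [h, Finset.image_insert, Finset.image_insert, Finset.image_singleton],
      by rw [orient_latticeRotation, ho]⟩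
  tri_subset v := by
    intro q hq
    obtain ⟨q, kq, rfl⟩ := Finset.mem_image.1 hq
    have := mem_quarticPoints.1 (G.tri_subset v kq)
    rw [mem_quarticPoints]
    simp only [latticeRotation, Equiv.coe_fn_mk]
    omega
  not_cross v v' u w u' w' hu hw hu' hw' := by
    obtain ⟨u, ku, rfl⟩ := Finset.mem_image.1 hu
    obtain ⟨w, kw, rfl⟩ := Finset.mem_image.1 hw
    obtain ⟨u', ku', rfl⟩ := Finset.mem_image.1 hu'
    obtain ⟨w', kw', rfl⟩ := Finset.mem_image.1 hw'
    simp only [orient_latticeRotation]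
    exact G.not_cross v v' u w u' w' ku kw ku' kw'
  exists_add_eq s h1 h2 h3 := by
    obtain ⟨v, u, hu, w, hw, h⟩ := G.exists_add_eq (s.2, 8 - s.1 - s.2) h2 (by simp; omega)
      (by simp; omega)
    refine ⟨v, _, Finset.mem_image_of_mem _ hu, _, Finset.mem_image_of_mem _ hw, ?_⟩
    have h4 := congrArg Prod.fst h
    have h5 := congrArg Prod.snd h
    simp only [Prod.fst_add, Prod.snd_add] at h4 h5
    ext
    · simp [latticeRotation]; omega
    · simp [latticeRotation]; omega
  side_card e := by
    rw [Finset.card_image_of_injective _ latticeRotation.injective, G.side_card]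
  side_injective e e' h := G.side_injective (Finset.image_injective latticeRotation.injective h)
  side_subset_tri e v := by
    rw [Finset.image_subset_image_iff latticeRotation.injective, G.side_subset_tri]
  exists_edge v u w hu hw huw hui := by
    obtain ⟨u, ku, rfl⟩ := Finset.mem_image.1 hu
    obtain ⟨w, kw, rfl⟩ := Finset.mem_image.1 hw
    obtain ⟨e, he⟩ := G.exists_edge v u w ku kw (fun h => huw (h ▸ rfl))
      (by simpa using latticeRotation_symm_mem_interiorPoints hui)
    exact ⟨e, by rw [he, Finset.image_insert, Finset.image_singleton]⟩
  pos_src e u w z hs hz ho := by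
    obtain ⟨z, kz, rfl⟩ := Finset.mem_image.1 hz
    have hs' := image_latticeRotation_eq hs
    rw [Finset.image_insert, Finset.image_singleton] at hs'
    have h := G.pos_src e _ _ z hs' kz (by rw [← orient_latticeRotation]; simpa using ho)
    simp only [latticeRotation, latticeToPlane, Equiv.coe_fn_symm_mk, Prod.ext_iff, Prod.fst_sub,
      Prod.snd_sub, Prod.smul_fst, Prod.smul_snd, smul_eq_mul] at h ⊢
    push_cast at h ⊢
    exact ⟨by linarith [h.1, h.2], by linarith [h.1, h.2]⟩
  pos_tgt e u w z hs hz ho := by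
    obtain ⟨z, kz, rfl⟩ := Finset.mem_image.1 hz
    have hs' := image_latticeRotation_eq hs
    rw [Finset.image_insert, Finset.image_singleton] at hs'
    have h := G.pos_tgt e _ _ z hs' kz (by rw [← orient_latticeRotation]; simpa using ho)
    simp only [latticeRotation, latticeToPlane, Equiv.coe_fn_symm_mk, Prod.ext_iff, Prod.fst_sub,
      Prod.snd_sub, Prod.smul_fst, Prod.smul_snd, smul_eq_mul] at h ⊢
    push_cast at h ⊢
    exact ⟨by linarith [h.1, h.2], by linarith [h.1, h.2]⟩
  core_leafless := G.core_leafless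
  mem_core e x hx hxe := by
    obtain ⟨x, kx, rfl⟩ := Finset.mem_image.1 hxe
    exact G.mem_core e x (by simpa using latticeRotation_symm_mem_interiorPoints hx) kx

variable {G : DualGraph}

theorem Joined.rotate {u w : ℤ × ℤ} (h : G.Joined u w) :
    G.rotate.Joined (latticeRotation u) (latticeRotation w) :=
  h.imp fun _ h => ⟨Finset.mem_image_of_mem _ h.1, Finset.mem_image_of_mem _ h.2⟩

/-- If the cell of `(1,1)` is connected to both others, then by common edges or by bridges that do
not cut off `(1,1)`. -/
theorem isCentral_of_joined
    (h1 : G.Joined (1,1) (2,1) ∨ G.Joined (1,0) (2,2) ∨ G.Joined (0,2) (3,0))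
    (h2 : G.Joined (1,1) (1,2) ∨ G.Joined (0,1) (2,2) ∨ G.Joined (2,0) (0,3)) : G.IsCentral := by
  rcases h1 with h1 | h1 | h1 <;> rcases h2 with h2 | h2 | h2
  · exact ⟨.inl h1, .inl h2⟩
  · exact ⟨.inl h1, .inr h2⟩
  · exact (h1.not_cross h2 (by decide)).elim
  · exact ⟨.inr h1, .inl h2⟩
  · exact ⟨.inr h1, .inr h2⟩
  all_goals exact (h1.not_cross h2 (by decide)).elim

/-- The segments between lattice points with the midpoint `(3/2, 1)` that occur as sides. -/
theorem pair_of_add_eq : ∀ u ∈ quarticPoints, ∀ w ∈ quarticPoints, u + w = (3,2) →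
    (∃ z ∈ quarticPoints, orient u w z = 1 ∨ orient u w z = -1) → (u, w) ∈ ({
      ((1,1), (2,1)), ((2,1), (1,1)), ((0,2), (3,0)), ((3,0), (0,2)), ((1,0), (2,2)),
      ((2,2), (1,0)), ((1,2), (2,0)), ((2,0), (1,2))} : Finset ((ℤ × ℤ) × (ℤ × ℤ))) := by
  decide +kernel

variable (G) in
/-- The triangle containing the midpoint of `(1,1)` and `(2,1)` has a side with this midpoint. -/
theorem joined_of_midpoint : (G.Joined (1,1) (2,1) ∨ G.Joined (1,0) (2,2) ∨ G.Joined (0,2) (3,0)) ∨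
    G.Joined (1,2) (2,0) := by
  obtain ⟨v, u, hu, w, hw, h⟩ := G.exists_add_eq (3,2) (by norm_num) (by norm_num) (by norm_num)
  have hj : G.Joined u w := ⟨v, hu, hw⟩
  have huw : u ≠ w := by
    rintro rfl
    have := congrArg Prod.fst h
    simp at this
    omega
  obtain ⟨h1, h2, h3⟩ := hj.exists_orient huw
  have hm := pair_of_add_eq u h1 w h2 h h3
  simp only [Finset.mem_insert, Finset.mem_singleton, Prod.mk.injEq] at hm
  rcases hm with ⟨rfl, rfl⟩ | ⟨rfl, rfl⟩ | ⟨rfl, rfl⟩ | ⟨rfl, rfl⟩ | ⟨rfl, rfl⟩ | ⟨rfl, rfl⟩ |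
    ⟨rfl, rfl⟩ | ⟨rfl, rfl⟩
  · exact .inl (.inl hj)
  · exact .inl (.inl hj.symm)
  · exact .inl (.inr (.inr hj))
  · exact .inl (.inr (.inr hj.symm))
  · exact .inl (.inr (.inl hj))
  · exact .inl (.inr (.inl hj.symm))
  · exact .inr hj
  · exact .inr hj.symm

theorem Joined.of_rotate {u w : ℤ × ℤ} (h : G.rotate.Joined u w) :
    G.Joined (latticeRotation.symm u) (latticeRotation.symm w) := by
  obtain ⟨v, hu, hw⟩ := h
  obtain ⟨u, ku, rfl⟩ := Finset.mem_image.1 hu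
  obtain ⟨w, kw, rfl⟩ := Finset.mem_image.1 hw
  exact ⟨v, by simpa using ku, by simpa using kw⟩

variable (G) in
theorem joined_of_midpoint_up : (G.Joined (1,2) (1,1) ∨ G.Joined (0,3) (2,0) ∨
    G.Joined (2,2) (0,1)) ∨ G.Joined (2,1) (0,2) := by
  rcases G.rotate.joined_of_midpoint with (h | h | h) | h
  · exact .inl (.inl h.of_rotate)
  · exact .inl (.inr (.inl h.of_rotate))
  · exact .inl (.inr (.inr h.of_rotate))
  · exact .inr h.of_rotate

variable (G) in
theorem joined_of_midpoint_diag : (G.Joined (2,1) (1,2) ∨ G.Joined (3,1) (0,2) ∨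
    G.Joined (2,0) (1,3)) ∨ G.Joined (1,1) (2,2) := by
  rcases G.rotate.joined_of_midpoint_up with (h | h | h) | h
  · exact .inl (.inl h.of_rotate)
  · exact .inl (.inr (.inl h.of_rotate))
  · exact .inl (.inr (.inr h.of_rotate))
  · exact .inr h.of_rotate

variable (G) in
/-- After a rotation the cell of `(1,1)` is connected to the two other cells. -/
theorem exists_isCentral : G.IsCentral ∨ G.rotate.IsCentral ∨ G.rotate.rotate.IsCentral := by
  rcases G.joined_of_midpoint with h1 | h1
  · rcases G.joined_of_midpoint_up with h2 | h2
    · refine .inl (isCentral_of_joined h1 ?_)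
      rcases h2 with h2 | h2 | h2
      exacts [.inl h2.symm, .inr (.inr h2.symm), .inr (.inl h2.symm)]
    · rcases G.joined_of_midpoint_diag with h3 | h3
      · refine .inr (.inr (isCentral_of_joined ?_ ?_))
        · rcases h3 with h3 | h3 | h3
          exacts [.inl h3.rotate.rotate, .inr (.inl h3.rotate.rotate),
            .inr (.inr h3.rotate.rotate)]
        · rcases h1 with h1 | h1 | h1
          exacts [.inl h1.symm.rotate.rotate, .inr (.inr h1.symm.rotate.rotate),
            .inr (.inl h1.symm.rotate.rotate)]
      · exact (h2.not_cross h3 (by decide)).elim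
  · rcases G.joined_of_midpoint_up with h2 | h2
    · rcases G.joined_of_midpoint_diag with h3 | h3
      · refine .inr (.inl (isCentral_of_joined ?_ ?_))
        · rcases h2 with h2 | h2 | h2
          exacts [.inl h2.rotate, .inr (.inl h2.rotate), .inr (.inr h2.rotate)]
        · rcases h3 with h3 | h3 | h3
          exacts [.inl h3.symm.rotate, .inr (.inr h3.symm.rotate), .inr (.inl h3.symm.rotate)]
      · exact (h1.not_cross h3 (by decide)).elim
    · exact (h1.not_cross h2 (by decide)).elim

end DualGraph

/-! ### Divisors on the core -/

namespace DualGraph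

/-- The core as a metric graph. -/
noncomputable def coreGraph (G : DualGraph) : MetricGraph where
  V := {v : G.V // ∃ e ∈ G.core, G.src e = v ∨ G.tgt e = v}
  E := G.core
  finV := inferInstance
  finE := Fintype.ofFinite _
  src e := ⟨G.src e.1, e.1, e.2, Or.inl rfl⟩
  tgt e := ⟨G.tgt e.1, e.1, e.2, Or.inr rfl⟩
  len e := G.len e.1
  len_pos e := G.len_pos e.1

variable {G : DualGraph}

open MetricGraph

variable (G) in
/-- The number of chips on each edge. -/
noncomputable def chips (A : G.coreGraph.Divisor) (e : G.E) : ℤ :=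
  if h : e ∈ G.core then chipCount (Γ := G.coreGraph) ⟨e, h⟩ A else 0

variable (G) in
/-- The sum of the distances of the chips on an edge to its end. -/
noncomputable def moment (A : G.coreGraph.Divisor) (e : G.E) : ℝ :=
  if h : e ∈ G.core then chipMoment (Γ := G.coreGraph) ⟨e, h⟩ A else 0

theorem sum_core {M : Type*} [AddCommMonoid M] (f : G.E → M) (hf : ∀ e ∉ G.core, f e = 0) :
    ∑ e : G.coreGraph.E, f e.1 = ∑ e, f e := by
  have h := Finset.sum_subtype (F := G.coreGraph.finE) (Finset.univ.filter (· ∈ G.core))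
    (p := (· ∈ G.core)) (by simp) f
  refine h.symm.trans (Finset.sum_subset (Finset.subset_univ _) fun e _ he => ?_)
  exact hf e fun h' => he (by simpa using h')

theorem exists_isGradient {A : G.coreGraph.Divisor} (hA : IsPrincipal A)
    (h0 : ∀ v, A (.vertex v) = 0) : ∃ F n, G.IsGradient (G.chips A) (G.moment A) F n := by
  obtain ⟨F, n, h1, h2⟩ := hA
  set n' : G.E → ℤ := fun e => if h : e ∈ G.core then n ⟨e, h⟩ else 0 with hn'
  have hoff : ∀ v, ∀ e ∉ G.core, G.outSlope n' (G.chips A) v e = 0 := by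
    intro v e he
    simp [outSlope, hn', chips, he]
  refine ⟨fun v => if h : ∃ e ∈ G.core, G.src e = v ∨ G.tgt e = v then F ⟨v, h⟩ else 0, n',
    fun e he => dif_neg he, fun e he => dif_neg he, fun e he => ?_, fun v => ?_⟩
  · have hs : ∃ e' ∈ G.core, G.src e' = G.src e ∨ G.tgt e' = G.src e := ⟨e, he, .inl rfl⟩
    have ht : ∃ e' ∈ G.core, G.src e' = G.tgt e ∨ G.tgt e' = G.tgt e := ⟨e, he, .inr rfl⟩
    simp only [dif_pos hs, dif_pos ht, hn', dif_pos he, moment]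
    exact h1 ⟨e, he⟩
  · by_cases hv : ∃ e ∈ G.core, G.src e = v ∨ G.tgt e = v
    · rw [← sum_core _ (hoff v), ← h0 ⟨v, hv⟩, ← h2 ⟨v, hv⟩, ← Finset.sum_sub_distrib]
      refine Finset.sum_congr rfl fun e _ => ?_
      have e1 : (G.coreGraph.src e = ⟨v, hv⟩) = (G.src e.1 = v) := by
        simp [coreGraph, Subtype.ext_iff]
      have e2 : (G.coreGraph.tgt e = ⟨v, hv⟩) = (G.tgt e.1 = v) := by
        simp [coreGraph, Subtype.ext_iff]
      simp only [outSlope, e1, e2, hn', chips, dif_pos e.2]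
      rfl
    · refine Finset.sum_eq_zero fun e _ => ?_
      by_cases he : e ∈ G.core
      · have e1 : G.src e ≠ v := fun h => hv ⟨e, he, .inl h⟩
        have e2 : G.tgt e ≠ v := fun h => hv ⟨e, he, .inr h⟩
        simp [outSlope, e1, e2]
      · exact hoff v e he

variable (G) in
/-- A point in the interior of an edge of the core, as a divisor. -/
noncomputable def chip {e : G.E} (he : e ∈ G.core) {t : ℝ} (ht : t ∈ Ioo 0 (G.len e)) :
    G.coreGraph.Divisor :=
  Finsupp.single (.inner (Γ := G.coreGraph) ⟨e, he⟩ t ht) 1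

theorem chips_chip {e : G.E} (he : e ∈ G.core) {t : ℝ} (ht : t ∈ Ioo 0 (G.len e)) (e' : G.E) :
    G.chips (G.chip he ht) e' = if e = e' then 1 else 0 := by
  by_cases h : e' ∈ G.core
  · have : ((⟨e, he⟩ : G.core) = ⟨e', h⟩) = (e = e') := by simp
    simp only [chips, dif_pos h, chip, chipCount, Finsupp.linearCombination_single, one_smul]
    exact if_congr (iff_of_eq this) rfl rfl
  · rw [chips, dif_neg h, if_neg]
    rintro rfl; exact h he

theorem moment_chip {e : G.E} (he : e ∈ G.core) {t : ℝ} (ht : t ∈ Ioo 0 (G.len e)) (e' : G.E) :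
    G.moment (G.chip he ht) e' = if e = e' then G.len e - t else 0 := by
  by_cases h : e' ∈ G.core
  · have : ((⟨e, he⟩ : G.core) = ⟨e', h⟩) = (e = e') := by simp
    simp only [moment, dif_pos h, chip, chipMoment, Finsupp.linearCombination_single, one_smul]
    by_cases hee : e = e'
    · subst hee; simp [coreGraph]
    · rw [if_neg hee]; exact if_neg fun h' => hee (this ▸ h')
  · rw [moment, dif_neg h, if_neg]
    rintro rfl; exact h he

theorem chip_vertex {e : G.E} (he : e ∈ G.core) {t : ℝ} (ht : t ∈ Ioo 0 (G.len e))
    (v : G.coreGraph.V) : G.chip he ht (.vertex v) = 0 := by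
  simp [chip]

theorem chips_sub (A B : G.coreGraph.Divisor) (e : G.E) :
    G.chips (A - B) e = G.chips A e - G.chips B e := by
  simp only [chips]; split_ifs <;> simp

theorem moment_sub (A B : G.coreGraph.Divisor) (e : G.E) :
    G.moment (A - B) e = G.moment A e - G.moment B e := by
  simp only [moment]; split_ifs <;> simp

theorem chips_add (A B : G.coreGraph.Divisor) (e : G.E) :
    G.chips (A + B) e = G.chips A e + G.chips B e := by
  simp only [chips]; split_ifs <;> simp

theorem moment_add (A B : G.coreGraph.Divisor) (e : G.E) :
    G.moment (A + B) e = G.moment A e + G.moment B e := by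
  simp only [moment]; split_ifs <;> simp

/-- Small movements of chips within their edges cannot be principal unless they balance on each
cell. -/
theorem sum_cellFlow_mul_moment {A : G.coreGraph.Divisor} (hA : IsPrincipal A)
    (h0 : ∀ v, A (.vertex v) = 0) (hc : ∀ e, G.chips A e = 0)
    (hm : ∀ e, |G.moment A e| < G.len e) {p : ℤ × ℤ} (hp : p ∈ interiorPoints) :
    ∑ e, (G.cellFlow p e : ℝ) * G.moment A e = 0 := by
  obtain ⟨F, n, hg⟩ := exists_isGradient hA h0
  rw [show G.chips A = fun _ => 0 from funext hc] at hg
  have hn := hg.slope_eq_zero_of_small hm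
  have := hg.sum_cellFlow_mul hp
  simpa [hn] using this

/-- An edge of the core as an edge of the metric graph. -/
def coreEdge {e : G.E} (he : e ∈ G.core) : G.coreGraph.E := ⟨e, he⟩

theorem single_pt {e : G.E} (he : e ∈ G.core) {t : ℝ} (ht : t ∈ Ioo 0 (G.len e)) :
    Finsupp.single (G.coreGraph.pt (coreEdge he) t) 1 = G.chip he ht := by
  rw [pt_of_mem (coreEdge he) ht]; rfl

/-- The coordinate of a point on its edge. -/
noncomputable def coordinate {Γ : MetricGraph} : Γ.Point → ℝ
  | .vertex _ => 0
  | .inner _ t _ => t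

/-- The vertex or edge on which a point lies. -/
def cellOf {Γ : MetricGraph} : Γ.Point → Γ.V ⊕ Γ.E
  | .vertex v => .inl v
  | .inner e _ _ => .inr e

theorem abs_sub_lt_of_floor_eq {a b δ : ℝ} (hδ : 0 < δ) (h : ⌊a / δ⌋ = ⌊b / δ⌋) :
    |a - b| < δ := by
  have := Int.abs_sub_lt_one_of_floor_eq_floor h
  rwa [← sub_div, abs_div, abs_of_pos hδ, div_lt_one hδ] at this

theorem cellFlow_cast_ne_zero {p : ℤ × ℤ} {e : G.E} (h : p ∈ G.side e) :
    (G.cellFlow p e : ℝ) ≠ 0 := by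
  rcases cellFlow_eq_one_or h with h | h <;> rw [h] <;> norm_num

/-- In a pencil of divisors of degree two the partner of a suitable point on a given edge lies on an
edge that belongs to the same cells. By the pigeonhole principle two close points of the edge have
close partners on a common edge; then the two movements have to balance on each cell. -/
theorem exists_partner {D : G.coreGraph.Divisor}
    (hD : ∀ P, ∃ Q, IsPrincipal (D - Finsupp.single P 1 - Finsupp.single Q 1))
    {e₀ : G.E} (he₀ : e₀ ∈ G.core) (hp : ∃ p ∈ interiorPoints, p ∈ G.side e₀) :
    ∃ (x : ℝ) (hx : x ∈ Ioo 0 (G.len e₀)) (e₁ : G.E) (he₁ : e₁ ∈ G.core) (y : ℝ)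
      (hy : y ∈ Ioo 0 (G.len e₁)), IsPrincipal (D - G.chip he₀ hx - G.chip he₁ hy) ∧
        ∀ p ∈ interiorPoints, p ∈ G.side e₀ → p ∈ G.side e₁ := by
  have : Nonempty G.E := ⟨e₀⟩
  obtain ⟨em, hem⟩ := Finite.exists_min G.len
  obtain ⟨eM, heM⟩ := Finite.exists_max G.len
  set δ := G.len em / 2 with hδ
  have hδ0 : 0 < δ := half_pos (G.len_pos em)
  have hδle : ∀ e, δ + δ ≤ G.len e := fun e => by linarith [hem e]
  choose Q hQ using hD
  let q : ℝ → G.coreGraph.Point := fun x => Q (G.coreGraph.pt (coreEdge he₀) x)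
  let f : ℝ → (G.coreGraph.V ⊕ G.coreGraph.E) × ℤ × ℤ := fun x =>
    (cellOf (q x), ⌊x / δ⌋, ⌊coordinate (q x) / δ⌋)
  have hcoord : ∀ P : G.coreGraph.Point, coordinate P ∈ Icc 0 (G.len eM) := by
    rintro (v | ⟨e, t, ht⟩)
    · exact ⟨le_rfl, (G.len_pos eM).le⟩
    · exact ⟨ht.1.le, ht.2.le.trans (heM e.1)⟩
  have hfloor : ∀ x ∈ Icc 0 (G.len eM), ⌊x / δ⌋ ∈ Icc 0 ⌊G.len eM / δ⌋ := fun x hx =>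
    ⟨Int.floor_nonneg.2 (div_nonneg hx.1 hδ0.le), Int.floor_mono
      (div_le_div_of_nonneg_right hx.2 hδ0.le)⟩
  have hfin : (univ ×ˢ Icc 0 ⌊G.len eM / δ⌋ ×ˢ Icc 0 ⌊G.len eM / δ⌋ :
      Set ((G.coreGraph.V ⊕ G.coreGraph.E) × ℤ × ℤ)).Finite :=
    finite_univ.prod ((finite_Icc _ _).prod (finite_Icc _ _))
  have hmaps : MapsTo f (Ioo 0 (G.len e₀))
      (univ ×ˢ Icc 0 ⌊G.len eM / δ⌋ ×ˢ Icc 0 ⌊G.len eM / δ⌋) := fun x hx =>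
    ⟨mem_univ _, hfloor x ⟨hx.1.le, hx.2.le.trans (heM e₀)⟩, hfloor _ (hcoord _)⟩
  obtain ⟨x₁, hx₁, x₂, hx₂, hne, hf⟩ :=
    (Ioo_infinite (G.len_pos e₀)).exists_ne_map_eq_of_mapsTo hmaps hfin
  simp only [f, Prod.mk.injEq] at hf
  obtain ⟨hcell, hfx, hfq⟩ := hf
  have hxδ := abs_sub_lt_of_floor_eq hδ0 hfx
  have hqδ := abs_sub_lt_of_floor_eq hδ0 hfq
  have hP₁ := hQ (G.coreGraph.pt (coreEdge he₀) x₁)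
  have hP₂ := hQ (G.coreGraph.pt (coreEdge he₀) x₂)
  change IsPrincipal (_ - _ - Finsupp.single (q x₁) 1) at hP₁
  change IsPrincipal (_ - _ - Finsupp.single (q x₂) 1) at hP₂
  rw [single_pt he₀ hx₁] at hP₁
  rw [single_pt he₀ hx₂] at hP₂
  have hxne : x₁ - x₂ ≠ 0 := sub_ne_zero.2 hne
  have hA := hP₁.sub hP₂
  rcases h₁ : q x₁ with v₁ | ⟨⟨e₁, he₁⟩, y₁, hy₁⟩ <;>
    rcases h₂ : q x₂ with v₂ | ⟨⟨e₂, he₂⟩, y₂, hy₂⟩ <;>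
    simp only [h₁, h₂, cellOf, reduceCtorEq, Sum.inl.injEq] at hcell <;> rw [h₁, h₂] at hA
  · exfalso
    subst hcell
    have hAeq : D - G.chip he₀ hx₁ - Finsupp.single (.vertex v₁) 1 -
        (D - G.chip he₀ hx₂ - Finsupp.single (.vertex v₁) 1) =
        G.chip he₀ hx₂ - G.chip he₀ hx₁ := by abel
    rw [hAeq] at hA
    have hm : ∀ e, G.moment (G.chip he₀ hx₂ - G.chip he₀ hx₁) e =
        if e₀ = e then x₁ - x₂ else 0 := by
      intro e
      rw [moment_sub, moment_chip, moment_chip]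
      split_ifs <;> ring
    obtain ⟨p, hp, hpe⟩ := hp
    have h := sum_cellFlow_mul_moment hA (fun v => by simp [chip_vertex])
      (fun e => by rw [chips_sub, chips_chip, chips_chip, sub_self])
      (fun e => by
        rw [hm]
        split_ifs
        · linarith [hδle e]
        · rw [abs_zero]; exact G.len_pos e) hp
    simp only [hm, mul_ite, mul_zero, Finset.sum_ite_eq, Finset.mem_univ, if_true] at h
    exact mul_ne_zero (cellFlow_cast_ne_zero hpe) hxne (by simpa using h)
  · obtain rfl : e₁ = e₂ := congrArg Subtype.val (Sum.inr.inj hcell)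
    have hy₁' : y₁ ∈ Ioo 0 (G.len e₁) := hy₁
    have hy₂' : y₂ ∈ Ioo 0 (G.len e₁) := hy₂
    have hAeq : D - G.chip he₀ hx₁ - G.chip he₁ hy₁' - (D - G.chip he₀ hx₂ - G.chip he₁ hy₂') =
        G.chip he₀ hx₂ - G.chip he₀ hx₁ + (G.chip he₁ hy₂' - G.chip he₁ hy₁') := by abel
    change IsPrincipal (D - G.chip he₀ hx₁ - G.chip he₁ hy₁' -
      (D - G.chip he₀ hx₂ - G.chip he₁ hy₂')) at hA
    rw [hAeq] at hA
    simp only [h₁, h₂, coordinate] at hqδ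
    have hm : ∀ e, G.moment (G.chip he₀ hx₂ - G.chip he₀ hx₁ +
        (G.chip he₁ hy₂' - G.chip he₁ hy₁')) e =
        (if e₀ = e then x₁ - x₂ else 0) + if e₁ = e then y₁ - y₂ else 0 := by
      intro e
      rw [moment_add, moment_sub, moment_sub, moment_chip, moment_chip, moment_chip, moment_chip]
      split_ifs <;> ring
    rw [h₁] at hP₁
    refine ⟨x₁, hx₁, e₁, he₁, y₁, hy₁', hP₁, fun p hp hpe => ?_⟩
    by_contra hpe₁
    have h := sum_cellFlow_mul_moment hA (fun v => by simp [chip_vertex])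
      (fun e => by
        rw [chips_add, chips_sub, chips_sub, chips_chip, chips_chip, chips_chip, chips_chip]
        ring)
      (fun e => by
        rw [hm]
        refine (abs_add_le _ _).trans_lt (lt_of_lt_of_le (add_lt_add ?_ ?_) (hδle e))
        · split_ifs
          · exact hxδ
          · rwa [abs_zero]
        · split_ifs
          · exact hqδ
          · rwa [abs_zero]) hp
    simp only [hm, mul_add, mul_ite, mul_zero, Finset.sum_add_distrib, Finset.sum_ite_eq,
      Finset.mem_univ, if_true, cellFlow_eq_zero hpe₁] at h
    exact mul_ne_zero (cellFlow_cast_ne_zero hpe) hxne (by simpa using h)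

end DualGraph

/-! ### Dual graphs are not hyperelliptic -/

namespace DualGraph

variable {G : DualGraph}

open MetricGraph

/-- An interior lattice point is not the midpoint of a primitive segment. -/
theorem eq_of_add_eq_double : ∀ p ∈ interiorPoints, ∀ u ∈ quarticPoints, ∀ w ∈ quarticPoints,
    u + w = p + p → (∃ z ∈ quarticPoints, orient u w z = 1 ∨ orient u w z = -1) → u = p := by
  decide +kernel

theorem add_self_bounds : ∀ p ∈ interiorPoints, 0 ≤ (p + p).1 ∧ 0 ≤ (p + p).2 ∧
    (p + p).1 + (p + p).2 ≤ 8 := by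
  decide

variable (G) in
theorem exists_mem_side {p : ℤ × ℤ} (hp : p ∈ interiorPoints) : ∃ e, p ∈ G.side e := by
  have hb := add_self_bounds p hp
  obtain ⟨v, u, hu, w, hw, h⟩ := G.exists_add_eq (p + p) hb.1 hb.2.1 hb.2.2
  have hup : u = p := by
    by_cases huw : u = w
    · subst huw
      have h1 := congrArg Prod.fst h
      have h2 := congrArg Prod.snd h
      simp only [Prod.fst_add, Prod.snd_add] at h1 h2
      exact Prod.ext (by omega) (by omega)
    · obtain ⟨h1, h2, h3⟩ := Joined.exists_orient ⟨v, hu, hw⟩ huw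
      exact eq_of_add_eq_double p hp u h1 w h2 h h3
  subst hup
  obtain ⟨y, z, ht, ho⟩ := exists_tri_eq hu
  obtain ⟨e, he⟩ := G.exists_edge v u y hu (by simp [ht])
    (ne_of_orient_ne_zero (orient_ne_zero ht)).1 hp
  exact ⟨e, by simp [he]⟩

variable (G) in
/-- Two edges of the cell of `p`, both equal to the common edge with the cell of `(1,1)` if there
is one. -/
structure IsTargetPair (p : ℤ × ℤ) (e e' : G.E) : Prop where
  mem_left : p ∈ G.side e
  mem_right : p ∈ G.side e'
  side_left : G.Joined (1,1) p → G.side e = {(1,1), p}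
  side_right : G.Joined (1,1) p → G.side e' = {(1,1), p}

/-- The divisors in the pencil with two chips on the cell of `p`. -/
theorem exists_target {D : G.coreGraph.Divisor}
    (hD : ∀ P, ∃ Q, IsPrincipal (D - Finsupp.single P 1 - Finsupp.single Q 1))
    {p : ℤ × ℤ} (hp : p ∈ interiorPoints) (hp1 : (1,1) ≠ p) :
    ∃ (e e' : G.E) (he : e ∈ G.core) (he' : e' ∈ G.core) (x y : ℝ) (hx : x ∈ Ioo 0 (G.len e))
      (hy : y ∈ Ioo 0 (G.len e')), G.IsTargetPair p e e' ∧
        IsPrincipal (D - G.chip he hx - G.chip he' hy) := by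
  obtain ⟨e, hpe, hside⟩ : ∃ e, p ∈ G.side e ∧ (G.Joined (1,1) p → G.side e = {(1,1), p}) := by
    by_cases hj : G.Joined (1,1) p
    · obtain ⟨v, h1, h2⟩ := hj
      obtain ⟨e, he⟩ := G.exists_edge v _ _ h1 h2 hp1 (by decide)
      exact ⟨e, by simp [he], fun _ => he⟩
    · obtain ⟨e, he⟩ := G.exists_mem_side hp
      exact ⟨e, he, fun h => absurd h hj⟩
  obtain ⟨x, hx, e', he', y, hy, hprin, hsub⟩ :=
    exists_partner hD (G.mem_core e p hp hpe) ⟨p, hp, hpe⟩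
  refine ⟨e, e', _, he', x, y, hx, hy, ⟨hpe, hsub p hp hpe, hside, fun hj => ?_⟩, hprin⟩
  have h1 := hside hj
  refine (Finset.eq_of_subset_of_card_le (fun q hq => ?_) ?_).symm
  · simp only [Finset.mem_insert, Finset.mem_singleton] at hq
    rcases hq with rfl | rfl
    · exact hsub _ (by decide) (by simp [h1])
    · exact hsub _ hp (by simp [h1])
  · rw [← h1, G.side_card, G.side_card]

/-- An edge with chips for the cell of `(2,1)` or `(1,2)` that lies in the cluster is a common edge
with the cell of `(1,1)`. -/
theorem IsTargetPair.side_eq (h : G.IsCentral) {p : ℤ × ℤ} (hp : p = (2,1) ∨ p = (1,2))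
    {e e' f : G.E} (hT : G.IsTargetPair p e e') (hf : f ∈ G.clusterEdges) (hef : e = f ∨ e' = f) :
    G.side f = {(1,1), p} := by
  have hpf : p ∈ G.side f := by
    rcases hef with rfl | rfl
    exacts [hT.mem_left, hT.mem_right]
  have hj : G.Joined (1,1) p := by
    obtain ⟨x, hx, hxc⟩ := hf
    have hpc := h.mem_cluster_of_joined hxc
      (by rw [mem_interiorPoints]; exact .inr hp) (joined_of_side hx hpf)
    rcases hp with rfl | rfl
    · rcases hpc with h' | h' | h'
      · simp at h'
      · exact h'.2
      · simp at h'
    · rcases hpc with h' | h' | h'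
      · simp at h'
      · simp at h'
      · exact h'.2
  rcases hef with rfl | rfl
  exacts [hT.side_left hj, hT.side_right hj]

/-- A curve with a central cell is not hyperelliptic. -/
theorem IsCentral.not_isHyperelliptic (h : G.IsCentral) : ¬ G.coreGraph.IsHyperelliptic := by
  rintro ⟨D, hdeg, hrank, -⟩
  have hD := hrank.exists_isPrincipal hdeg
  obtain ⟨e₁, e₂, he₁, he₂, x₁, x₂, hx₁, hx₂, hT, hP⟩ :=
    exists_target hD (p := (2,1)) (by decide) (by decide)
  obtain ⟨e₃, e₄, he₃, he₄, x₃, x₄, hx₃, hx₄, hT', hP'⟩ :=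
    exists_target hD (p := (1,2)) (by decide) (by decide)
  have hA := hP'.sub hP
  have hAeq : D - G.chip he₃ hx₃ - G.chip he₄ hx₄ - (D - G.chip he₁ hx₁ - G.chip he₂ hx₂) =
      (G.chip he₁ hx₁ + G.chip he₂ hx₂) - (G.chip he₃ hx₃ + G.chip he₄ hx₄) := by abel
  rw [hAeq] at hA
  obtain ⟨F, n, hg⟩ := exists_isGradient hA fun v => by simp [chip_vertex]
  set A := (G.chip he₁ hx₁ + G.chip he₂ hx₂) - (G.chip he₃ hx₃ + G.chip he₄ hx₄)
  have hc : ∀ e, G.chips A e = ((if e₁ = e then 1 else 0) + if e₂ = e then 1 else 0) -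
      ((if e₃ = e then 1 else 0) + if e₄ = e then 1 else 0) := fun e => by
    rw [chips_sub, chips_add, chips_add, chips_chip, chips_chip, chips_chip, chips_chip]
  have hm : ∀ e, G.moment A e = ((if e₁ = e then G.len e₁ - x₁ else 0) +
      if e₂ = e then G.len e₂ - x₂ else 0) -
      ((if e₃ = e then G.len e₃ - x₃ else 0) + if e₄ = e then G.len e₄ - x₄ else 0) := fun e => by
    rw [moment_sub, moment_add, moment_add, moment_chip, moment_chip, moment_chip, moment_chip]
  have hup : ∀ e, (2,1) ∈ G.side e → ¬ G.Joined (1,1) (2,1) → ¬ (e₃ = e ∨ e₄ = e) := by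
    intro e he hj h'
    refine hj (h.joined_right_of_joined (joined_of_side he ?_))
    rcases h' with rfl | rfl
    exacts [hT'.mem_left, hT'.mem_right]
  have hri : ∀ e, (1,2) ∈ G.side e → ¬ G.Joined (1,1) (1,2) → ¬ (e₁ = e ∨ e₂ = e) := by
    intro e he hj h'
    refine hj (h.joined_up_of_joined (joined_of_side ?_ he))
    rcases h' with rfl | rfl
    exacts [hT.mem_left, hT.mem_right]
  have hsum : ∀ p : ℤ × ℤ, (∑ e, if p ∈ G.side e then G.chips A e else 0) =
      ((if p ∈ G.side e₁ then 1 else 0) + if p ∈ G.side e₂ then 1 else 0) -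
        ((if p ∈ G.side e₃ then 1 else 0) + if p ∈ G.side e₄ then 1 else 0) := by
    intro p
    have h1 : ∀ f : G.E, (∑ e, if f = e then (if p ∈ G.side e then (1 : ℤ) else 0) else 0) =
        if p ∈ G.side f then 1 else 0 := fun f => by rw [Finset.sum_ite_eq]; simp
    rw [← h1 e₁, ← h1 e₂, ← h1 e₃, ← h1 e₄, ← Finset.sum_add_distrib, ← Finset.sum_add_distrib,
      ← Finset.sum_sub_distrib]
    refine Finset.sum_congr rfl fun e _ => ?_
    by_cases hpe : p ∈ G.side e <;> simp [hpe, hc]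
  refine hg.not_isTransfer h ⟨fun e he => ?_, fun e he => ?_, fun e he h1 h2 => ?_, fun hj => ?_,
    fun hj => ?_, fun e he => ?_⟩
  · have hj : G.Joined (1,1) (2,1) := joined_of_side (e := e) (by simp [he]) (by simp [he])
    obtain rfl : e₁ = e := G.side_injective ((hT.side_left hj).trans he.symm)
    obtain rfl : e₂ = e₁ := G.side_injective ((hT.side_right hj).trans he.symm)
    have h3 : e₃ ≠ e₂ := by
      rintro rfl; have := hT'.mem_left; simp [he] at this
    have h4 : e₄ ≠ e₂ := by
      rintro rfl; have := hT'.mem_right; simp [he] at this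
    refine ⟨by simp [hc, h3, h4], ?_⟩
    simp only [hm, h3, h4, if_true, if_false]
    rw [abs_lt]
    constructor <;> linarith [hx₁.1, hx₁.2, hx₂.1, hx₂.2]
  · have hj : G.Joined (1,1) (1,2) := joined_of_side (e := e) (by simp [he]) (by simp [he])
    obtain rfl : e₃ = e := G.side_injective ((hT'.side_left hj).trans he.symm)
    obtain rfl : e₄ = e₃ := G.side_injective ((hT'.side_right hj).trans he.symm)
    have h3 : e₁ ≠ e₄ := by
      rintro rfl; have := hT.mem_left; simp [he] at this
    have h4 : e₂ ≠ e₄ := by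
      rintro rfl; have := hT.mem_right; simp [he] at this
    refine ⟨by simp [hc, h3, h4], ?_⟩
    simp only [hm, h3, h4, if_true, if_false]
    rw [abs_lt]
    constructor <;> linarith [hx₃.1, hx₃.2, hx₄.1, hx₄.2]
  · have h3 : ¬ (e₁ = e ∨ e₂ = e) := fun h' => h1 (hT.side_eq h (.inl rfl) he h')
    have h4 : ¬ (e₃ = e ∨ e₄ = e) := fun h' => h2 (hT'.side_eq h (.inr rfl) he h')
    push Not at h3 h4
    simp [hc, hm, h3, h4]
  · have h3 : (2,1) ∉ G.side e₃ := fun h' => hup _ h' hj (.inl rfl)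
    have h4 : (2,1) ∉ G.side e₄ := fun h' => hup _ h' hj (.inr rfl)
    simp [hsum, h3, h4, hT.mem_left, hT.mem_right]
  · have h3 : (1,2) ∉ G.side e₁ := fun h' => hri _ h' hj (.inl rfl)
    have h4 : (1,2) ∉ G.side e₂ := fun h' => hri _ h' hj (.inr rfl)
    simp [hsum, h3, h4, hT'.mem_left, hT'.mem_right]
  · have h1 : e₁ ≠ e := fun h' => he (2,1) (by decide) (h' ▸ hT.mem_left)
    have h2 : e₂ ≠ e := fun h' => he (2,1) (by decide) (h' ▸ hT.mem_right)
    have h3 : e₃ ≠ e := fun h' => he (1,2) (by decide) (h' ▸ hT'.mem_left)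
    have h4 : e₄ ≠ e := fun h' => he (1,2) (by decide) (h' ▸ hT'.mem_right)
    simp [hc, h1, h2, h3, h4]

variable (G) in
theorem not_isHyperelliptic : ¬ G.coreGraph.IsHyperelliptic := by
  rcases G.exists_isCentral with h | h | h
  · exact h.not_isHyperelliptic
  · exact h.not_isHyperelliptic
  · exact h.not_isHyperelliptic

end DualGraph

/-! ### Lattice triangles in the plane -/

/-- Twice the signed area of the triangle `p q x`, for a point `x` of the plane. -/
noncomputable def planeOrient (p q : ℤ × ℤ) (x : ℝ × ℝ) : ℝ :=
  ((q.1 : ℝ) - p.1) * (x.2 - p.2) - ((q.2 : ℝ) - p.2) * (x.1 - p.1)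

theorem planeOrient_latticeToPlane (p q r : ℤ × ℤ) :
    planeOrient p q (latticeToPlane r) = orient p q r := by
  simp [planeOrient, latticeToPlane, orient]

/-- The lattice triangle spanned by a finite set of lattice points. -/
def latticeHull (t : Finset (ℤ × ℤ)) : Set (ℝ × ℝ) :=
  convexHull ℝ (latticeToPlane '' (t : Set (ℤ × ℤ)))

theorem latticeToPlane_mem_latticeHull {t : Finset (ℤ × ℤ)} {q : ℤ × ℤ} (hq : q ∈ t) :
    latticeToPlane q ∈ latticeHull t :=
  subset_convexHull ℝ _ ⟨q, hq, rfl⟩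

theorem convex_latticeHull (t : Finset (ℤ × ℤ)) : Convex ℝ (latticeHull t) :=
  convex_convexHull ℝ _

theorem isClosed_latticeHull (t : Finset (ℤ × ℤ)) : IsClosed (latticeHull t) :=
  ((t.finite_toSet.image _).isCompact_convexHull ℝ).isClosed

theorem convex_setOf_le (a b c : ℝ) : Convex ℝ {x : ℝ × ℝ | c ≤ a * x.1 + b * x.2} := by
  intro x hx y hy s t hs ht hst
  simp only [mem_ofPred_eq, Prod.fst_add, Prod.snd_add, Prod.smul_fst, Prod.smul_snd,
    smul_eq_mul] at hx hy ⊢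
  obtain rfl : t = 1 - s := by linarith
  nlinarith [mul_le_mul_of_nonneg_left hx hs, mul_le_mul_of_nonneg_left hy ht]

theorem planeOrient_nonneg {t : Finset (ℤ × ℤ)} {p q : ℤ × ℤ} {x : ℝ × ℝ}
    (h : ∀ r ∈ t, 0 ≤ orient p q r) (hx : x ∈ latticeHull t) : 0 ≤ planeOrient p q x := by
  have h1 : latticeHull t ⊆ {x : ℝ × ℝ | ((q.1 : ℝ) - p.1) * p.2 - ((q.2 : ℝ) - p.2) * p.1 ≤
      (-((q.2 : ℝ) - p.2)) * x.1 + ((q.1 : ℝ) - p.1) * x.2} := by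
    refine convexHull_min ?_ (convex_setOf_le _ _ _)
    rintro _ ⟨r, hr, rfl⟩
    have := h r hr
    rw [← Int.cast_nonneg_iff (R := ℝ), ← planeOrient_latticeToPlane] at this
    simp only [planeOrient, mem_ofPred_eq] at this ⊢
    linarith
  have := h1 hx
  simp only [planeOrient, mem_ofPred_eq] at this ⊢
  linarith

theorem planeOrient_eq_zero {t : Finset (ℤ × ℤ)} {p q : ℤ × ℤ} {x : ℝ × ℝ}
    (h : ∀ r ∈ t, orient p q r = 0) (hx : x ∈ latticeHull t) : planeOrient p q x = 0 := by
  refine le_antisymm ?_ (planeOrient_nonneg (fun r hr => (h r hr).ge) hx)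
  have h1 := planeOrient_nonneg (p := q) (q := p)
    (fun r hr => by rw [orient_swap_left, h r hr, neg_zero]) hx
  have h2 : planeOrient q p x = -planeOrient p q x := by simp only [planeOrient]; ring
  linarith

theorem Convex.three_mem {s : Set (ℝ × ℝ)} (hs : Convex ℝ s) {x y z : ℝ × ℝ} (hx : x ∈ s)
    (hy : y ∈ s) (hz : z ∈ s) {a b c : ℝ} (ha : 0 ≤ a) (hb : 0 ≤ b) (hc : 0 ≤ c)
    (habc : a + b + c = 1) : a • x + b • y + c • z ∈ s := by
  have := hs.sum_mem (t := Finset.univ) (w := ![a, b, c]) (z := ![x, y, z])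
    (by intro i _; fin_cases i <;> assumption) (by simpa [Fin.sum_univ_three] using habc)
    (by intro i _; fin_cases i <;> assumption)
  simpa [Fin.sum_univ_three] using this

theorem mem_quartic_triangle {x : ℝ × ℝ} :
    x ∈ convexHull ℝ {((0 : ℝ), (0 : ℝ)), (((4 : ℕ) : ℝ), (0 : ℝ)), ((0 : ℝ), ((4 : ℕ) : ℝ))} ↔
      0 ≤ x.1 ∧ 0 ≤ x.2 ∧ x.1 + x.2 ≤ 4 := by
  constructor
  · intro hx
    have key : ∀ a b c : ℝ, c ≤ 0 → c ≤ 4 * a → c ≤ 4 * b → c ≤ a * x.1 + b * x.2 := by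
      intro a b c h0 ha hb
      refine convexHull_min ?_ (convex_setOf_le a b c) hx
      rintro y (rfl | rfl | rfl) <;> simp <;> linarith
    have h1 := key 1 0 0 (by norm_num) (by norm_num) (by norm_num)
    have h2 := key 0 1 0 (by norm_num) (by norm_num) (by norm_num)
    have h3 := key (-1) (-1) (-4) (by norm_num) (by norm_num) (by norm_num)
    exact ⟨by linarith, by linarith, by linarith⟩
  · rintro ⟨h1, h2, h3⟩
    have := (convex_convexHull ℝ {((0 : ℝ), (0 : ℝ)), (((4 : ℕ) : ℝ), (0 : ℝ)),
      ((0 : ℝ), ((4 : ℕ) : ℝ))}).three_mem (subset_convexHull ℝ _ (by simp))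
      (subset_convexHull ℝ _ (by simp)) (subset_convexHull ℝ _ (by simp))
      (x := (0, 0)) (y := (((4 : ℕ) : ℝ), 0)) (z := (0, ((4 : ℕ) : ℝ)))
      (a := 1 - x.1 / 4 - x.2 / 4) (b := x.1 / 4) (c := x.2 / 4)
      (by linarith) (by linarith) (by linarith) (by ring)
    convert this using 1
    ext <;> simp

namespace IsUnimodularTriangulation

variable {T : Finset (Finset (ℤ × ℤ))} {t t' : Finset (ℤ × ℤ)}

theorem exists_orient_eq_one {d : ℕ} (hT : IsUnimodularTriangulation d T) (ht : t ∈ T) :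
    ∃ p q r, t = {p, q, r} ∧ orient p q r = 1 := by
  obtain ⟨p, q, r, rfl, h⟩ := hT.unimodular t ht
  rcases eq_or_eq_neg_of_abs_eq h with h | h
  · exact ⟨p, q, r, rfl, h⟩
  · refine ⟨p, r, q, by rw [Finset.pair_comm], ?_⟩
    rw [orient_swap_right, orient, h]; norm_num

theorem exists_orient_eq_one_of_mem {d : ℕ} (hT : IsUnimodularTriangulation d T) (ht : t ∈ T)
    {u : ℤ × ℤ} (hu : u ∈ t) : ∃ q r, t = {u, q, r} ∧ orient u q r = 1 := by
  obtain ⟨p, q, r, rfl, h⟩ := hT.exists_orient_eq_one ht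
  simp only [Finset.mem_insert, Finset.mem_singleton] at hu
  rcases hu with rfl | rfl | rfl
  · exact ⟨q, r, rfl, h⟩
  · refine ⟨r, p, ?_, by rw [orient_rotate]; exact h⟩
    ext; simp; tauto
  · refine ⟨p, q, ?_, by rw [← orient_rotate]; exact h⟩
    ext; simp; tauto

theorem exists_third_vertex {d : ℕ} (hT : IsUnimodularTriangulation d T) (ht : t ∈ T)
    {u w : ℤ × ℤ} (hu : u ∈ t) (hw : w ∈ t) (huw : u ≠ w) :
    ∃ z, t = {u, w, z} ∧ (orient u w z = 1 ∨ orient u w z = -1) := by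
  obtain ⟨q, r, rfl, h⟩ := hT.exists_orient_eq_one_of_mem ht hu
  simp only [Finset.mem_insert, Finset.mem_singleton] at hw
  rcases hw with rfl | rfl | rfl
  · exact absurd rfl huw
  · exact ⟨r, rfl, .inl h⟩
  · exact ⟨q, by rw [Finset.pair_comm], .inr (by rw [orient_swap_right, h])⟩

/-- If a triangle contains a point of a side of another one with positive weight at the vertex `u`,
then `u` is a vertex of both: the barycentric coordinate of `u` does not vanish on the common face
of the triangles. -/
theorem mem_of_combo_mem {d : ℕ} (hT : IsUnimodularTriangulation d T) (ht : t ∈ T) (ht' : t' ∈ T)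
    {u w : ℤ × ℤ} (hu : u ∈ t) (hw : w ∈ t) {a b : ℝ} (ha : 0 < a) (hb : 0 ≤ b) (hab : a + b = 1)
    (hx : a • latticeToPlane u + b • latticeToPlane w ∈ latticeHull t') : u ∈ t' := by
  by_contra hu'
  have hxt : a • latticeToPlane u + b • latticeToPlane w ∈ latticeHull t :=
    convex_latticeHull _ (latticeToPlane_mem_latticeHull hu) (latticeToPlane_mem_latticeHull hw)
      ha.le hb hab
  have hxi : a • latticeToPlane u + b • latticeToPlane w ∈ latticeHull (t ∩ t') := by
    rw [latticeHull, ← hT.inter t ht t' ht']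
    exact ⟨hxt, hx⟩
  obtain ⟨q, r, rfl, ho⟩ := hT.exists_orient_eq_one_of_mem ht hu
  have ho' : orient q r u = 1 := by rw [orient_rotate, ho]
  have h0 : orient q r q = 0 ∧ orient q r r = 0 := by
    simp only [orient]; exact ⟨by ring, by ring⟩
  have h1 := planeOrient_eq_zero (p := q) (q := r) (fun z hz => ?_) hxi
  · have h2 : planeOrient q r (a • latticeToPlane u + b • latticeToPlane w) =
        a * planeOrient q r (latticeToPlane u) + b * planeOrient q r (latticeToPlane w) := by
      simp only [planeOrient, Prod.fst_add, Prod.snd_add, Prod.smul_fst, Prod.smul_snd,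
        smul_eq_mul]
      linear_combination -(((r.2 : ℝ) - q.2) * q.1 - ((r.1 : ℝ) - q.1) * q.2) * hab
    rw [planeOrient_latticeToPlane, planeOrient_latticeToPlane, ho', h1] at h2
    have hw' : (0 : ℝ) ≤ orient q r w := by
      simp only [Finset.mem_insert, Finset.mem_singleton] at hw
      rcases hw with rfl | rfl | rfl
      · rw [ho']; norm_num
      · rw [h0.1]; norm_num
      · rw [h0.2]; norm_num
    have := mul_nonneg hb hw'
    push_cast at h2
    linarith
  · simp only [Finset.mem_inter, Finset.mem_insert, Finset.mem_singleton] at hz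
    rcases hz with ⟨rfl | rfl | rfl, hz⟩
    · exact absurd hz hu'
    · exact h0.1
    · exact h0.2

theorem not_cross {d : ℕ} (hT : IsUnimodularTriangulation d T) (ht : t ∈ T) (ht' : t' ∈ T)
    {u w u' w' : ℤ × ℤ} (hu : u ∈ t) (hw : w ∈ t) (hu' : u' ∈ t') (hw' : w' ∈ t') :
    ¬ (orient u w u' * orient u w w' < 0 ∧ orient u' w' u * orient u' w' w < 0) := by
  rintro ⟨h1, h2⟩
  have hpt : ∃ a b : ℝ, 0 < a ∧ 0 < b ∧ a + b = 1 ∧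
      a • latticeToPlane u + b • latticeToPlane w ∈ latticeHull t' := by
    set A : ℝ := (orient u w u' : ℝ) with hA
    set B : ℝ := (orient u w w' : ℝ) with hB
    set P : ℝ := (orient u' w' u : ℝ) with hP
    set Q : ℝ := (orient u' w' w : ℝ) with hQ
    have hAB : A * B < 0 := by rw [hA, hB]; exact_mod_cast h1
    have hPQ : P * Q < 0 := by rw [hP, hQ]; exact_mod_cast h2
    have pos : ∀ {A B : ℝ}, A * B < 0 → 0 < A / (A - B) ∧ 0 < -B / (A - B) ∧
        A / (A - B) + -B / (A - B) = 1 ∧ A - B ≠ 0 := by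
      intro A B h
      have hne : A - B ≠ 0 := fun h' => by
        have : A = B := by linarith
        subst this; nlinarith [mul_self_nonneg A]
      refine ⟨?_, ?_, by field_simp; ring, hne⟩
      · rcases mul_neg_iff.1 h with ⟨ha, hb⟩ | ⟨ha, hb⟩
        · exact div_pos ha (by linarith)
        · exact div_pos_of_neg_of_neg ha (by linarith)
      · rcases mul_neg_iff.1 h with ⟨ha, hb⟩ | ⟨ha, hb⟩
        · exact div_pos (by linarith) (by linarith)
        · exact div_pos_of_neg_of_neg (by linarith) (by linarith)
    obtain ⟨q1, q2, q3, q4⟩ := pos hPQ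
    obtain ⟨r1, r2, r3, r4⟩ := pos hAB
    refine ⟨-Q / (P - Q), P / (P - Q), q2, q1, by linarith, ?_⟩
    have := convex_latticeHull _ (latticeToPlane_mem_latticeHull hu')
      (latticeToPlane_mem_latticeHull hw') r2.le r1.le (by linarith)
    convert this using 1
    have hd : A - B = -(P - Q) := by
      simp only [hA, hB, hP, hQ, orient]; push_cast; ring
    rw [hd]
    ext
    · simp only [latticeToPlane, Prod.fst_add, Prod.smul_fst, smul_eq_mul]
      field_simp
      simp only [hA, hB, hP, hQ, orient]; push_cast; ring
    · simp only [latticeToPlane, Prod.snd_add, Prod.smul_snd, smul_eq_mul]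
      field_simp
      simp only [hA, hB, hP, hQ, orient]; push_cast; ring
  obtain ⟨a, b, ha, hb, hab, hx⟩ := hpt
  have hut : u ∈ t' := hT.mem_of_combo_mem ht ht' hu hw ha hb.le hab hx
  have hwt : w ∈ t' := hT.mem_of_combo_mem ht ht' hw hu hb ha.le (by linarith)
    (by rwa [add_comm])
  have hne : u' ≠ w' := by
    rintro rfl
    exact absurd h2 (by simp [orient])
  obtain ⟨z, rfl, -⟩ := hT.exists_third_vertex ht' hu' hw' hne
  have h0 : ∀ a b : ℤ × ℤ, orient a b a = 0 ∧ orient a b b = 0 := fun a b => by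
    simp only [orient]; exact ⟨by ring, by ring⟩
  have hz : ∀ y ∈ ({u', w', z} : Finset (ℤ × ℤ)), orient u' w' y ≠ 0 → y = z := by
    intro y hy ho
    simp only [Finset.mem_insert, Finset.mem_singleton] at hy
    rcases hy with rfl | rfl | rfl
    · exact absurd (h0 _ _).1 ho
    · exact absurd (h0 _ _).2 ho
    · rfl
  obtain rfl := hz u hut (left_ne_zero_of_mul h2.ne)
  obtain rfl := hz w hwt (right_ne_zero_of_mul h2.ne)
  exact absurd h2 (not_lt.2 (mul_self_nonneg _))

theorem subset_quarticPoints (hT : IsUnimodularTriangulation 4 T) (ht : t ∈ T) :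
    t ⊆ quarticPoints := by
  intro q hq
  have h1 : latticeToPlane q ∈ ⋃ t ∈ T, convexHull ℝ (latticeToPlane '' (t : Set (ℤ × ℤ))) :=
    mem_biUnion ht (latticeToPlane_mem_latticeHull hq)
  rw [hT.cover, mem_quartic_triangle] at h1
  simp only [latticeToPlane] at h1
  rw [mem_quarticPoints]
  exact_mod_cast h1

theorem exists_mem_latticeHull (hT : IsUnimodularTriangulation 4 T) {x : ℝ × ℝ} (h1 : 0 ≤ x.1)
    (h2 : 0 ≤ x.2) (h3 : x.1 + x.2 ≤ 4) : ∃ t ∈ T, x ∈ latticeHull t := by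
  have := mem_quartic_triangle.2 ⟨h1, h2, h3⟩
  rw [← hT.cover] at this
  simpa [latticeHull] using this

/-- Every half-integral point of the triangle is the midpoint of two vertices of one triangle: its
doubled barycentric coordinates are non-negative integers with sum two. -/
theorem exists_add_eq (hT : IsUnimodularTriangulation 4 T) {s : ℤ × ℤ} (h1 : 0 ≤ s.1)
    (h2 : 0 ≤ s.2) (h3 : s.1 + s.2 ≤ 8) : ∃ t ∈ T, ∃ u ∈ t, ∃ w ∈ t, u + w = s := by
  have h1' : (0 : ℝ) ≤ s.1 := by exact_mod_cast h1
  have h2' : (0 : ℝ) ≤ s.2 := by exact_mod_cast h2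
  have h3' : (s.1 : ℝ) + s.2 ≤ 8 := by exact_mod_cast h3
  obtain ⟨t, ht, hx⟩ := hT.exists_mem_latticeHull (x := ((s.1 : ℝ) / 2, (s.2 : ℝ) / 2))
    (by simp; linarith) (by simp; linarith) (by simp; linarith)
  obtain ⟨p, q, r, rfl, ho⟩ := hT.exists_orient_eq_one ht
  have key : ∀ p q r : ℤ × ℤ, orient p q r = 1 →
      ((s.1 : ℝ) / 2, (s.2 : ℝ) / 2) ∈ latticeHull {p, q, r} →
      0 ≤ (q.1 - p.1) * (s.2 - 2 * p.2) - (q.2 - p.2) * (s.1 - 2 * p.1) := by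
    intro p q r ho hx
    have h := planeOrient_nonneg (p := p) (q := q) (fun z hz => ?_) hx
    · have : (0 : ℝ) ≤ (((q.1 - p.1) * (s.2 - 2 * p.2) - (q.2 - p.2) * (s.1 - 2 * p.1) : ℤ) : ℝ) := by
        simp only [planeOrient] at h
        push_cast
        linarith
      exact_mod_cast this
    · simp only [Finset.mem_insert, Finset.mem_singleton] at hz
      rcases hz with rfl | rfl | rfl
      · simp only [orient]; ring_nf; rfl
      · simp only [orient]; ring_nf; rfl
      · rw [ho]; norm_num
  have e1 := key p q r ho hx
  have e2 := key q r p (by rw [orient_rotate, ho])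
    (by convert hx using 2; ext; simp; tauto)
  have e3 := key r p q (by rw [← orient_rotate, ho])
    (by convert hx using 2; ext; simp; tauto)
  set A := (q.1 - p.1) * (s.2 - 2 * p.2) - (q.2 - p.2) * (s.1 - 2 * p.1) with hA
  set B := (r.1 - q.1) * (s.2 - 2 * q.2) - (r.2 - q.2) * (s.1 - 2 * q.1) with hB
  set D := (p.1 - r.1) * (s.2 - 2 * r.2) - (p.2 - r.2) * (s.1 - 2 * r.1) with hD
  simp only [orient] at ho
  have hsum : A + B + D = 2 := by
    rw [hA, hB, hD]; linear_combination 2 * ho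
  have hs1 : s.1 = A * r.1 + B * p.1 + D * q.1 := by
    rw [hA, hB, hD]; linear_combination -s.1 * ho
  have hs2 : s.2 = A * r.2 + B * p.2 + D * q.2 := by
    rw [hA, hB, hD]; linear_combination -s.2 * ho
  refine ⟨_, ht, ?_⟩
  have hcase : (A = 2 ∧ B = 0 ∧ D = 0) ∨ (A = 0 ∧ B = 2 ∧ D = 0) ∨ (A = 0 ∧ B = 0 ∧ D = 2) ∨
      (A = 1 ∧ B = 1 ∧ D = 0) ∨ (A = 1 ∧ B = 0 ∧ D = 1) ∨ (A = 0 ∧ B = 1 ∧ D = 1) := by omega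
  rcases hcase with h | h | h | h | h | h <;> rw [h.1, h.2.1, h.2.2] at hs1 hs2
  · exact ⟨r, by simp, r, by simp, Prod.ext (by simp; linarith) (by simp; linarith)⟩
  · exact ⟨p, by simp, p, by simp, Prod.ext (by simp; linarith) (by simp; linarith)⟩
  · exact ⟨q, by simp, q, by simp, Prod.ext (by simp; linarith) (by simp; linarith)⟩
  · exact ⟨r, by simp, p, by simp, Prod.ext (by simp; linarith) (by simp; linarith)⟩
  · exact ⟨r, by simp, q, by simp, Prod.ext (by simp; linarith) (by simp; linarith)⟩
  · exact ⟨p, by simp, q, by simp, Prod.ext (by simp; linarith) (by simp; linarith)⟩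

/-- A side at an interior lattice point belongs to a second triangle, since the points just beyond
its midpoint are covered as well. -/
theorem exists_ne_of_side (hT : IsUnimodularTriangulation 4 T) (ht : t ∈ T) {u w : ℤ × ℤ}
    (hu : u ∈ t) (hw : w ∈ t) (huw : u ≠ w) (hui : u ∈ interiorPoints) :
    ∃ t' ∈ T, t' ≠ t ∧ u ∈ t' ∧ w ∈ t' := by
  obtain ⟨z, htz, ho⟩ := hT.exists_third_vertex ht hu hw huw
  set m : ℝ × ℝ := (1 / 2 : ℝ) • latticeToPlane u + (1 / 2 : ℝ) • latticeToPlane w with hm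
  have hquart := hT.subset_quarticPoints ht
  have hz := mem_quarticPoints.1 (hquart (by simp [htz] : z ∈ t))
  have hw' := mem_quarticPoints.1 (hquart hw)
  have hu1 : 1 ≤ u.1 ∧ 1 ≤ u.2 ∧ u.1 + u.2 ≤ 3 := by
    exact (by decide : ∀ u ∈ interiorPoints, 1 ≤ u.1 ∧ 1 ≤ u.2 ∧ u.1 + u.2 ≤ 3) u hui
  have bz : (0 : ℝ) ≤ z.1 ∧ (0 : ℝ) ≤ z.2 ∧ (z.1 : ℝ) + z.2 ≤ 4 := by exact_mod_cast hz
  have bw : (0 : ℝ) ≤ w.1 ∧ (0 : ℝ) ≤ w.2 ∧ (w.1 : ℝ) + w.2 ≤ 4 := by exact_mod_cast hw'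
  have bu : (1 : ℝ) ≤ u.1 ∧ (1 : ℝ) ≤ u.2 ∧ (u.1 : ℝ) + u.2 ≤ 3 := by exact_mod_cast hu1
  have m1 : m.1 = (u.1 + w.1) / 2 := by simp [hm, latticeToPlane]; ring
  have m2 : m.2 = (u.2 + w.2) / 2 := by simp [hm, latticeToPlane]; ring
  have hmem : m ∈ ⋃ t' ∈ T.erase t, latticeHull t' := by
    have hcl : IsClosed (⋃ t' ∈ T.erase t, latticeHull t') :=
      Set.Finite.isClosed_biUnion (T.erase t).finite_toSet fun t' _ => isClosed_latticeHull t'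
    have hlim : Filter.Tendsto (fun ε : ℝ => m + ε • (m - latticeToPlane z))
        (nhdsWithin 0 (Ioi 0)) (nhds m) := by
      have : Filter.Tendsto (fun ε : ℝ => m + ε • (m - latticeToPlane z)) (nhds 0)
          (nhds (m + (0 : ℝ) • (m - latticeToPlane z))) :=
        Continuous.tendsto (by fun_prop) 0
      rw [zero_smul, add_zero] at this
      exact this.mono_left nhdsWithin_le_nhds
    refine hcl.mem_of_tendsto hlim ?_
    filter_upwards [Ioo_mem_nhdsGT (show (0 : ℝ) < 1 / 16 by norm_num)] with ε hε
    have f1 : (m + ε • (m - latticeToPlane z)).1 = m.1 + ε * (m.1 - z.1) := by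
      simp [latticeToPlane]
    have f2 : (m + ε • (m - latticeToPlane z)).2 = m.2 + ε * (m.2 - z.2) := by
      simp [latticeToPlane]
    have bound : ∀ {a : ℝ}, -4 ≤ a → a ≤ 4 → -(1 / 4) ≤ ε * a ∧ ε * a ≤ 1 / 4 := by
      intro a h1 h2
      constructor <;> nlinarith [hε.1, hε.2]
    obtain ⟨t', ht', hx⟩ := hT.exists_mem_latticeHull (x := m + ε • (m - latticeToPlane z))
      (by rw [f1]; linarith [(bound (a := m.1 - z.1) (by linarith) (by linarith)).1])
      (by rw [f2]; linarith [(bound (a := m.2 - z.2) (by linarith) (by linarith)).1])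
      (by
        rw [f1, f2]
        linarith [(bound (a := (m.1 - z.1) + (m.2 - z.2)) (by linarith) (by linarith)).2])
    refine mem_biUnion (Finset.mem_coe.2 (Finset.mem_erase.2 ⟨?_, ht'⟩)) hx
    rintro rfl
    -- The points beyond the midpoint are on the other side of the line through `u` and `w`.
    have hval : planeOrient u w (m + ε • (m - latticeToPlane z)) = -ε * orient u w z := by
      simp only [planeOrient, f1, f2, m1, m2, orient]; push_cast; ring
    have hval' : planeOrient w u (m + ε • (m - latticeToPlane z)) = -ε * orient w u z := by
      simp only [planeOrient, f1, f2, m1, m2, orient]; push_cast; ring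
    have hself : orient u w u = 0 ∧ orient u w w = 0 ∧ orient w u u = 0 ∧ orient w u w = 0 := by
      simp only [orient]; refine ⟨?_, ?_, ?_, ?_⟩ <;> ring
    rcases ho with ho | ho
    · have := planeOrient_nonneg (p := u) (q := w) (fun y hy => ?_) hx
      · rw [hval, ho] at this
        push_cast at this
        linarith [hε.1]
      · rw [htz] at hy
        simp only [Finset.mem_insert, Finset.mem_singleton] at hy
        rcases hy with rfl | rfl | rfl
        exacts [hself.1.ge, hself.2.1.ge, by rw [ho]; norm_num]
    · have ho' : orient w u z = 1 := by rw [orient_swap_left, ho]; norm_num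
      have := planeOrient_nonneg (p := w) (q := u) (fun y hy => ?_) hx
      · rw [hval', ho'] at this
        push_cast at this
        linarith [hε.1]
      · rw [htz] at hy
        simp only [Finset.mem_insert, Finset.mem_singleton] at hy
        rcases hy with rfl | rfl | rfl
        exacts [hself.2.2.1.ge, hself.2.2.2.ge, by rw [ho']; norm_num]
  simp only [mem_iUnion, exists_prop, Finset.mem_erase] at hmem
  obtain ⟨t', ⟨hne, ht'⟩, hx⟩ := hmem
  have hhalf : (0 : ℝ) < 1 / 2 := by norm_num
  exact ⟨t', ht', hne, hT.mem_of_combo_mem ht ht' hu hw hhalf hhalf.le (by norm_num) hx,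
    hT.mem_of_combo_mem ht ht' hw hu hhalf hhalf.le (by norm_num) (by rwa [add_comm])⟩

end IsUnimodularTriangulation

/-! ### Smooth tropical quartics as dual graphs -/

namespace PlaneTropicalCurve

variable {C : PlaneTropicalCurve}

theorem src_ne_tgt (e : C.E) : C.src e ≠ C.tgt e := by
  intro h
  have h1 := C.pos_tgt e
  rw [← h, left_eq_add, smul_eq_zero] at h1
  have h2 := h1.resolve_left (C.len_pos e).ne'
  simp only [latticeToPlane, Prod.mk_eq_zero, Int.cast_eq_zero] at h2
  have h3 := C.dir_primitive e
  rw [h2.1, h2.2] at h3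
  simp at h3

theorem IsLeafless.subset_skeletonEdges {S : Set C.E} (hS : C.IsLeafless S) :
    S ⊆ C.skeletonEdges := subset_sUnion_of_mem hS

theorem isLeafless_skeletonEdges : C.IsLeafless C.skeletonEdges := by
  rintro e ⟨S, hS, he⟩
  obtain ⟨⟨e₁, h₁, h₁'⟩, e₂, h₂, h₂'⟩ := hS e he
  exact ⟨⟨e₁, hS.subset_skeletonEdges h₁, h₁'⟩, e₂, hS.subset_skeletonEdges h₂, h₂'⟩

/-- The primitive outer normal of a side `u w` of a unimodular triangle `u w z` is the quarter turn
of `w - u`. -/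
theorem _root_.IsOuterFace.eq_of_orient {n u w z : ℤ × ℤ} {t : Finset (ℤ × ℤ)}
    (h : IsOuterFace n {u, w} t) (hn : Int.gcd n.1 n.2 = 1) (hz : z ∈ t)
    (ho : orient u w z = 1) : n.1 = w.2 - u.2 ∧ n.2 = u.1 - w.1 := by
  obtain ⟨hut, hu⟩ := (h u).1 (by simp)
  obtain ⟨hwt, hw⟩ := (h w).1 (by simp)
  have h1 := hu w hwt
  have h2 := hw u hut
  have hzn : z ∉ ({u, w} : Finset (ℤ × ℤ)) := by
    have := ne_of_orient_ne_zero (p := u) (q := w) (r := z) (by rw [ho]; norm_num)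
    simp only [Finset.mem_insert, Finset.mem_singleton]
    rintro (h' | h')
    exacts [this.2.2 h'.symm, this.2.1 h'.symm]
  have h3 : 0 < n.1 * (u.1 - z.1) + n.2 * (u.2 - z.2) := by
    by_contra hle
    exact hzn ((h z).2 ⟨hz, fun r hr => by linarith [hu r hr]⟩)
  have h4 : n.1 * (w.1 - u.1) + n.2 * (w.2 - u.2) = 0 := by linarith
  simp only [orient] at ho
  set k := n.1 * (u.1 - z.1) + n.2 * (u.2 - z.2) with hk
  have e1 : n.1 = k * (w.2 - u.2) := by
    rw [hk]; linear_combination -n.1 * ho + (z.2 - u.2) * h4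
  have e2 : n.2 = k * (u.1 - w.1) := by
    rw [hk]; linear_combination -n.2 * ho - (z.1 - u.1) * h4
  have hk1 : k = 1 := by
    have : k ∣ (Int.gcd n.1 n.2 : ℤ) :=
      Int.dvd_coe_gcd ⟨_, e1⟩ ⟨_, e2⟩
    rw [hn] at this
    exact Int.eq_one_of_dvd_one h3.le (by exact_mod_cast this)
  rw [hk1, one_mul] at e1 e2
  exact ⟨e1, e2⟩

namespace Duality

variable {T : Finset (Finset (ℤ × ℤ))} (dual : C.Duality T)

theorem exists_edge (hT : IsUnimodularTriangulation 4 T)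
    {v : C.V} {u w : ℤ × ℤ} (hu : u ∈ (dual.tri v).1) (hw : w ∈ (dual.tri v).1)
    (huw : u ≠ w) (hui : u ∈ interiorPoints) : ∃ e, (dual.side (Sum.inl e)).1 = {u, w} := by
  have hsub : ({u, w} : Finset (ℤ × ℤ)) ⊆ (dual.tri v).1 := by
    intro x; simp only [Finset.mem_insert, Finset.mem_singleton]; rintro (rfl | rfl) <;> assumption
  obtain ⟨x, hx⟩ := dual.side.surjective
    ⟨{u, w}, Finset.card_pair huw, _, (dual.tri v).2, hsub⟩
  have hx' : (dual.side x).1 = {u, w} := by rw [hx]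
  rcases x with e | r
  · exact ⟨e, hx'⟩
  · -- An unbounded edge would be dual to a side of a single triangle.
    exfalso
    obtain ⟨t', ht', hne, hu', hw'⟩ := hT.exists_ne_of_side (dual.tri v).2 hu hw huw hui
    obtain ⟨v', hv'⟩ := dual.tri.surjective ⟨t', ht'⟩
    have h1 := (dual.incident_ray r v).1 (hx'.trans_subset hsub)
    have h2 := (dual.incident_ray r v').1 (by
      rw [hx', hv']
      intro x; simp only [Finset.mem_insert, Finset.mem_singleton]
      rintro (rfl | rfl) <;> assumption)
    rw [h1, ← h2] at hne
    exact hne (by rw [hv'])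

/-- Around an interior lattice point of the triangulation every side is followed by another one, so
the boundaries of the cells survive in the skeleton. -/
theorem isLeafless_interior (hT : IsUnimodularTriangulation 4 T) :
    C.IsLeafless {e | ∃ x ∈ interiorPoints, x ∈ (dual.side (Sum.inl e)).1} := by
  have key : ∀ (e : C.E) (v : C.V) (x : ℤ × ℤ), x ∈ interiorPoints →
      x ∈ (dual.side (Sum.inl e)).1 → (dual.side (Sum.inl e)).1 ⊆ (dual.tri v).1 →
      ∃ e', (∃ x ∈ interiorPoints, x ∈ (dual.side (Sum.inl e')).1) ∧ e' ≠ e ∧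
        (C.src e' = v ∨ C.tgt e' = v) := by
    intro e v x hx hxe hsub
    obtain ⟨y, z, ht, ho⟩ := hT.exists_orient_eq_one_of_mem (dual.tri v).2 (hsub hxe)
    have hne := ne_of_orient_ne_zero (p := x) (q := y) (r := z) (by rw [ho]; norm_num)
    have hpair := (DualGraph.pair_ne_pair hne).2.1
    obtain ⟨w, hw, hxw, hse⟩ : ∃ w ∈ (dual.tri v).1, x ≠ w ∧
        ({x, w} : Finset (ℤ × ℤ)) ≠ (dual.side (Sum.inl e)).1 := by
      by_cases h : ({x, y} : Finset (ℤ × ℤ)) = (dual.side (Sum.inl e)).1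
      · exact ⟨z, by simp [ht], hne.2.2, fun h' => hpair (h.trans h'.symm)⟩
      · exact ⟨y, by simp [ht], hne.1, h⟩
    obtain ⟨e', he'⟩ := dual.exists_edge hT (hsub hxe) hw hxw hx
    refine ⟨e', ⟨x, hx, by simp [he']⟩, fun h => hse (by rw [← he', h]), ?_⟩
    have := (dual.incident_edge e' v).1 (by
      rw [he']
      intro a; simp only [Finset.mem_insert, Finset.mem_singleton]
      rintro (rfl | rfl); exacts [hsub hxe, hw])
    exact this.imp Eq.symm Eq.symm
  rintro e ⟨x, hx, hxe⟩
  exact ⟨key e _ x hx hxe ((dual.incident_edge e _).2 (.inl rfl)),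
    key e _ x hx hxe ((dual.incident_edge e _).2 (.inr rfl))⟩

/-- The bounded part of a smooth tropical quartic with its dual triangulation. -/
noncomputable def dualGraph (hT : IsUnimodularTriangulation 4 T) : DualGraph where
  V := C.V
  E := C.E
  finV := inferInstance
  finE := inferInstance
  src := C.src
  tgt := C.tgt
  len := C.len
  core := C.skeletonEdges
  tri v := (dual.tri v).1
  side e := (dual.side (Sum.inl e)).1
  pos v := (-(C.pos v).2, (C.pos v).1)
  len_pos := C.len_pos
  src_ne_tgt := src_ne_tgt
  unimodular v := hT.exists_orient_eq_one (dual.tri v).2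
  tri_subset v := hT.subset_quarticPoints (dual.tri v).2
  not_cross v v' _ _ _ _ hu hw hu' hw' :=
    hT.not_cross (dual.tri v).2 (dual.tri v').2 hu hw hu' hw'
  exists_add_eq s h1 h2 h3 := by
    obtain ⟨t, ht, h⟩ := hT.exists_add_eq h1 h2 h3
    obtain ⟨v, hv⟩ := dual.tri.surjective ⟨t, ht⟩
    exact ⟨v, by rw [hv]; exact h⟩
  side_card e := (dual.side (Sum.inl e)).2.1
  side_injective e e' h := Sum.inl_injective (dual.side.injective (Subtype.ext h))
  side_subset_tri := dual.incident_edge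
  exists_edge v u w hu hw huw hui := dual.exists_edge hT hu hw huw hui
  pos_src e u w z hs hz ho := by
    have hface := dual.normal_src e
    rw [hs] at hface
    obtain ⟨h1, h2⟩ := hface.eq_of_orient (C.dir_primitive e) hz ho
    rw [C.pos_tgt e]
    ext <;> simp [latticeToPlane, h1, h2]
    ring
  pos_tgt e u w z hs hz ho := by
    have hface := dual.normal_tgt e
    rw [hs] at hface
    obtain ⟨h1, h2⟩ := hface.eq_of_orient (by simpa using C.dir_primitive e) hz ho
    simp only [Prod.fst_neg, Prod.snd_neg] at h1 h2
    rw [C.pos_tgt e]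
    ext <;> simp [latticeToPlane, neg_eq_iff_eq_neg.1 h1, neg_eq_iff_eq_neg.1 h2]
    ring
  core_leafless := isLeafless_skeletonEdges
  mem_core _ x hx hxe := (dual.isLeafless_interior hT).subset_skeletonEdges ⟨x, hx, hxe⟩

theorem coreGraph_dualGraph (hT : IsUnimodularTriangulation 4 T) :
    (dual.dualGraph hT).coreGraph = C.skeleton := rfl

end Duality

end PlaneTropicalCurve

theorem theorem4p3 (C : PlaneTropicalCurve) (hC : C.IsSmoothOfDegree 4) :
    ¬ C.skeleton.IsHyperelliptic := by
  obtain ⟨T, hT, ⟨dual⟩⟩ := hC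
  rw [← dual.coreGraph_dualGraph hT]
  exact (dual.dualGraph hT).not_isHyperelliptic
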